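/- **Setting.** Let $\mathcal A$ be a unital normed $*$-algebra over $\mathbb C$ (for instance a unital Banach $*$-algebra) and let $(\mathcal H,D)$ be an odd theta-summable Fredholm module over $\mathcal A$: $\mathcal H$ is a Hilbert space with a continuous unital $*$-representation of $\mathcal A$, and $D$ is a (possibly unbounded) self-adjoint operator on $\mathcal H$ such that every $a\in\mathcal A$ preserves $\operatorname{dom} D$ and $[D,a]$ extends to a bounded operator with $\|[D,a]\|\le c\|a\|$ for a constant $c>0$ independent of $a$, and $e^{-tD^2}$ is of trace class for every $t>0$. Let $\mathcal P=\mathbb C[X]$ be the polynomial Hopf algebra with $X$ primitive, and let $\mathcal A$ be a $\mathcal P$-module algebra, i.e. $h(ab)=h_{(1)}(a)h_{(2)}(b)$ and $h(1)=\varepsilon(h)1$. Let $g\in U_N(\mathcal A)$ be a unitary; let $M_N(\mathcal A)$ act on $\mathcal H^N$, let $\mathcal P$ act on matrices entrywise, and write $D$ also for $D\otimes 1$ on $\mathcal H^N$. For $u\in[0,1]$ put $D_u=(1-u)D+u\,g^{-1}Dg$ and $e(t)=e^{-tD_u^2}$. **The cochain.** Let $\Delta^n=\{0=t_0\le t_1\le\dots\le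 t_n\le t_{n+1}=1\}$, with the cofaces $\delta_i$ that repeat the entry $t_i$ and the cyclic operator $\tau_n(t_1,\dots,t_n)=(t_2-t_1,\dots,t_n-t_1,1-t_1)$, and let $*$ be the point of $\Delta^0$. Let $$\varphi_{2n}=\frac{(-1)^n}{2^n n!}\sum_{r=0}^n\tau_{2n}^{2r}\delta_0^{2n}(*)\in\mathbb C[\Delta^{2n}],\qquad n\ge 0 .$$ Let $\eta(\mathbf t)=(X\mid \mathbf t)$ with $X\in C^1(\mathcal P)=\mathcal P$. On $C^n(\mathcal P)=\mathcal P^{\otimes n}$ let $d_0z=1\otimes z$, $d_{n+1}z=z\otimes 1$, and let $d_i$ ($1\le i\le n$) apply the coproduct to the $i$-th factor. Let $\cup$ be the external (Alexander-Whitney) cup product $\mathbf u_p\cup \mathbf v_q=d_{p+q}\cdots d_{p+1}\mathbf u_p\otimes \delta_{p-1}\cdots \delta_0\mathbf v_q$, or alternatively the identity-shuffle product $\mathbf u_p\cup \mathbf v_q=d_{p+q-1}\cdots d_{p}\mathbf u_p\otimes \delta_{p-1}\cdots \delta_0\mathbf v_q$ (so that $X\cup\mathbf v_{q}$ is $X\otimes1\otimes\cdots\otimes1\otimes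 \delta_0\mathbf v_q$, respectively $X_{(1)}\otimes\cdots\otimes X_{(q+1)}\otimes \delta_0\mathbf v_q$); the statement holds for both. Let $\chi$ be the linear map with $$\chi(h^1\otimes\cdots\otimes h^n\mid t_1,\dots,t_n)(a_0,\dots,a_n)=\operatorname{Tr}\bigl(a_0e(t_1)h^1(a_1)e(t_2-t_1)\cdots h^n(a_n)e(1-t_n)\bigr),\qquad a_i\in M_N(\mathcal A).$$ This defines an odd cochain $(\chi\circ\cup\circ\eta)(\varphi)$ with components in degrees $2n+1$. For an odd cochain $\phi=(\phi_{2n+1})_{n\ge0}$ let $$\langle\phi,g\rangle=\frac1{\sqrt{2\pi i}}\sum_{n\ge 0}(-1)^n n!\,\phi_{2n+1}(g^{-1},g,\dots,g^{-1},g).$$ **Theorem.** (1) For every $u\in[0,1]$ the operator $g^{-1}X(g)e(1)$ is of trace class, the series that defines $\langle(\chi\circ\cup\circ\eta)(\varphi),g\rangle$ converges absolutely, and $$\langle(\chi\circ\cup\circ\eta)(\varphi),g\rangle=\Bigl(\frac1{\sqrt{2\pi i}}\sum_{n=0}^\infty\frac{n+1}{2^n}\Bigr)\operatorname{Tr}\bigl(g^{-1}X(g)e(1)\bigr).$$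 (2) If moreover $X(g)$ acts on $\mathcal H^N$ as the commutator $[D,g]$, then $u\mapsto\langle(\chi\circ\cup\circ\eta)(\varphi),g\rangle$ is integrable on $[0,1]$, the spectral flow $\mathrm{sf}(D,g^{-1}Dg)$ along the path $(D_u)_{0\le u\le1}$ exists, and $$\int_0^1\langle(\chi\circ\cup\circ\eta)(\varphi),g\rangle\,du=\Bigl(\frac1{\sqrt{2i}}\sum_{n=0}^\infty\frac{n+1}{2^n}\Bigr)\,\mathrm{sf}(D,g^{-1}Dg).$$ Here the spectral flow is the net number of eigenvalues that cross $0$ upwards: $\sum_j\bigl(\dim E_{[0,a_j)}(D_{u_{j+1}})-\dim E_{[0,a_j)}(D_{u_j})\bigr)$ for any $0=u_0\le\dots\le u_k=1$ and $a_j\ge0$ such that $\pm a_j$ is not in the spectrum of $D_u$ for $u_j\le u\le u_{j+1}$, where $E_J(D_u)$ is the (finite dimensional) spectral subspace of $D_u$ for $J$. -/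

import Mathlib

open scoped TensorProduct Polynomial ComplexInnerProductSpace

noncomputable section

namespace OddPairing

/-! ## The cocyclic simplex -/

/-- The geometric `n`-simplex: sequences `0 = t₀ ≤ t₁ ≤ ⋯ ≤ tₙ ≤ tₙ₊₁ = 1`. -/
@[ext]
structure Simplex (n : ℕ) where
  t : Fin (n + 2) → ℝ
  mono : Monotone t
  zero : t 0 = 0
  last : t (Fin.last (n + 1)) = 1

/-- The unique point of the `0`-simplex. -/
def Simplex.pt : Simplex 0 where
  t := ![0, 1]
  mono := by
    intro i j h
    fin_cases i <;> fin_cases j <;> simp_all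
  zero := rfl
  last := rfl

/-- The coface `δᵢ`, `0 ≤ i ≤ n + 1`: the entry `tᵢ` is repeated.  As `t₀ = 0` and `tₙ₊₁ = 1`, the
map `δ₀` inserts a `0` at the front and `δₙ₊₁` a `1` at the end of `(t₁, …, tₙ)`. -/
def Simplex.coface {n : ℕ} (i : Fin (n + 2)) (x : Simplex n) : Simplex (n + 1) where
  t := fun m => x.t (i.predAbove m)
  mono := x.mono.comp (Fin.predAbove_right_monotone i)
  zero := by
    have : i.predAbove 0 = 0 := by simp
    rw [this, x.zero]
  last := by
    have : i.predAbove (Fin.last (n + 2)) = Fin.last (n + 1) := by simp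
    rw [this, x.last]

/-- The cyclic operator `τ (t₁, …, tₙ) = (t₂ - t₁, …, tₙ - t₁, 1 - t₁)`. -/
def Simplex.cyc {n : ℕ} (x : Simplex n) : Simplex n where
  t := Fin.snoc (α := fun _ => ℝ) (fun k : Fin (n + 1) => x.t k.succ - x.t 1) 1
  mono := by
    intro i j hij
    induction j using Fin.lastCases with
    | last =>
      induction i using Fin.lastCases with
      | last => exact le_rfl
      | cast i =>
        rw [Fin.snoc_castSucc, Fin.snoc_last]
        have h1 : x.t i.succ ≤ 1 := x.last ▸ x.mono (Fin.le_last _)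
        have h2 : 0 ≤ x.t 1 := x.zero ▸ x.mono (Fin.zero_le _)
        linarith
    | cast j =>
      induction i using Fin.lastCases with
      | last => exact absurd hij (not_le.2 (Fin.castSucc_lt_last j))
      | cast i =>
        rw [Fin.snoc_castSucc, Fin.snoc_castSucc]
        have h : x.t i.succ ≤ x.t j.succ :=
          x.mono (Fin.succ_le_succ_iff.2 (Fin.castSucc_le_castSucc_iff.1 hij))
        linarith
  zero := by
    have h : (0 : Fin (n + 2)) = (0 : Fin (n + 1)).castSucc := rfl
    rw [h, Fin.snoc_castSucc]
    simp
  last := by rw [Fin.snoc_last]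

/-- Transport along an equality of dimensions. -/
def Simplex.cast {m n : ℕ} (h : m = n) (x : Simplex m) : Simplex n := h ▸ x

/-- `δ₀ⁿ(∗) = (0, …, 0)`. -/
def Simplex.vertex : (n : ℕ) → Simplex n
  | 0 => Simplex.pt
  | n + 1 => Simplex.coface 0 (Simplex.vertex n)

/-- `p` applications of `δ₀`. -/
def Simplex.zeroFaces {q : ℕ} : (p : ℕ) → Simplex q → Simplex (q + p)
  | 0, x => x
  | p + 1, x => Simplex.coface 0 (Simplex.zeroFaces p x)

/-- The degree `n` cochains `ℂ[Δⁿ]` of the cocyclic simplex. -/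
abbrev SimplexCochain (n : ℕ) : Type := Simplex n →₀ ℂ

/-- The component in degree `2n` of the cochain `φ`:
`((-1)ⁿ / (2ⁿ n!)) ∑_{r=0}^{n} τ^{2r} δ₀^{2n}(∗)`; for `n = 0` this is the point `∗`. -/
def phi (n : ℕ) : SimplexCochain (2 * n) :=
  ((-1 : ℂ) ^ n / (2 ^ n * (n.factorial : ℂ))) •
    ∑ r ∈ Finset.range (n + 1),
      Finsupp.single (Simplex.cyc^[2 * r] (Simplex.vertex (2 * n))) (1 : ℂ)

/-! ## The polynomial Hopf algebra and its Hopf-cyclic cochains -/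

/-- The coproduct of the Hopf algebra `𝒫 = ℂ[X]`, with `X` primitive. -/
def comul : ℂ[X] →ₐ[ℂ] ℂ[X] ⊗[ℂ] ℂ[X] :=
  Polynomial.aeval (Polynomial.X ⊗ₜ[ℂ] 1 + 1 ⊗ₜ[ℂ] Polynomial.X)

/-- The counit of `𝒫 = ℂ[X]`. -/
def counit : ℂ[X] →ₐ[ℂ] ℂ := Polynomial.aeval 0

/-- The Hopf-cyclic cochains of `𝒫` in degree `n`, i.e. `𝒫^{⊗ n}`. -/
abbrev HopfCochain (n : ℕ) : Type := PiTensorProduct ℂ (fun _ : Fin n => ℂ[X])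

/-- `h ↦ 1 ⊗ ⋯ ⊗ h ⊗ ⋯ ⊗ 1`, with `h` in position `k`. -/
def inj {n : ℕ} (k : Fin n) : ℂ[X] →ₗ[ℂ] HopfCochain n :=
  (PiTensorProduct.tprod ℂ).toLinearMap (fun _ => (1 : ℂ[X])) k

/-- `h ↦ 1 ⊗ ⋯ ⊗ h₍₁₎ ⊗ h₍₂₎ ⊗ ⋯ ⊗ 1`, with the two legs in positions `k` and `l`. -/
def injComul {n : ℕ} (k l : Fin n) : ℂ[X] →ₗ[ℂ] HopfCochain n :=
  (TensorProduct.lift ((PiTensorProduct.mul (R := ℂ) (A := fun _ : Fin n => ℂ[X])).compl₁₂ (inj k) (inj l))).comp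
    comul.toLinearMap

/-- The coface `dᵢ`, `0 ≤ i ≤ n + 1`, of the Hopf-cocyclic object of `𝒫` with coefficients in the
modular pair `(ε, 1)`: `d₀ z = 1 ⊗ z`, `dₙ₊₁ z = z ⊗ 1`, and `dᵢ` applies the coproduct to the
`i`-th factor for `1 ≤ i ≤ n`.  (The factor with index `k : Fin n` is the `(k+1)`-st one.) -/
def HopfCochain.coface {n : ℕ} (i : Fin (n + 2)) : HopfCochain n →ₗ[ℂ] HopfCochain (n + 1) :=
  PiTensorProduct.lift
    ((MultilinearMap.mkPiAlgebra ℂ (Fin n) (HopfCochain (n + 1))).compLinearMap fun k =>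
      if (k : ℕ) + 1 < i then inj k.castSucc
      else if (k : ℕ) + 1 = i then injComul k.castSucc k.succ
      else inj k.succ)

/-- `q` applications of the last coface: `d_{p+q} ⋯ d_{p+1}`. -/
def HopfCochain.lastFaces {p : ℕ} : (q : ℕ) → HopfCochain p →ₗ[ℂ] HopfCochain (p + q)
  | 0 => LinearMap.id
  | q + 1 => (HopfCochain.coface (Fin.last (p + q + 1))).comp (HopfCochain.lastFaces q)

/-- The composition `d_{p+q-1} ⋯ d_p`. -/
def HopfCochain.shuffleFaces {p : ℕ} : (q : ℕ) → HopfCochain p →ₗ[ℂ] HopfCochain (p + q)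
  | 0 => LinearMap.id
  | q + 1 => (HopfCochain.coface (Fin.last (p + q)).castSucc).comp (HopfCochain.shuffleFaces q)

/-! ## The external cup product, and the map `η` -/

/-- The degree `n` cochains of `Diag(C(𝒫) ⊗ Δ)`. -/
abbrev DiagCochain (n : ℕ) : Type := HopfCochain n ⊗[ℂ] SimplexCochain n

/-- The type of external products of cochains. -/
abbrev ExternalProduct : Type :=
  (p q : ℕ) → HopfCochain p ⊗[ℂ] SimplexCochain q →ₗ[ℂ] DiagCochain (p + q)

/-- `d_{p-1} ⋯ d_0 = d_0^p` on `ℂ[Δ^q]`. -/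
def simplexFaces (p q : ℕ) : SimplexCochain q →ₗ[ℂ] SimplexCochain (p + q) :=
  Finsupp.lmapDomain ℂ ℂ fun x => (Simplex.zeroFaces p x).cast (Nat.add_comm q p)

/-- The external (Alexander-Whitney) cup product
`u ∪ v = d_{p+q} ⋯ d_{p+1} u ⊗ d_{p-1} ⋯ d_0 v`. -/
def cup : ExternalProduct := fun p q =>
  TensorProduct.map (HopfCochain.lastFaces q) (simplexFaces p q)

/-- The variant of the cup product given by the identity shuffle,
`u ∪' v = d_{p+q-1} ⋯ d_p u ⊗ d_{p-1} ⋯ d_0 v`; thus `X ∪' v` is the iterated coproduct of `X`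
tensored with `d_0 v`. -/
def cup' : ExternalProduct := fun p q =>
  TensorProduct.map (HopfCochain.shuffleFaces q) (simplexFaces p q)

/-- The map `η`, `t ↦ X ⊗ t`, with `X` regarded as an element of `C¹(𝒫) = 𝒫`. -/
def eta (q : ℕ) : SimplexCochain q →ₗ[ℂ] HopfCochain 1 ⊗[ℂ] SimplexCochain q :=
  TensorProduct.mk ℂ (HopfCochain 1) (SimplexCochain q)
    (PiTensorProduct.tprod ℂ fun _ => Polynomial.X)

/-! ## Operators on a Hilbert space -/

section Operators

variable {K : Type*} [NormedAddCommGroup K] [InnerProductSpace ℂ K]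

/-- Trace class operators: those of the form `z ↦ ∑ₖ ⟨yₖ, z⟩ xₖ` with `∑ₖ ‖xₖ‖ ‖yₖ‖ < ∞`. -/
def IsTraceClass (T : K →L[ℂ] K) : Prop :=
  ∃ x y : ℕ → K, Summable (fun k => ‖x k‖ * ‖y k‖) ∧ ∀ z, HasSum (fun k => ⟪y k, z⟫ • x k) (T z)

/-- The trace `∑ᵢ ⟨bᵢ, T bᵢ⟩` with respect to an orthonormal basis; on trace class operators it
does not depend on the basis. -/
def trace [CompleteSpace K] (T : K →L[ℂ] K) : ℂ :=
  ∑' i, ⟪(exists_hilbertBasis ℂ K).choose_spec.choose i,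
    T ((exists_hilbertBasis ℂ K).choose_spec.choose i)⟫

/-- `S` is the heat semigroup `t ↦ e^{-tD²}`: a strongly continuous semigroup on `[0, ∞)` whose
infinitesimal generator is `-D²`, with its natural domain.  (The values at `t < 0` are
irrelevant.) -/
structure IsHeatSemigroup (D : K →ₗ.[ℂ] K) (S : ℝ → K →L[ℂ] K) : Prop where
  map_zero : S 0 = 1
  map_add : ∀ s t, 0 ≤ s → 0 ≤ t → S (s + t) = S s * S t
  cont : ∀ x, ContinuousOn (fun t => S t x) (Set.Ici 0)
  generator : ∀ x y, Filter.Tendsto (fun t : ℝ => (t⁻¹ : ℝ) • (S t x - x))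
      (nhdsWithin 0 (Set.Ioi 0)) (nhds y) ↔
    ∃ (hx : x ∈ D.domain) (hDx : D ⟨x, hx⟩ ∈ D.domain), y = -D ⟨D ⟨x, hx⟩, hDx⟩

open Classical in
/-- The operator `e^{-tD²}`, for `t ≥ 0`. -/
def heat (D : K →ₗ.[ℂ] K) (t : ℝ) : K →L[ℂ] K :=
  if h : ∃ S, IsHeatSemigroup D S then h.choose t else 0

/-- The operator `v D w`, with domain `{x | w x ∈ dom D}`. -/
def sandwich (v : K →L[ℂ] K) (D : K →ₗ.[ℂ] K) (w : K →L[ℂ] K) : K →ₗ.[ℂ] K where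
  domain := D.domain.comap (w : K →ₗ[ℂ] K)
  toFun := (v : K →ₗ[ℂ] K).comp (D.toFun.comp
    ((w : K →ₗ[ℂ] K).restrict (q := D.domain) fun _ hx => hx))

/-- The bounded operator `T` extends the commutator `[D, a]`. -/
def Implements (D : K →ₗ.[ℂ] K) (a T : K →L[ℂ] K) : Prop :=
  ∀ x (hx : x ∈ D.domain), ∃ hax : a x ∈ D.domain, D ⟨a x, hax⟩ - a (D ⟨x, hx⟩) = T x

/-! ### Spectral flow -/

/-- The real number `c` lies in the resolvent set of the closed operator `D`. -/
def InResolventSet (D : K →ₗ.[ℂ] K) (c : ℝ) : Prop :=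
  Function.Bijective fun x : D.domain => D x - (c : ℂ) • (x : K)

/-- The eigenspace of `D` at the real number `c`. -/
def eigenspace (D : K →ₗ.[ℂ] K) (c : ℝ) : Submodule ℂ K :=
  (LinearMap.ker (D.toFun - (c : ℂ) • D.domain.subtype)).map D.domain.subtype

/-- The range of the spectral projection of `D` for a bounded set `J ⊆ ℝ`, for self-adjoint `D` with
compact resolvent: the sum of the eigenspaces with eigenvalue in `J`. -/
def spectralSubspace (D : K →ₗ.[ℂ] K) (J : Set ℝ) : Submodule ℂ K :=
  ⨆ c ∈ J, eigenspace D c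

/-- The integer `m` is the spectral flow along the path `(D_s)`, `0 ≤ s ≤ 1`, of self-adjoint
operators with compact resolvent: there are `0 = s₀ ≤ ⋯ ≤ s_k = 1` and `aᵢ ≥ 0` such that `± aᵢ` is
not in the spectrum of `D_s` for `sᵢ ≤ s ≤ sᵢ₊₁`, the spectral subspaces for `[-aᵢ, aᵢ]` are finite
dimensional there, and
`m = ∑ᵢ (dim E_{[0, aᵢ)}(D_{sᵢ₊₁}) - dim E_{[0, aᵢ)}(D_{sᵢ}))`. -/
def IsSpectralFlow (D : ℝ → K →ₗ.[ℂ] K) (m : ℤ) : Prop :=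
  ∃ (k : ℕ) (s : Fin (k + 1) → ℝ) (a : Fin k → ℝ),
    Monotone s ∧ s 0 = 0 ∧ s (Fin.last k) = 1 ∧ (∀ i, 0 ≤ a i) ∧
    (∀ i, ∀ r ∈ Set.Icc (s i.castSucc) (s i.succ),
      InResolventSet (D r) (a i) ∧ InResolventSet (D r) (-a i) ∧
      FiniteDimensional ℂ (spectralSubspace (D r) (Set.Icc (-a i) (a i)))) ∧
    m = ∑ i, ((Module.finrank ℂ (spectralSubspace (D (s i.succ)) (Set.Ico 0 (a i))) : ℤ) -
      Module.finrank ℂ (spectralSubspace (D (s i.castSucc)) (Set.Ico 0 (a i))))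

end Operators

/-! ## Fredholm modules -/

section Fredholm

variable {A : Type*} [NormedRing A] [NormedAlgebra ℂ A] [StarRing A] [StarModule ℂ A]
variable {H : Type*} [NormedAddCommGroup H] [InnerProductSpace ℂ H] [CompleteSpace H]

/-- `(H, D)`, with `A` acting on `H` by the unital `∗`-representation `ρ`, is an odd theta-summable
Fredholm module over `A`. -/
structure IsOddThetaSummable (ρ : A →⋆ₐ[ℂ] (H →L[ℂ] H)) (D : H →ₗ.[ℂ] H) : Prop where
  continuous : Continuous ρ
  selfAdjoint : IsSelfAdjoint D
  commutator : ∃ c > (0 : ℝ), ∀ a : A, ∃ T : H →L[ℂ] H, Implements D (ρ a) T ∧ ‖T‖ ≤ c * ‖a‖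
  theta : ∃ S, IsHeatSemigroup D S ∧ ∀ t, 0 < t → IsTraceClass (S t)

/-- `A` is a `𝒫`-module algebra: `h(ab) = h₍₁₎(a) h₍₂₎(b)` and `h(1) = ε(h) 1`. -/
structure IsModuleAlgebra (A : Type*) [Ring A] [Algebra ℂ A] [Module ℂ[X] A]
    [IsScalarTower ℂ ℂ[X] A] : Prop where
  smul_mul : ∀ (h : ℂ[X]) (a b : A), h • (a * b) =
    LinearMap.mul' ℂ A (TensorProduct.map
      ((LinearMap.toSpanSingleton ℂ[X] A a).restrictScalars ℂ)
      ((LinearMap.toSpanSingleton ℂ[X] A b).restrictScalars ℂ) (comul h))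
  smul_one : ∀ h : ℂ[X], h • (1 : A) = counit h • (1 : A)

/-- The Hilbert space `H ⊗ ℂᴺ = Hᴺ`. -/
abbrev Amp (H : Type*) (N : ℕ) : Type _ := PiLp 2 (fun _ : Fin N => H)

/-- The operator `D ⊗ 1` on `Hᴺ`. -/
def ampOp (N : ℕ) (D : H →ₗ.[ℂ] H) : Amp H N →ₗ.[ℂ] Amp H N where
  domain :=
    { carrier := {x | ∀ i, x i ∈ D.domain}
      add_mem' := fun hx hy i => D.domain.add_mem (hx i) (hy i)
      zero_mem' := fun _ => D.domain.zero_mem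
      smul_mem' := fun c _ hx i => D.domain.smul_mem c (hx i) }
  toFun :=
    { toFun := fun x => WithLp.toLp 2 fun i => D ⟨(x : Amp H N) i, x.2 i⟩
      map_add' := fun x y => by
        ext i
        exact D.map_add ⟨(x : Amp H N) i, x.2 i⟩ ⟨(y : Amp H N) i, y.2 i⟩
      map_smul' := fun c x => by
        ext i
        exact D.map_smul c ⟨(x : Amp H N) i, x.2 i⟩ }

/-- The representation of `M_N(A)` on `Hᴺ`: `(M x)ᵢ = ∑ⱼ Mᵢⱼ xⱼ`. -/
def ampRep (N : ℕ) (ρ : A →⋆ₐ[ℂ] (H →L[ℂ] H)) :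
    Matrix (Fin N) (Fin N) A →ₗ[ℂ] (Amp H N →L[ℂ] Amp H N) where
  toFun M := ((PiLp.continuousLinearEquiv 2 ℂ (fun _ : Fin N => H)).symm :
      (Fin N → H) →L[ℂ] Amp H N).comp
    (ContinuousLinearMap.pi fun i => ∑ j, (ρ (M i j)).comp (PiLp.proj 2 (fun _ : Fin N => H) j))
  map_add' M M' := by
    ext x i
    simp [Finset.sum_add_distrib]
  map_smul' c M := by
    ext x i
    simp [Finset.smul_sum]

/-! ## The characteristic map and the pairing -/

variable [Module ℂ[X] A] [IsScalarTower ℂ ℂ[X] A] {N : ℕ}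

/-- `h ↦ h(M)`, the action of `𝒫` on a matrix being entrywise. -/
def act (M : Matrix (Fin N) (Fin N) A) : ℂ[X] →ₗ[ℂ] Matrix (Fin N) (Fin N) A :=
  (LinearMap.toSpanSingleton ℂ[X] _ M).restrictScalars ℂ

/-- `h¹ ⊗ ⋯ ⊗ hⁿ ↦ a₀ e(t₁) h¹(a₁) e(t₂ - t₁) ⋯ e(tₙ - tₙ₋₁) hⁿ(aₙ) e(1 - tₙ)`. -/
def chiPoint (ρ : A →⋆ₐ[ℂ] (H →L[ℂ] H)) (e : ℝ → Amp H N →L[ℂ] Amp H N) {n : ℕ}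
    (a : Fin (n + 1) → Matrix (Fin N) (Fin N) A) (x : Simplex n) :
    HopfCochain n →ₗ[ℂ] (Amp H N →L[ℂ] Amp H N) :=
  (LinearMap.mulLeft ℂ (ampRep N ρ (a 0) * e (x.t 1 - x.t 0))).comp
    (PiTensorProduct.lift
      ((MultilinearMap.mkPiAlgebraFin ℂ n (Amp H N →L[ℂ] Amp H N)).compLinearMap fun k =>
        (LinearMap.mulRight ℂ (e (x.t k.succ.succ - x.t k.succ.castSucc))).comp
          ((ampRep N ρ).comp (act (a k.succ)))))

/-- The characteristic map `χ`, linear in its argument in `Diagⁿ`: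
`χ(h¹ ⊗ ⋯ ⊗ hⁿ | t₁, …, tₙ)(a₀, …, aₙ)
  = Tr(a₀ e(t₁) h¹(a₁) e(t₂ - t₁) ⋯ e(tₙ - tₙ₋₁) hⁿ(aₙ) e(1 - tₙ))`. -/
def chi (ρ : A →⋆ₐ[ℂ] (H →L[ℂ] H)) (e : ℝ → Amp H N →L[ℂ] Amp H N) {n : ℕ} (z : DiagCochain n)
    (a : Fin (n + 1) → Matrix (Fin N) (Fin N) A) : ℂ :=
  trace (TensorProduct.lift
    (Finsupp.linearCombination ℂ (fun x : Simplex n => chiPoint ρ e a x)).flip z)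

/-- The component in degree `2n + 1` of the odd cochain `(χ ∘ ∪ ∘ η)(φ)`. -/
def oddCochain (prod : ExternalProduct) (ρ : A →⋆ₐ[ℂ] (H →L[ℂ] H))
    (e : ℝ → Amp H N →L[ℂ] Amp H N) (n : ℕ) :
    (Fin (1 + 2 * n + 1) → Matrix (Fin N) (Fin N) A) → ℂ :=
  chi ρ e (prod 1 (2 * n) (eta (2 * n) (phi n)))

/-- The terms `(-1)ⁿ n! f_{2n+1}(g⁻¹, g, …, g⁻¹, g)` of the odd pairing. -/
def pairingTerm {R : Type*} [Monoid R] [StarMul R]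
    (f : (n : ℕ) → (Fin (1 + 2 * n + 1) → R) → ℂ) (g : unitary R) (n : ℕ) : ℂ :=
  (-1) ^ n * (n.factorial : ℂ) *
    f n (fun i => if Even (i : ℕ) then ((g⁻¹ : unitary R) : R) else (g : R))

/-- The pairing `⟨f, g⟩ = (2πi)^{-1/2} ∑ₙ (-1)ⁿ n! f_{2n+1}(g⁻¹, g, …, g⁻¹, g)` of an odd cochain
with a unitary. -/
def pairing {R : Type*} [Monoid R] [StarMul R]
    (f : (n : ℕ) → (Fin (1 + 2 * n + 1) → R) → ℂ) (g : unitary R) : ℂ :=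
  1 / (2 * Real.pi * Complex.I) ^ (1 / 2 : ℂ) * ∑' n, pairingTerm f g n

/-- The path `D_u = (1 - u) D + u g⁻¹ D g` on `Hᴺ`, for `g ∈ U_N(A)`. -/
def path (ρ : A →⋆ₐ[ℂ] (H →L[ℂ] H)) (D : H →ₗ.[ℂ] H) (g : unitary (Matrix (Fin N) (Fin N) A))
    (u : ℝ) : Amp H N →ₗ.[ℂ] Amp H N :=
  ((1 - u : ℝ) : ℂ) • ampOp N D + (u : ℂ) •
    sandwich (ampRep N ρ ((g⁻¹ : unitary (Matrix (Fin N) (Fin N) A)) : Matrix (Fin N) (Fin N) A))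
      (ampOp N D) (ampRep N ρ (g : Matrix (Fin N) (Fin N) A))

end Fredholm

end OddPairing

end

noncomputable section

namespace OddPairing

open Filter Topology

/-! ### Hilbert bases and diagonal operators -/

section Basis

variable {K : Type*} [NormedAddCommGroup K] [InnerProductSpace ℂ K] {ι : Type*}

/-! The evaluation of the pairing is algebra. The points $\delta_0\tau^{2r}\delta_0^{2n}(*)$ are
vertices of the simplex, so of the consecutive differences of the $t_i$ one is $1$ and the others
are $0$. Since $e(0)=1$, a single factor $e(1)$ survives, and the even power of $\tau$ puts it
directly behind a factor in a $g$ position. For the Alexander-Whitney product $X$ hits only the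
first $g$, and the remaining pairs $g^{-1}g$ cancel. For the shuffle product $X$ is distributed over
all positions by primitivity, and all but the first contribute $X(g^{-1})g+g^{-1}X(g)=X(1)=0$ in
pairs. Each of the $n+1$ points yields $g^{-1}X(g)e(1)$, and the prefactors leave $(n+1)/2^n$
(`exists_chiPoint_eq`, `pairingTerm_eq`).

The analytic half is $\int_0^1\operatorname{Tr}(Be^{-D_u^2})\,du=\sqrt\pi\,\mathrm{sf}$ for the
affine path $D_u=D+uB$ with $B=g^{-1}[D,g]$ bounded and symmetric. Let $f_a$ be the primitive of
$e^{-x^2}$ off $a$ that vanishes at $\pm\infty$; it jumps by $-\sqrt\pi$ at $a$ (`gaussStep`). While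
$a$ is not an eigenvalue of $D_u$, $\operatorname{Tr}f_a(D_u)$ has derivative
$\operatorname{Tr}(Be^{-D_u^2})$ (`IsEigenFamily.hasDerivAt_stepTrace`). As
$f_a-f_0=\sqrt\pi\,1_{[0,a)}$, integrating over each piece of a partition and adding gives
$\sqrt\pi\,\mathrm{sf}+\operatorname{Tr}f_0(D_1)-\operatorname{Tr}f_0(D_0)$
(`IsEigenFamily.integral_eq_of_isSpectralFlow`). The boundary terms cancel because $D_1=g^{-1}Dg$ is
unitarily equivalent to $D_0$ (`stepTrace_path_one`).

All traces are computed in eigenbases. Trace class heat operators make the resolvent compact, so $D$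
is diagonalizable (`exists_isEigenBasis_of_theta`), and this passes to bounded symmetric
perturbations (`IsPerturbation.exists_isEigenBasis`). Two eigenbases are compared through the doubly
stochastic matrix $p_{ij}=|\langle b_i,b'_j\rangle|^2$. With $\lambda_i,\lambda'_j$ the eigenvalues
of $D$ and $D'=D+E$, one has $(\lambda'_j-\lambda_i)\langle b_i,b'_j\rangle=\langle
b_i,Eb'_j\rangle$. The first two moments of $\lambda'_j-\lambda_i$ under $p$ are thus matrix
elements of $E$, and scalar Taylor estimates become trace estimates (`IsPerturbation.taylor`). -/

theorem basis_hasSum_norm_sq (b : HilbertBasis ι ℂ K) (x : K) :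
    HasSum (fun i => ‖⟪b i, x⟫‖ ^ 2) (‖x‖ ^ 2) := by
  have h := b.hasSum_inner_mul_inner x x
  have h2 := h.mapL Complex.reCLM
  have e : (fun i => ‖⟪b i, x⟫‖ ^ 2) = fun i => Complex.reCLM (⟪x, b i⟫ * ⟪b i, x⟫) := by
    funext i
    rw [← inner_conj_symm x (b i), Complex.reCLM_apply, ← Complex.normSq_eq_conj_mul_self,
      Complex.ofReal_re, Complex.normSq_eq_norm_sq]
  have e2 : ‖x‖ ^ 2 = Complex.reCLM ⟪x, x⟫ := by
    rw [inner_self_eq_norm_sq_to_K, Complex.reCLM_apply]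
    norm_cast
  rw [e, e2]
  exact h2

theorem basis_hasSum_norm_sq' (b : HilbertBasis ι ℂ K) (x : K) :
    HasSum (fun i => ‖⟪x, b i⟫‖ ^ 2) (‖x‖ ^ 2) := by
  simpa only [norm_inner_symm] using basis_hasSum_norm_sq b x

theorem basis_ext (b : HilbertBasis ι ℂ K) {x y : K} (h : ∀ i, ⟪b i, x⟫ = ⟪b i, y⟫) : x = y := by
  apply b.repr.injective
  ext i
  rw [b.repr_apply_apply, b.repr_apply_apply, h i]

theorem basis_exists (b : HilbertBasis ι ℂ K) {c : ι → ℂ} (hc : Summable fun i => ‖c i‖ ^ 2) :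
    ∃ x, ∀ i, ⟪b i, x⟫ = c i := by
  have hm : Memℓp c 2 := by
    rw [memℓp_gen_iff (by norm_num)]
    simpa using hc
  refine ⟨b.repr.symm ⟨c, hm⟩, fun i => ?_⟩
  rw [← b.repr_apply_apply, LinearIsometryEquiv.apply_symm_apply]

theorem basis_inner_self (b : HilbertBasis ι ℂ K) (i : ι) : ⟪b i, b i⟫ = 1 := by
  rw [inner_self_eq_norm_sq_to_K, b.orthonormal.1 i]; simp

theorem basis_inner_ne (b : HilbertBasis ι ℂ K) {i j : ι} (h : i ≠ j) : ⟪b i, b j⟫ = 0 :=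
  b.orthonormal.2 h

/-- Bessel-type bound for a bounded multiplier. -/
theorem summable_mul_norm_sq (b : HilbertBasis ι ℂ K) {m : ι → ℂ} {C : ℝ} (hm : ∀ i, ‖m i‖ ≤ C)
    (x : K) : Summable fun i => ‖m i * ⟪b i, x⟫‖ ^ 2 := by
  refine Summable.of_nonneg_of_le (fun _ => by positivity) (fun i => ?_)
    ((basis_hasSum_norm_sq b x).summable.mul_left (C ^ 2))
  rw [norm_mul, mul_pow]
  gcongr
  exact hm i

theorem exists_diagonal (b : HilbertBasis ι ℂ K) {m : ι → ℂ} {C : ℝ} (hC : 0 ≤ C)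
    (hm : ∀ i, ‖m i‖ ≤ C) :
    ∃ T : K →L[ℂ] K, ‖T‖ ≤ C ∧ ∀ x i, ⟪b i, T x⟫ = m i * ⟪b i, x⟫ := by
  choose f hf using fun x => basis_exists b (summable_mul_norm_sq b hm x)
  let L : K →ₗ[ℂ] K :=
    { toFun := f
      map_add' := fun x y => basis_ext b fun i => by
        rw [hf, inner_add_right, inner_add_right, hf, hf]; ring
      map_smul' := fun c x => basis_ext b fun i => by
        rw [hf, RingHom.id_apply, inner_smul_right, inner_smul_right, hf]; ring }
  have hL : ∀ x, ‖L x‖ ≤ C * ‖x‖ := fun x => by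
    refine (sq_le_sq₀ (norm_nonneg _) (by positivity)).1 ?_
    rw [mul_pow]
    refine hasSum_le (fun i => ?_) (basis_hasSum_norm_sq b (L x))
      ((basis_hasSum_norm_sq b x).mul_left (C ^ 2))
    change ‖⟪b i, f x⟫‖ ^ 2 ≤ _
    rw [hf, norm_mul, mul_pow]
    gcongr
    exact hm i
  exact ⟨L.mkContinuous C hL, LinearMap.mkContinuous_norm_le _ hC _, fun x i => hf x i⟩

open Classical in
/-- The diagonal operator with bounded eigenvalues `m`. -/
def diag (b : HilbertBasis ι ℂ K) (m : ι → ℂ) : K →L[ℂ] K :=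
  if h : ∃ C : ℝ, 0 ≤ C ∧ ∀ i, ‖m i‖ ≤ C then
    (exists_diagonal b h.choose_spec.1 h.choose_spec.2).choose else 0

theorem inner_diag (b : HilbertBasis ι ℂ K) {m : ι → ℂ} {C : ℝ} (hC : 0 ≤ C)
    (hm : ∀ i, ‖m i‖ ≤ C) (x : K) (i : ι) : ⟪b i, diag b m x⟫ = m i * ⟪b i, x⟫ := by
  have h : ∃ C : ℝ, 0 ≤ C ∧ ∀ i, ‖m i‖ ≤ C := ⟨C, hC, hm⟩
  rw [diag, dif_pos h]
  exact (exists_diagonal b h.choose_spec.1 h.choose_spec.2).choose_spec.2 x i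

theorem clm_eq_of_basis (b : HilbertBasis ι ℂ K) {S T : K →L[ℂ] K}
    (h : ∀ x i, ⟪b i, S x⟫ = ⟪b i, T x⟫) : S = T := by
  ext x
  exact basis_ext b (h x)

theorem clm_eq_of_apply_basis (b : HilbertBasis ι ℂ K) {S T : K →L[ℂ] K}
    (h : ∀ i, S (b i) = T (b i)) : S = T := by
  refine ContinuousLinearMap.ext_on (s := Set.range b) ?_ ?_
  · rw [Submodule.dense_iff_topologicalClosure_eq_top]
    exact b.dense_span
  · rintro _ ⟨i, rfl⟩
    exact h i

theorem diag_apply_basis (b : HilbertBasis ι ℂ K) {m : ι → ℂ} {C : ℝ} (hC : 0 ≤ C)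
    (hm : ∀ i, ‖m i‖ ≤ C) (i : ι) : diag b m (b i) = m i • b i := by
  refine basis_ext b fun j => ?_
  rw [inner_diag b hC hm, inner_smul_right]
  by_cases h : j = i
  · rw [h]
  · rw [basis_inner_ne b h]; simp

theorem norm_diag_le (b : HilbertBasis ι ℂ K) {m : ι → ℂ} {C : ℝ} (hC : 0 ≤ C)
    (hm : ∀ i, ‖m i‖ ≤ C) : ‖diag b m‖ ≤ C := by
  obtain ⟨T, hT, hT'⟩ := exists_diagonal b hC hm
  have : diag b m = T := clm_eq_of_basis b fun x i => by rw [inner_diag b hC hm, hT']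
  rw [this]
  exact hT

theorem isCompactOperator_finite_rank [CompleteSpace K] {κ : Type*} (s : Finset κ) (x y : κ → K) :
    IsCompactOperator (∑ k ∈ s, (innerSL ℂ (y k)).smulRight (x k) : K →L[ℂ] K) := by
  classical
  induction s using Finset.induction_on with
  | empty => exact isCompactOperator_zero
  | insert a s ha ih =>
    rw [Finset.sum_insert ha]
    refine IsCompactOperator.add ?_ ih
    have h : IsCompactOperator (ContinuousLinearMap.toSpanSingleton ℂ (x a)) :=
      IsCompactOperator.comp_clm (f := (ContinuousLinearMap.toSpanSingleton ℂ (x a) : ℂ → K))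
        (g := ContinuousLinearMap.id ℂ ℂ) (by
          have := (isCompactOperator_id_iff_finiteDimensional (𝕜 := ℂ) (E := ℂ)).2 inferInstance
          exact this.clm_comp (ContinuousLinearMap.toSpanSingleton ℂ (x a)))
    exact h.comp_clm (innerSL ℂ (y a))

theorem isCompactOperator_diag [CompleteSpace K] (b : HilbertBasis ι ℂ K) {m : ι → ℂ}
    (hm : Tendsto m cofinite (𝓝 0)) {C : ℝ} (hC : 0 ≤ C) (hmC : ∀ i, ‖m i‖ ≤ C) :
    IsCompactOperator (diag b m) := by
  classical
  refine isCompactOperator_of_tendsto (l := atTop)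
    (F := fun s : Finset ι => ∑ i ∈ s, (innerSL ℂ (b i)).smulRight (m i • b i)) ?_
    (Eventually.of_forall fun s => isCompactOperator_finite_rank s _ _)
  rw [Metric.tendsto_atTop]
  intro ε hε
  have hfin : {i | ¬ ‖m i‖ < ε / 2}.Finite := by
    have := (Metric.tendsto_nhds.1 hm (ε / 2) (by positivity))
    simpa [Filter.eventually_cofinite, dist_zero_right] using this
  refine ⟨hfin.toFinset, fun s hs => ?_⟩
  -- The difference is again diagonal, with entries only outside `s`, where they are smaller than `ε
  -- / 2`.
  have key : (∑ i ∈ s, (innerSL ℂ (b i)).smulRight (m i • b i) : K →L[ℂ] K) - diag b m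
      = diag b (fun i => if i ∈ s then 0 else - m i) := by
    refine clm_eq_of_apply_basis b fun j => ?_
    rw [diag_apply_basis b (C := C) hC (fun i => by split_ifs <;> simp [hmC, hC]),
      sub_apply, diag_apply_basis b hC hmC, sum_apply]
    have : ∀ i ∈ s, ((innerSL ℂ (b i)).smulRight (m i • b i) : K →L[ℂ] K) (b j) =
        if i = j then m j • b j else 0 := fun i _ => by
      rw [ContinuousLinearMap.smulRight_apply, innerSL_apply_apply]
      split_ifs with h
      · rw [h, basis_inner_self, one_smul]
      · rw [basis_inner_ne b h, zero_smul]
    rw [Finset.sum_congr rfl this, Finset.sum_ite_eq']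
    split_ifs <;> simp
  rw [dist_eq_norm, key]
  refine lt_of_le_of_lt (norm_diag_le b (C := ε / 2) (by positivity) fun i => ?_) (by linarith)
  split_ifs with h
  · simp; positivity
  · rw [norm_neg]
    by_contra h2
    exact h (hs (by simpa using le_of_lt (not_le.1 h2)))

/-! ### Trace class operators -/

theorem IsTraceClass.isCompactOperator [CompleteSpace K] {T : K →L[ℂ] K} (hT : IsTraceClass T) :
    IsCompactOperator T := by
  obtain ⟨x, y, hs, hxy⟩ := hT
  refine isCompactOperator_of_tendsto (l := atTop)
    (F := fun n : ℕ => ∑ k ∈ Finset.range n, (innerSL ℂ (y k)).smulRight (x k)) ?_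
    (Eventually.of_forall fun s => isCompactOperator_finite_rank _ _ _)
  have hs' : Summable fun k => ((innerSL ℂ (y k)).smulRight (x k) : K →L[ℂ] K) := by
    refine Summable.of_norm_bounded hs fun k => ?_
    rw [ContinuousLinearMap.norm_smulRight_apply, innerSL_apply_norm, mul_comm]
  have h : ∑' k, ((innerSL ℂ (y k)).smulRight (x k) : K →L[ℂ] K) = T := by
    ext z
    have := (hs'.hasSum).mapL (ContinuousLinearMap.apply ℂ K z)
    exact this.unique (by simpa using hxy z)
  rw [← h]
  exact hs'.hasSum.tendsto_sum_nat

theorem IsTraceClass.comp_left {T : K →L[ℂ] K} (hT : IsTraceClass T) (A : K →L[ℂ] K) :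
    IsTraceClass (A * T) := by
  obtain ⟨x, y, hs, hxy⟩ := hT
  refine ⟨fun k => A (x k), y, ?_, fun z => ?_⟩
  · refine Summable.of_nonneg_of_le (fun _ => by positivity) (fun k => ?_) (hs.mul_left ‖A‖)
    rw [← mul_assoc]
    gcongr
    exact A.le_opNorm _
  · simpa using (hxy z).mapL A

theorem summable_norm_inner_mul (b : HilbertBasis ι ℂ K) (x y : K) :
    Summable (fun i => ‖⟪y, b i⟫ * ⟪b i, x⟫‖) ∧ ∑' i, ‖⟪y, b i⟫ * ⟪b i, x⟫‖ ≤ ‖x‖ * ‖y‖ := by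
  have hx := basis_hasSum_norm_sq b x
  have hy := basis_hasSum_norm_sq' b y
  have hx' : Summable fun i => ‖⟪b i, x⟫‖ ^ (2 : ℝ) := by simpa using hx.summable
  have hy' : Summable fun i => ‖⟪y, b i⟫‖ ^ (2 : ℝ) := by simpa using hy.summable
  have hpq : (2 : ℝ).HolderConjugate 2 := Real.HolderConjugate.two_two
  simp only [norm_mul]
  refine ⟨Real.summable_mul_of_Lp_Lq_of_nonneg hpq (fun i => norm_nonneg _)
    (fun i => norm_nonneg _) hy' hx', (Real.inner_le_Lp_mul_Lq_tsum_of_nonneg hpq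
    (fun i => norm_nonneg _) (fun i => norm_nonneg _) hy' hx').trans (le_of_eq ?_)⟩
  have e1 : ∑' i, ‖⟪y, b i⟫‖ ^ (2 : ℝ) = ‖y‖ ^ 2 := by simpa using hy.tsum_eq
  have e2 : ∑' i, ‖⟪b i, x⟫‖ ^ (2 : ℝ) = ‖x‖ ^ 2 := by simpa using hx.tsum_eq
  rw [e1, e2, ← Real.sqrt_eq_rpow, ← Real.sqrt_eq_rpow, Real.sqrt_sq (norm_nonneg _),
    Real.sqrt_sq (norm_nonneg _), mul_comm]

/-- The trace of `∑ₖ ⟨yₖ, ·⟩ xₖ` computed in an arbitrary basis. -/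
theorem hasSum_inner_of_traceClass (b : HilbertBasis ι ℂ K) {T : K →L[ℂ] K} {x y : ℕ → K}
    (hs : Summable fun k => ‖x k‖ * ‖y k‖) (hT : ∀ z, HasSum (fun k => ⟪y k, z⟫ • x k) (T z)) :
    HasSum (fun i => ⟪b i, T (b i)⟫) (∑' k, ⟪y k, x k⟫) ∧
      Summable fun i => ‖⟪b i, T (b i)⟫‖ := by
  -- By Cauchy-Schwarz the row sums of $|F|$ are at most $\|x_k\|\|y_k\|$, so $F$ is absolutely
  -- summable. Its two iterated sums are the trace in the basis and $\sum_k\langle y_k,x_k\rangle$,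
  -- which does not mention the basis.
  let F : ℕ × ι → ℂ := fun p => ⟪y p.1, b p.2⟫ * ⟪b p.2, x p.1⟫
  have hF : Summable fun p => ‖F p‖ := by
    rw [summable_prod_of_nonneg fun _ => norm_nonneg _]
    refine ⟨fun k => (summable_norm_inner_mul b (x k) (y k)).1, ?_⟩
    exact Summable.of_nonneg_of_le (fun k => tsum_nonneg fun _ => norm_nonneg _)
      (fun k => (summable_norm_inner_mul b (x k) (y k)).2) hs
  have hF' : Summable F := hF.of_norm
  have hi : ∀ i, HasSum (fun k => F (k, i)) ⟪b i, T (b i)⟫ := fun i => by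
    have := (hT (b i)).mapL (innerSL ℂ (b i))
    simpa [F, inner_smul_right] using this
  have h1 : HasSum F (∑' k, ⟪y k, x k⟫) := by
    have h2 : ∑' p, F p = ∑' k, ⟪y k, x k⟫ := by
      rw [hF'.tsum_prod]
      exact tsum_congr fun k => b.tsum_inner_mul_inner (y k) (x k)
    rw [← h2]
    exact hF'.hasSum
  have hswap : Summable fun p : ι × ℕ => ‖F p.swap‖ := hF.prod_symm
  refine ⟨?_, ?_⟩
  · have h3 : HasSum (F ∘ Prod.swap) (∑' k, ⟪y k, x k⟫) :=
      ((Equiv.prodComm ι ℕ).hasSum_iff (f := F)).2 h1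
    exact h3.prod_fiberwise hi
  · have h4 := hswap.prod
    refine Summable.of_nonneg_of_le (fun _ => norm_nonneg _) (fun i => ?_) h4
    rw [← (hi i).tsum_eq]
    exact norm_tsum_le_tsum_norm (hswap.prod_factor i)

theorem IsTraceClass.summable_inner {T : K →L[ℂ] K} (hT : IsTraceClass T)
    (b : HilbertBasis ι ℂ K) : Summable fun i => ‖⟪b i, T (b i)⟫‖ := by
  obtain ⟨x, y, hs, h⟩ := hT
  exact (hasSum_inner_of_traceClass b hs h).2

theorem IsTraceClass.trace_eq [CompleteSpace K] {T : K →L[ℂ] K} (hT : IsTraceClass T)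
    (b : HilbertBasis ι ℂ K) : trace T = ∑' i, ⟪b i, T (b i)⟫ := by
  obtain ⟨x, y, hs, h⟩ := hT
  rw [(hasSum_inner_of_traceClass b hs h).1.tsum_eq]
  exact (hasSum_inner_of_traceClass _ hs h).1.tsum_eq

theorem isTraceClass_diag (b : HilbertBasis ι ℂ K) {m : ι → ℂ} (hm : Summable fun i => ‖m i‖) :
    IsTraceClass (diag b m) := by
  classical
  have hmC : ∀ i, ‖m i‖ ≤ ∑' i, ‖m i‖ := fun i => hm.le_tsum i fun _ _ => norm_nonneg _
  have hC : 0 ≤ ∑' i, ‖m i‖ := tsum_nonneg fun _ => norm_nonneg _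
  have hz : ∀ z, HasSum (fun i => ⟪b i, z⟫ • (m i • b i)) (diag b m z) := fun z => by
    have h := b.hasSum_repr (diag b m z)
    simp only [b.repr_apply_apply, inner_diag b hC hmC] at h
    convert h using 2 with i
    rw [smul_smul, mul_comm]
  have hcount : (Function.support fun i => ‖m i‖).Countable := hm.countable_support
  -- The index type may be uncountable, but a summable family has countable support; this is
  -- injected into `ℕ` and the families are extended by zero.
  obtain ⟨e, he⟩ := (Set.countable_coe_iff.2 hcount).exists_injective_nat
  refine ⟨Function.extend e (fun i => m i • b i) 0, Function.extend e (fun i => b i) 0, ?_,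
    fun z => ?_⟩
  · have : (fun k => ‖Function.extend e (fun i => m i • b i) 0 k‖ *
        ‖Function.extend e (fun i => b i) 0 k‖) = Function.extend e (fun i => ‖m i‖) 0 := by
      funext k
      by_cases hk : ∃ i, e i = k
      · obtain ⟨i, rfl⟩ := hk
        rw [he.extend_apply, he.extend_apply, he.extend_apply, norm_smul, b.orthonormal.1]
        ring
      · simp [Function.extend_apply' _ _ _ hk]
    rw [this, summable_extend_zero he]
    exact hm.subtype _
  · have : (fun k => ⟪Function.extend e (fun i => b i) 0 k, z⟫ •
        Function.extend e (fun i => m i • b i) 0 k) =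
        Function.extend e (fun i => ⟪b i, z⟫ • (m i • b i)) 0 := by
      funext k
      by_cases hk : ∃ i, e i = k
      · obtain ⟨i, rfl⟩ := hk
        rw [he.extend_apply, he.extend_apply, he.extend_apply]
      · simp [Function.extend_apply' _ _ _ hk]
    rw [this, hasSum_extend_zero he]
    refine (hasSum_subtype_iff_of_support_subset (f := fun i => ⟪b i, z⟫ • (m i • b i)) ?_).2 (hz z)
    intro i hi
    simp only [Function.mem_support, ne_eq, norm_eq_zero] at hi ⊢
    exact fun h => hi (by simp [h])

end Basis

/-! ### Diagonalization of self-adjoint operators with compact resolvent -/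

section EigenBasis

universe w

variable {K : Type w} [NormedAddCommGroup K] [InnerProductSpace ℂ K]

/-- `x` lies in the domain of `D` and `D x = y`. -/
def Maps (D : K →ₗ.[ℂ] K) (x y : K) : Prop := ∃ h : x ∈ D.domain, D ⟨x, h⟩ = y

theorem Maps.mem {D : K →ₗ.[ℂ] K} {x y : K} (h : Maps D x y) : x ∈ D.domain := h.1

theorem maps_apply {D : K →ₗ.[ℂ] K} {x : K} (h : x ∈ D.domain) : Maps D x (D ⟨x, h⟩) := ⟨h, rfl⟩

theorem Maps.add {D : K →ₗ.[ℂ] K} {x y x' y' : K} (h : Maps D x y) (h' : Maps D x' y') :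
    Maps D (x + x') (y + y') := by
  obtain ⟨h, rfl⟩ := h
  obtain ⟨h', rfl⟩ := h'
  exact ⟨D.domain.add_mem h h', D.map_add ⟨x, h⟩ ⟨x', h'⟩⟩

theorem Maps.smul {D : K →ₗ.[ℂ] K} {x y : K} (c : ℂ) (h : Maps D x y) :
    Maps D (c • x) (c • y) := by
  obtain ⟨h, rfl⟩ := h
  exact ⟨D.domain.smul_mem c h, D.map_smul c ⟨x, h⟩⟩

theorem Maps.sub {D : K →ₗ.[ℂ] K} {x y x' y' : K} (h : Maps D x y) (h' : Maps D x' y') :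
    Maps D (x - x') (y - y') := by
  have := h.add (h'.smul (-1))
  simpa [sub_eq_add_neg] using this

theorem Maps.unique {D : K →ₗ.[ℂ] K} {x y y' : K} (h : Maps D x y) (h' : Maps D x y') : y = y' := by
  obtain ⟨h, rfl⟩ := h
  obtain ⟨h', rfl⟩ := h'
  rfl

theorem Maps.congr {D : K →ₗ.[ℂ] K} {x y x' y' : K} (h : Maps D x y) (hx : x = x') (hy : y = y') :
    Maps D x' y' := hx ▸ hy ▸ h

theorem Maps.map_zero {D : K →ₗ.[ℂ] K} {y : K} (h : Maps D 0 y) : y = 0 :=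
  h.unique ((h.smul 0).congr (smul_zero _) (zero_smul _ _))

/-- Symmetry of a partially defined operator. -/
def IsSymm (D : K →ₗ.[ℂ] K) : Prop := ∀ x y x' y', Maps D x y → Maps D x' y' → ⟪y, x'⟫ = ⟪x, y'⟫

/-- Symmetry makes $\langle x,y\rangle$ real, so $\langle x,y+cix\rangle$ has imaginary part
$c\|x\|^2$; Cauchy-Schwarz finishes. -/
theorem IsSymm.lower_bound {D : K →ₗ.[ℂ] K} (hD : IsSymm D) (c : ℝ) {x y : K} (h : Maps D x y) :
    |c| * ‖x‖ ≤ ‖y + (c * Complex.I) • x‖ := by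
  have h1 := hD x y x y h h
  have him : (⟪x, y⟫ : ℂ).im = 0 := by
    have := congrArg Complex.im h1
    rw [← inner_conj_symm, Complex.conj_im] at this
    linarith
  have h2 : (⟪x, y + (c * Complex.I) • x⟫ : ℂ).im = c * ‖x‖ ^ 2 := by
    rw [inner_add_right, inner_smul_right, inner_self_eq_norm_sq_to_K, Complex.add_im, him]
    have : (c * Complex.I * ((‖x‖ : ℝ) : ℂ) ^ 2).im = c * ‖x‖ ^ 2 := by
      rw [← Complex.ofReal_pow, mul_right_comm, ← Complex.ofReal_mul]
      rw [Complex.mul_I_im, Complex.ofReal_re]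
    rw [zero_add]
    exact this
  have h3 : |c| * ‖x‖ ^ 2 ≤ ‖x‖ * ‖y + (c * Complex.I) • x‖ := by
    have := (Complex.abs_im_le_norm _).trans (norm_inner_le_norm x (y + (c * Complex.I) • x))
    rwa [h2, abs_mul, abs_of_nonneg (sq_nonneg ‖x‖)] at this
  rcases eq_or_ne (‖x‖) 0 with h0 | h0
  · rw [h0, mul_zero]; exact norm_nonneg _
  · have : 0 < ‖x‖ := lt_of_le_of_ne (norm_nonneg _) (Ne.symm h0)
    nlinarith

theorem mem_eigenspace {D : K →ₗ.[ℂ] K} {c : ℝ} {v : K} :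
    v ∈ eigenspace D c ↔ Maps D v ((c : ℂ) • v) := by
  constructor
  · rintro ⟨⟨x, hx⟩, h, rfl⟩
    refine ⟨hx, ?_⟩
    have h2 : D ⟨x, hx⟩ - (c : ℂ) • x = 0 := h
    exact sub_eq_zero.1 h2
  · rintro ⟨hx, h⟩
    refine ⟨⟨v, hx⟩, ?_, rfl⟩
    change D ⟨v, hx⟩ - (c : ℂ) • v = 0
    rw [h, sub_self]

/-- `b` is a Hilbert basis of eigenvectors of the self-adjoint operator `D`, with eigenvalues
`ev`. -/
structure IsEigenBasis {ι : Type*} (D : K →ₗ.[ℂ] K) (b : HilbertBasis ι ℂ K) (ev : ι → ℝ) :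
    Prop where
  mem_domain : ∀ x, x ∈ D.domain ↔ Summable fun i => ‖(ev i : ℂ) * ⟪b i, x⟫‖ ^ 2
  inner_apply : ∀ x y, Maps D x y → ∀ i, ⟪b i, y⟫ = ev i * ⟪b i, x⟫

/-- The operator `P` is the right inverse of `D + z`. -/
def RightInv (D : K →ₗ.[ℂ] K) (z : ℂ) (P : K → K) : Prop := ∀ y, Maps D (P y) (y - z • P y)

/-- The lower bound makes $D+ci$ injective, so a right inverse is also a left inverse. -/
theorem RightInv.apply_eq {D : K →ₗ.[ℂ] K} (hD : IsSymm D) {c : ℝ} (hc : c ≠ 0) {P : K → K}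
    (hP : RightInv D (c * Complex.I) P) {x y : K} (h : Maps D x y) :
    P (y + (c * Complex.I) • x) = x := by
  have h1 := hD.lower_bound c ((hP (y + (c * Complex.I) • x)).sub h)
  set w := P (y + (c * Complex.I) • x)
  have : y + (c * Complex.I) • x - (c * Complex.I) • w - y + (c * Complex.I) • (w - x) = 0 := by
    rw [smul_sub]; abel
  rw [this, norm_zero] at h1
  have h2 : 0 < |c| := abs_pos.2 hc
  have h3 : ‖w - x‖ = 0 := by nlinarith [norm_nonneg (w - x)]
  exact sub_eq_zero.1 (norm_eq_zero.1 h3)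

theorem ofReal_add_ne_zero (a : ℝ) {c : ℝ} (hc : c ≠ 0) : (a : ℂ) + c * Complex.I ≠ 0 := by
  intro h
  have := congrArg Complex.im h
  simp at this
  exact hc this

/-- Surjectivity of $D+ci$ forces the domain to be maximal. If $(\lambda_i\langle b_i,x\rangle)$ is
square summable, let $y$ have these coordinates and solve $(D+ci)w=y+cix$; comparing coordinates
gives $w=x$. -/
theorem isEigenBasis_of_maps {ι : Type*} {D : K →ₗ.[ℂ] K} (hD : IsSymm D) {c : ℝ} (hc : c ≠ 0)
    {P : K → K} (hP : RightInv D (c * Complex.I) P) (b : HilbertBasis ι ℂ K) (ev : ι → ℝ)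
    (hb : ∀ i, Maps D (b i) ((ev i : ℂ) • b i)) : IsEigenBasis D b ev := by
  have key : ∀ x y, Maps D x y → ∀ i, ⟪b i, y⟫ = ev i * ⟪b i, x⟫ := fun x y h i => by
    rw [← hD _ _ _ _ (hb i) h, inner_smul_left, Complex.conj_ofReal]
  refine ⟨fun x => ⟨fun hx => ?_, fun hx => ?_⟩, key⟩
  · simp only [← key x _ (maps_apply hx)]
    exact (basis_hasSum_norm_sq b _).summable
  · obtain ⟨y, hy⟩ := basis_exists b hx
    have h1 := hP (y + (c * Complex.I) • x)
    set w := P (y + (c * Complex.I) • x)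
    have : w = x := basis_ext b fun i => by
      have h2 := key _ _ h1 i
      rw [inner_sub_right, inner_add_right, hy, inner_smul_right, inner_smul_right] at h2
      have h3 : ((ev i : ℂ) + c * Complex.I) * (⟪b i, w⟫ - ⟪b i, x⟫) = 0 := by linear_combination -h2
      exact sub_eq_zero.1 ((mul_eq_zero.1 h3).resolve_left (ofReal_add_ne_zero _ hc))
    exact this ▸ h1.mem

/-- The eigenspace is the fixed space of the bounded operator $(a+ci)P$. -/
theorem isClosed_eigenspace {D : K →ₗ.[ℂ] K} (hD : IsSymm D) {c : ℝ} (hc : c ≠ 0)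
    {P : K →L[ℂ] K} (hP : RightInv D (c * Complex.I) P) (a : ℝ) :
    IsClosed (eigenspace D a : Set K) := by
  have : (eigenspace D a : Set K) = {v | P (((a : ℂ) + c * Complex.I) • v) = v} := by
    ext v
    rw [SetLike.mem_coe, mem_eigenspace]
    constructor
    · intro h
      have := hP.apply_eq hD hc h
      rwa [← add_smul] at this
    · intro h
      have h1 := hP (((a : ℂ) + c * Complex.I) • v)
      rw [show P (((a : ℂ) + c * Complex.I) • v) = v from h] at h1
      refine h1.congr rfl ?_
      rw [add_smul]; abel
  rw [this]
  exact isClosed_eq (by fun_prop) continuous_id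

/-- If $D^2v=rv$ with $v\ne0$, symmetry gives $r=\kappa^2$ with $\kappa=\|Dv\|/\|v\|$. If
$\kappa\neq0$, then $v$ is a multiple of the sum of $\kappa v\pm Dv$, which lie in the eigenspaces
for $\pm\kappa$; if $\kappa=0$, then $Dv=0$. -/
theorem mem_iSup_eigenspace {D : K →ₗ.[ℂ] K} (hD : IsSymm D) {v y : K} {r : ℂ} (h1 : Maps D v y)
    (h2 : Maps D y (r • v)) : v ∈ ⨆ a : ℝ, eigenspace D a := by
  rcases eq_or_ne v 0 with h0 | h0
  · rw [h0]; exact Submodule.zero_mem _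
  have hv : ‖v‖ ≠ 0 := norm_ne_zero_iff.2 h0
  set κ : ℝ := ‖y‖ / ‖v‖ with hκ
  have hr : r = (κ : ℂ) ^ 2 := by
    have h3 := hD _ _ _ _ h1 h1
    have h4 := hD _ _ _ _ h1 h2
    rw [inner_smul_right, inner_self_eq_norm_sq_to_K] at h4
    have h5 : ((‖y‖ : ℝ) : ℂ) ^ 2 = r * ((‖v‖ : ℝ) : ℂ) ^ 2 := by
      rw [inner_self_eq_norm_sq_to_K] at h4
      exact h4
    rw [hκ]
    push_cast
    rw [div_pow, h5, mul_div_assoc, div_self, mul_one]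
    exact pow_ne_zero 2 (Complex.ofReal_ne_zero.2 hv)
  rcases eq_or_ne κ 0 with hκ0 | hκ0
  · have hy : y = 0 := by
      have := (div_eq_zero_iff.1 (hκ ▸ hκ0)).resolve_right hv
      exact norm_eq_zero.1 this
    refine Submodule.mem_iSup_of_mem 0 (mem_eigenspace.2 (h1.congr rfl ?_))
    rw [hy]; simp
  · have hp : (κ : ℂ) • v + y ∈ eigenspace D κ := by
      refine mem_eigenspace.2 (((h1.smul (κ : ℂ)).add h2).congr rfl ?_)
      rw [hr, smul_add, smul_smul, ← sq, add_comm]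
    have hm : (κ : ℂ) • v - y ∈ eigenspace D (-κ) := by
      refine mem_eigenspace.2 (((h1.smul (κ : ℂ)).sub h2).congr rfl ?_)
      rw [hr, smul_sub, smul_smul, Complex.ofReal_neg, neg_smul, neg_mul, neg_smul, ← sq]
      abel
    have hk : (κ : ℂ) ≠ 0 := Complex.ofReal_ne_zero.2 hκ0
    have : v = (2 * κ : ℂ)⁻¹ • (((κ : ℂ) • v + y) + ((κ : ℂ) • v - y)) := by
      rw [add_add_sub_cancel, ← two_smul ℂ, smul_smul, smul_smul, mul_assoc,
        inv_mul_cancel₀ (mul_ne_zero two_ne_zero hk), one_smul]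
    rw [this]
    exact Submodule.smul_mem _ _ (Submodule.add_mem _
      (Submodule.mem_iSup_of_mem κ hp) (Submodule.mem_iSup_of_mem (-κ) hm))

theorem orthogonalFamily_eigenspace {D : K →ₗ.[ℂ] K} (hD : IsSymm D) :
    OrthogonalFamily ℂ (fun a : ℝ => eigenspace D a) fun a => (eigenspace D a).subtypeₗᵢ := by
  intro a a' h v w
  have h1 := hD _ _ _ _ (mem_eigenspace.1 v.2) (mem_eigenspace.1 w.2)
  rw [inner_smul_left, inner_smul_right, Complex.conj_ofReal] at h1
  have h2 : ((a : ℂ) - a') * ⟪(v : K), (w : K)⟫ = 0 := by linear_combination h1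
  exact (mul_eq_zero.1 h2).resolve_left (sub_ne_zero.2 fun h' => h (Complex.ofReal_injective h'))

theorem rightInv_adjoint {D : K →ₗ.[ℂ] K} (hD : IsSymm D) {c : ℝ} {P M : K → K}
    (hP : RightInv D (c * Complex.I) P) (hM : RightInv D (-(c * Complex.I)) M) (x y : K) :
    ⟪P x, y⟫ = ⟪x, M y⟫ := by
  have h := hD _ _ _ _ (hP x) (hM y)
  rw [inner_sub_left, inner_sub_right, inner_smul_left, inner_smul_right] at h
  simp only [map_mul, Complex.conj_ofReal, Complex.conj_I] at h
  linear_combination -h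

/-- The operator $MP=(D^2+c^2)^{-1}$ is compact and symmetric, so its eigenspaces span a dense
subspace. An eigenvector for $\mu\ne0$ satisfies $D^2v=(\mu^{-1}-c^2)v$ and splits into eigenvectors
of $D$; $\mu=0$ does not occur since $MP$ is injective. Orthonormal bases of the eigenspaces of $D$
are then glued. -/
theorem exists_isEigenBasis [CompleteSpace K] {D : K →ₗ.[ℂ] K} (hD : IsSymm D) {c : ℝ} (hc : c ≠ 0)
    {P M : K →L[ℂ] K} (hP : RightInv D (c * Complex.I) P) (hM : RightInv D (-(c * Complex.I)) M)
    (hcomp : IsCompactOperator (M * P : K →L[ℂ] K)) :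
    ∃ (ι : Type w) (b : HilbertBasis ι ℂ K) (ev : ι → ℝ), IsEigenBasis D b ev := by
  have hPM := rightInv_adjoint hD hP hM
  have hsymm : (M * P : K →L[ℂ] K).IsSymmetric := fun x y => by
    change ⟪M (P x), y⟫ = ⟪x, M (P y)⟫
    rw [← hPM, ← inner_conj_symm, ← hPM, inner_conj_symm]
  have htop := ContinuousLinearMap.orthogonalComplement_iSup_eigenspaces_eq_bot hcomp hsymm
  have hle : (⨆ μ, Module.End.eigenspace ((M * P : K →L[ℂ] K) : Module.End ℂ K) μ) ≤
      ⨆ a : ℝ, eigenspace D a := by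
    refine iSup_le fun μ v hv => ?_
    have hv' : M (P v) = μ • v := Module.End.mem_eigenspace_iff.1 hv
    have h1 := hM (P v)
    have h2 := hP v
    rcases eq_or_ne μ 0 with h0 | h0
    · rw [h0, zero_smul] at hv'
      rw [hv'] at h1
      have h3 : P v = 0 := by simpa using h1.map_zero
      rw [h3] at h2
      have h4 : v = 0 := by simpa using h2.map_zero
      rw [h4]; exact Submodule.zero_mem _
    · rw [hv'] at h1
      have h3 := h1.smul μ⁻¹
      rw [smul_smul, inv_mul_cancel₀ h0, one_smul] at h3
      set y := μ⁻¹ • (P v - -(c * Complex.I) • μ • v) with hy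
      have hy' : y = μ⁻¹ • P v + (c * Complex.I) • v := by
        rw [hy, smul_sub, neg_smul, smul_neg, sub_neg_eq_add, smul_smul, smul_smul,
          mul_right_comm, inv_mul_cancel₀ h0, one_mul]
      refine mem_iSup_eigenspace hD h3 (r := μ⁻¹ + (c * Complex.I) ^ 2)
        (((h2.smul μ⁻¹).add (h3.smul (c * Complex.I))).congr hy'.symm ?_)
      rw [hy']
      module
  have htop' : (⨆ a : ℝ, eigenspace D a)ᗮ = ⊥ :=
    le_bot_iff.1 ((Submodule.orthogonal_le hle).trans htop.le)
  have hcompl : ∀ a : ℝ, CompleteSpace (eigenspace D a) := fun a =>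
    (isClosed_eigenspace hD hc hP a).completeSpace_coe
  choose s β _ using fun a : ℝ => exists_hilbertBasis ℂ (eigenspace D a)
  have horth : Orthonormal ℂ fun i : (Σ a : ℝ, s a) => ((β i.1 i.2 : eigenspace D i.1) : K) :=
    (orthogonalFamily_eigenspace hD).orthonormal_sigma_orthonormal fun a => (β a).orthonormal
  have hbot : (Submodule.span ℂ (Set.range
      fun i : (Σ a : ℝ, s a) => ((β i.1 i.2 : eigenspace D i.1) : K)))ᗮ = ⊥ := by
    rw [eq_bot_iff, ← htop']
    intro x hx
    rw [Submodule.mem_orthogonal'] at hx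
    rw [← Submodule.iInf_orthogonal, Submodule.mem_iInf]
    intro a
    rw [Submodule.mem_orthogonal]
    intro v hv
    have h1 := (β a).hasSum_repr ⟨v, hv⟩
    have h2 := h1.mapL ((innerSL ℂ x).comp (eigenspace D a).subtypeL)
    have h3 : (fun i => ((innerSL ℂ x).comp (eigenspace D a).subtypeL)
        ((β a).repr ⟨v, hv⟩ i • β a i)) = 0 := by
      funext i
      have := hx _ (Submodule.subset_span ⟨⟨a, i⟩, rfl⟩)
      simp [this]
    rw [h3] at h2
    have h4 : ⟪x, v⟫ = 0 := h2.unique hasSum_zero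
    rw [← inner_conj_symm, h4, map_zero]
  let b := HilbertBasis.mkOfOrthogonalEqBot horth hbot
  have hb : ∀ i, b i = ((β i.1 i.2 : eigenspace D i.1) : K) := fun i => by
    rw [HilbertBasis.coe_mkOfOrthogonalEqBot]
  refine ⟨_, b, fun i => i.1, isEigenBasis_of_maps hD hc hP b _ fun i => ?_⟩
  rw [hb]
  exact mem_eigenspace.1 (β i.1 i.2).2

end EigenBasis

/-! ### Self-adjoint operators with trace class heat semigroup -/

section SelfAdjoint

universe w

variable {K : Type w} [NormedAddCommGroup K] [InnerProductSpace ℂ K]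

/-- The lower bound supplies linearity of the chosen solution map, through uniqueness, and the norm
bound $|c|^{-1}$. -/
theorem exists_rightInv {D : K →ₗ.[ℂ] K} (hD : IsSymm D) {c : ℝ} (hc : c ≠ 0)
    (hsurj : ∀ y, ∃ x z, Maps D x z ∧ z + (c * Complex.I) • x = y) :
    ∃ P : K →L[ℂ] K, RightInv D (c * Complex.I) P := by
  choose P z hP hz using hsurj
  have hP' : RightInv D (c * Complex.I) P := fun y => (hP y).congr rfl (eq_sub_of_add_eq (hz y))
  let L : K →ₗ[ℂ] K :=
    { toFun := P
      map_add' := fun x y => by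
        have := hP'.apply_eq hD hc ((hP' x).add (hP' y))
        rwa [smul_add, ← add_sub_add_comm, ← smul_add, sub_add_cancel] at this
      map_smul' := fun a x => by
        have := hP'.apply_eq hD hc ((hP' x).smul a)
        rwa [smul_comm _ a, ← smul_add, sub_add_cancel] at this }
  refine ⟨L.mkContinuous |c|⁻¹ fun x => ?_, hP'⟩
  have := hD.lower_bound c (hP' x)
  rw [sub_add_cancel] at this
  rw [inv_mul_eq_div, le_div_iff₀ (abs_pos.2 hc), mul_comm]
  exact this

theorem isSymm_of_isSelfAdjoint [CompleteSpace K] {D : K →ₗ.[ℂ] K} (hD : IsSelfAdjoint D) :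
    IsSymm D := by
  rintro x _ x' _ ⟨hx, rfl⟩ ⟨hx', rfl⟩
  have h := LinearPMap.adjoint_isFormalAdjoint hD.dense_domain
  rw [LinearPMap.isSelfAdjoint_def.1 hD] at h
  exact h ⟨x, hx⟩ ⟨x', hx'⟩

theorem maps_of_isSelfAdjoint [CompleteSpace K] {D : K →ₗ.[ℂ] K} (hD : IsSelfAdjoint D) {x y : K}
    (h : ∀ z w, Maps D z w → ⟪y, z⟫ = ⟪x, w⟫) : Maps D x y := by
  have h1 : x ∈ D.adjoint.domain :=
    LinearPMap.mem_adjoint_domain_of_exists x ⟨y, fun z => h z _ (maps_apply z.2)⟩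
  have h2 : D.adjoint ⟨x, h1⟩ = y :=
    LinearPMap.adjoint_apply_eq hD.dense_domain ⟨x, h1⟩ fun z => h z _ (maps_apply z.2)
  have h3 : Maps D.adjoint x y := ⟨h1, h2⟩
  rwa [LinearPMap.isSelfAdjoint_def.1 hD] at h3

/-- The range of $D+ci$ is closed, by the lower bound together with closedness of $D=D^*$. Its
orthogonal complement consists of $v$ with $Dv=civ$, and these vanish by the lower bound for $-c$.
-/
theorem surjective_of_isSelfAdjoint [CompleteSpace K] {D : K →ₗ.[ℂ] K} (hD : IsSelfAdjoint D)
    {c : ℝ} (hc : c ≠ 0) (y : K) : ∃ x z, Maps D x z ∧ z + (c * Complex.I) • x = y := by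
  have hs := isSymm_of_isSelfAdjoint hD
  let V : Submodule ℂ K := LinearMap.range (D.toFun + ((c : ℂ) * Complex.I) • D.domain.subtype)
  have hV : ∀ y, y ∈ V ↔ ∃ x z, Maps D x z ∧ z + (c * Complex.I) • x = y := fun y => by
    constructor
    · rintro ⟨x, rfl⟩
      exact ⟨x, _, maps_apply x.2, rfl⟩
    · rintro ⟨x, z, ⟨hx, rfl⟩, rfl⟩
      exact ⟨⟨x, hx⟩, rfl⟩
  have hclosed : IsClosed (V : Set K) := by
    refine isClosed_of_closure_subset fun y hy => ?_
    obtain ⟨s, hsV, hs_tendsto⟩ := mem_closure_iff_seq_limit.1 hy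
    choose x z hxz hs_eq using fun n => (hV _).1 (hsV n)
    have hb : ∀ m n, |c| * ‖x m - x n‖ ≤ ‖s m - s n‖ := fun m n => by
      have := hs.lower_bound c ((hxz m).sub (hxz n))
      rwa [smul_sub, ← add_sub_add_comm, hs_eq, hs_eq] at this
    have hcauchy : CauchySeq x := by
      rw [Metric.cauchySeq_iff']
      intro ε hε
      obtain ⟨N, hN⟩ := Metric.cauchySeq_iff'.1 hs_tendsto.cauchySeq (|c| * ε)
        (mul_pos (abs_pos.2 hc) hε)
      refine ⟨N, fun n hn => ?_⟩
      have h1 := hN n hn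
      rw [dist_eq_norm] at h1 ⊢
      exact lt_of_mul_lt_mul_left ((hb n N).trans_lt h1) (abs_nonneg c)
    obtain ⟨x₀, hx₀⟩ := cauchySeq_tendsto_of_complete hcauchy
    refine (hV y).2 ⟨x₀, y - (c * Complex.I) • x₀, maps_of_isSelfAdjoint hD fun v w hvw => ?_,
      sub_add_cancel _ _⟩
    have h1 : Tendsto (fun n => ⟪z n, v⟫) atTop (𝓝 ⟪y - (c * Complex.I) • x₀, v⟫) := by
      have : z = fun n => s n - (c * Complex.I) • x n := funext fun n => eq_sub_of_add_eq (hs_eq n)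
      rw [this]
      exact (hs_tendsto.sub (hx₀.const_smul _)).inner tendsto_const_nhds
    have h2 : Tendsto (fun n => ⟪x n, w⟫) atTop (𝓝 ⟪x₀, w⟫) := hx₀.inner tendsto_const_nhds
    refine tendsto_nhds_unique h1 (h2.congr fun n => (hs _ _ _ _ (hxz n) hvw).symm)
  have hbot : Vᗮ = ⊥ := by
    refine (Submodule.eq_bot_iff _).2 fun v hv => ?_
    have h1 : Maps D v ((c * Complex.I) • v) := maps_of_isSelfAdjoint hD fun z w hzw => by
      have := (Submodule.mem_orthogonal' _ _).1 hv _ ((hV _).2 ⟨z, w, hzw, rfl⟩)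
      rw [inner_add_right, inner_smul_right] at this
      rw [inner_smul_left]
      simp only [map_mul, Complex.conj_ofReal, Complex.conj_I]
      linear_combination -this
    have h2 := hs.lower_bound (-c) h1
    rw [← add_smul] at h2
    have h3 : (c : ℂ) * Complex.I + ((-c : ℝ) : ℂ) * Complex.I = 0 := by push_cast; ring
    rw [h3, zero_smul, norm_zero, abs_neg] at h2
    have : ‖v‖ ≤ 0 := by
      by_contra h
      exact absurd h2 (not_le.2 (mul_pos (abs_pos.2 hc) (not_le.1 h)))
    exact norm_le_zero_iff.1 this
  have hcV : CompleteSpace V := hclosed.completeSpace_coe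
  have htop : V = ⊤ := Submodule.orthogonal_eq_bot_iff.1 hbot
  exact (hV y).1 (htop ▸ Submodule.mem_top)

/-! ### The heat semigroup -/

/-- Writing $S_t=S_sS_{t-s}$ reduces the right derivative at $s$ to the generator at $0$, applied
before $S_s$. No invariance of the domain under the semigroup is needed. -/
theorem IsHeatSemigroup.commute {D : K →ₗ.[ℂ] K} {S : ℝ → K →L[ℂ] K} (hS : IsHeatSemigroup D S)
    {x y z : K} (h1 : Maps D x y) (h2 : Maps D y z) {s : ℝ} (hs : 0 ≤ s) :
    HasDerivWithinAt (fun t => S t x) (-(S s z)) (Set.Ici s) s := by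
  obtain ⟨hx, rfl⟩ := h1
  obtain ⟨hy, rfl⟩ := h2
  have h0 := (hS.generator x (-D ⟨D ⟨x, hx⟩, hy⟩)).2 ⟨hx, hy, rfl⟩
  have h1 := ((S s).continuous.tendsto _).comp h0
  rw [map_neg] at h1
  rw [← hasDerivWithinAt_Ioi_iff_Ici, hasDerivWithinAt_iff_tendsto_slope' (by simp)]
  have hsub : Tendsto (fun t => t - s) (𝓝[>] s) (𝓝[>] 0) := by
    refine tendsto_nhdsWithin_iff.2 ⟨?_, ?_⟩
    · have : Tendsto (fun t : ℝ => t - s) (𝓝 s) (𝓝 (s - s)) := tendsto_id.sub tendsto_const_nhds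
      rw [sub_self] at this
      exact this.mono_left nhdsWithin_le_nhds
    · filter_upwards [self_mem_nhdsWithin] with t ht
      exact sub_pos.2 (Set.mem_Ioi.1 ht)
  refine (h1.comp hsub).congr' ?_
  filter_upwards [self_mem_nhdsWithin] with t ht
  have hts : 0 ≤ t - s := (sub_pos.2 (Set.mem_Ioi.1 ht)).le
  have : S t = S s * S (t - s) := by rw [← hS.map_add s (t - s) hs hts, add_sub_cancel]
  simp only [Function.comp_apply, slope_def_module, this]
  rw [ContinuousLinearMap.map_smul_of_tower, map_sub]
  rfl

/-- The function $s\mapsto e^{sa^2}S_sv$ is continuous with right derivative zero, hence constant.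
-/
theorem IsHeatSemigroup.apply_eigenvector {D : K →ₗ.[ℂ] K} {S : ℝ → K →L[ℂ] K}
    (hS : IsHeatSemigroup D S) {v : K} {a : ℝ} (hv : Maps D v ((a : ℂ) • v)) {t : ℝ} (ht : 0 ≤ t) :
    S t v = (Real.exp (-t * a ^ 2) : ℂ) • v := by
  have hcont : ContinuousOn (fun s => Real.exp (s * a ^ 2) • S s v) (Set.Icc 0 t) :=
    ContinuousOn.smul (f := fun s : ℝ => Real.exp (s * a ^ 2)) (by fun_prop) ((hS.cont v).mono Set.Icc_subset_Ici_self)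
  have h := constant_of_has_deriv_right_zero hcont (fun s hs => by
    have h1 := hS.commute hv (hv.smul (a : ℂ)) hs.1
    have h2 : HasDerivWithinAt (fun s => Real.exp (s * a ^ 2)) (Real.exp (s * a ^ 2) * (1 * a ^ 2))
        (Set.Ici s) s := (((hasDerivAt_id s).mul_const (a ^ 2)).exp).hasDerivWithinAt
    refine (h2.smul h1).congr_deriv ?_
    rw [map_smul, map_smul, smul_smul, ← Complex.ofReal_mul, Complex.coe_smul]
    module) t ⟨ht, le_rfl⟩
  simp only [zero_mul, Real.exp_zero, one_smul, hS.map_zero, one_apply_eq_self] at h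
  conv_rhs => rw [← h]
  rw [Complex.coe_smul, smul_smul, ← Real.exp_add]
  simp

/-- For $R=MP=(D^2-z^2)^{-1}$ the operator $D^2R=1+z^2R$ is bounded, so $\|S_tR-R\|=O(t)$. Thus $R$
is a norm limit of the compact operators $S_tR$. -/
theorem IsHeatSemigroup.isCompactOperator_resolvent [CompleteSpace K] {D : K →ₗ.[ℂ] K}
    {S : ℝ → K →L[ℂ] K} (hS : IsHeatSemigroup D S) (hcomp : ∀ t, 0 < t → IsCompactOperator (S t))
    {P M : K →L[ℂ] K} {z : ℂ} (hP : RightInv D z P) (hM : RightInv D (-z) M) :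
    IsCompactOperator (M * P : K →L[ℂ] K) := by
  set R := M * P with hR
  -- Strong continuity bounds each orbit on the compact interval; the uniform boundedness principle
  -- makes the bound uniform.
  obtain ⟨C, hC⟩ : ∃ C, ∀ s : Set.Icc (0 : ℝ) 1, ‖S s‖ ≤ C := by
    refine banach_steinhaus fun x => ?_
    obtain ⟨C, hC⟩ := isCompact_Icc.exists_bound_of_continuousOn
      ((hS.cont x).mono (Set.Icc_subset_Ici_self : Set.Icc (0 : ℝ) 1 ⊆ _))
    exact ⟨C, fun s => hC s s.2⟩
  have hC0 : 0 ≤ C := (norm_nonneg _).trans (hC ⟨0, by simp⟩)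
  have hmaps : ∀ x, ∃ y, Maps D (R x) y ∧ Maps D y (x + z ^ 2 • R x) := fun x => by
    refine ⟨P x + z • R x, (hM (P x)).congr rfl ?_, ((hP x).add ((hM (P x)).smul z)).congr ?_ ?_⟩
    · rw [neg_smul, sub_neg_eq_add]; rfl
    · rfl
    · change x - z • P x + z • (P x - -z • R x) = _
      module
  have hbound : ∀ x, ∀ t ∈ Set.Icc (0 : ℝ) 1,
      ‖(S t * R - R) x‖ ≤ C * (1 + ‖z ^ 2‖ * ‖R‖) * t * ‖x‖ := fun x t ht => by
    obtain ⟨y, h1, h2⟩ := hmaps x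
    have h := norm_image_sub_le_of_norm_deriv_right_le_segment (f := fun t => S t (R x))
      (f' := fun t => -(S t (x + z ^ 2 • R x))) (C := C * (1 + ‖z ^ 2‖ * ‖R‖) * ‖x‖) (a := 0) (b := 1)
      ((hS.cont (R x)).mono Set.Icc_subset_Ici_self)
      (fun s hs => hS.commute h1 h2 hs.1) (fun s hs => by
        rw [norm_neg]
        have hs' : s ∈ Set.Icc (0 : ℝ) 1 := ⟨hs.1, hs.2.le⟩
        calc ‖S s (x + z ^ 2 • R x)‖ ≤ ‖S s‖ * ‖x + z ^ 2 • R x‖ := (S s).le_opNorm _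
          _ ≤ C * (‖x‖ + ‖z ^ 2‖ * (‖R‖ * ‖x‖)) := by
            refine mul_le_mul (hC ⟨s, hs'⟩) ((norm_add_le _ _).trans ?_) (norm_nonneg _) hC0
            rw [norm_smul]
            gcongr
            exact R.le_opNorm x
          _ = _ := by ring) t ht
    simp only [hS.map_zero, sub_zero, one_apply_eq_self] at h
    refine h.trans (le_of_eq ?_)
    ring
  refine isCompactOperator_of_tendsto (l := 𝓝[>] (0 : ℝ)) (F := fun t => S t * R) ?_ ?_
  · rw [tendsto_iff_norm_sub_tendsto_zero]
    have h1 : Tendsto (fun t : ℝ => C * (1 + ‖z ^ 2‖ * ‖R‖) * t) (𝓝[>] 0) (𝓝 0) := by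
      have : Tendsto (fun t : ℝ => C * (1 + ‖z ^ 2‖ * ‖R‖) * t) (𝓝 0)
          (𝓝 (C * (1 + ‖z ^ 2‖ * ‖R‖) * 0)) := tendsto_const_nhds.mul tendsto_id
      rw [mul_zero] at this
      exact this.mono_left nhdsWithin_le_nhds
    refine squeeze_zero' (Eventually.of_forall fun _ => norm_nonneg _) ?_ h1
    filter_upwards [Ioc_mem_nhdsGT (zero_lt_one' ℝ)] with t ht
    have ht' : t ∈ Set.Icc (0 : ℝ) 1 := ⟨ht.1.le, ht.2⟩
    exact ContinuousLinearMap.opNorm_le_bound _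
      (mul_nonneg (mul_nonneg hC0 (by positivity)) ht'.1) fun x => hbound x t ht'
  · filter_upwards [self_mem_nhdsWithin] with t ht
    exact (hcomp t ht).comp_clm R

theorem IsEigenBasis.maps_basis {ι : Type*} {D : K →ₗ.[ℂ] K} {b : HilbertBasis ι ℂ K} {ev : ι → ℝ}
    (h : IsEigenBasis D b ev) (i : ι) : Maps D (b i) ((ev i : ℂ) • b i) := by
  classical
  have hmem : b i ∈ D.domain := by
    rw [h.mem_domain]
    refine summable_of_ne_finset_zero (s := {i}) fun j hj => ?_
    rw [basis_inner_ne b (by simpa using hj)]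
    simp
  refine (maps_apply hmem).congr rfl (basis_ext b fun j => ?_)
  rw [h.inner_apply _ _ (maps_apply hmem), inner_smul_right]
  by_cases hj : j = i
  · rw [hj]
  · rw [basis_inner_ne b hj]; simp

theorem summable_exp_of_heat {ι : Type*} {D : K →ₗ.[ℂ] K} {b : HilbertBasis ι ℂ K}
    {ev : ι → ℝ} (h : IsEigenBasis D b ev) {S : ℝ → K →L[ℂ] K} (hS : IsHeatSemigroup D S) {t : ℝ}
    (ht : 0 ≤ t) (htr : IsTraceClass (S t)) : Summable fun i => Real.exp (-t * ev i ^ 2) := by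
  refine (htr.summable_inner b).congr fun i => ?_
  rw [hS.apply_eigenvector (h.maps_basis i) ht, inner_smul_right, basis_inner_self, mul_one,
    Complex.norm_real, Real.norm_of_nonneg (Real.exp_pos _).le]

/-- A self-adjoint operator with trace class heat semigroup has a Hilbert basis of eigenvectors. -/
theorem exists_isEigenBasis_of_theta [CompleteSpace K] {D : K →ₗ.[ℂ] K} (hD : IsSelfAdjoint D)
    (hθ : ∃ S, IsHeatSemigroup D S ∧ ∀ t, 0 < t → IsTraceClass (S t)) :
    ∃ (ι : Type w) (b : HilbertBasis ι ℂ K) (ev : ι → ℝ), IsEigenBasis D b ev ∧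
      ∀ t : ℝ, 0 < t → Summable fun i => Real.exp (-t * ev i ^ 2) := by
  obtain ⟨S, hS, htr⟩ := hθ
  have hs := isSymm_of_isSelfAdjoint hD
  obtain ⟨P, hP⟩ := exists_rightInv hs one_ne_zero (surjective_of_isSelfAdjoint hD one_ne_zero)
  obtain ⟨M, hM⟩ := exists_rightInv hs (neg_ne_zero.2 one_ne_zero)
    (surjective_of_isSelfAdjoint hD (neg_ne_zero.2 one_ne_zero))
  rw [Complex.ofReal_neg, neg_mul] at hM
  obtain ⟨ι, b, ev, h⟩ := exists_isEigenBasis hs one_ne_zero hP hM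
    (hS.isCompactOperator_resolvent (fun t ht => (htr t ht).isCompactOperator) hP hM)
  exact ⟨ι, b, ev, h, fun t ht => summable_exp_of_heat h hS ht.le (htr t ht)⟩

end SelfAdjoint

/-! ### Existence and uniqueness of the heat semigroup of a diagonalized operator -/

section Heat

variable {K : Type*} [NormedAddCommGroup K] [InnerProductSpace ℂ K] {ι : Type*}

/-- Dominated convergence in Parseval's identity: coordinatewise convergence with a square summable
majorant is norm convergence. -/
theorem tendsto_of_inner_basis {α : Type*} {l : Filter α} (b : HilbertBasis ι ℂ K) {F : α → K}
    {y : K} {g : ι → ℝ} (hg : Summable fun i => g i ^ 2)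
    (hb : ∀ᶠ n in l, ∀ i, ‖⟪b i, F n - y⟫‖ ≤ g i)
    (hlim : ∀ i, Tendsto (fun n => ⟪b i, F n - y⟫) l (𝓝 0)) : Tendsto F l (𝓝 y) := by
  have h1 : Tendsto (fun n => ∑' i, ‖⟪b i, F n - y⟫‖ ^ 2) l (𝓝 (∑' _ : ι, (0 : ℝ))) := by
    refine tendsto_tsum_of_dominated_convergence hg (fun i => ?_) ?_
    · simpa using ((hlim i).norm).pow 2
    · filter_upwards [hb] with n hn i
      rw [Real.norm_of_nonneg (by positivity)]
      exact pow_le_pow_left₀ (norm_nonneg _) (hn i) 2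
  simp only [(basis_hasSum_norm_sq b _).tsum_eq, tsum_zero] at h1
  rw [tendsto_iff_norm_sub_tendsto_zero]
  have h2 := h1.sqrt
  simpa [Real.sqrt_sq (norm_nonneg _)] using h2

/-- The diagonal semigroup `e^{-tD²}`. -/
def diagHeat (b : HilbertBasis ι ℂ K) (ev : ι → ℝ) (t : ℝ) : K →L[ℂ] K :=
  diag b fun i => (Real.exp (-t * ev i ^ 2) : ℂ)

theorem norm_exp_le_one {t : ℝ} (ht : 0 ≤ t) (a : ℝ) : ‖(Real.exp (-t * a ^ 2) : ℂ)‖ ≤ 1 := by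
  rw [Complex.norm_real, Real.norm_of_nonneg (Real.exp_pos _).le, Real.exp_le_one_iff]
  nlinarith [mul_nonneg ht (sq_nonneg a)]

theorem inner_diagHeat (b : HilbertBasis ι ℂ K) (ev : ι → ℝ) {t : ℝ} (ht : 0 ≤ t) (x : K) (i : ι) :
    ⟪b i, diagHeat b ev t x⟫ = Real.exp (-t * ev i ^ 2) * ⟪b i, x⟫ :=
  inner_diag b zero_le_one (fun i => norm_exp_le_one ht (ev i)) x i

theorem diagHeat_apply_basis (b : HilbertBasis ι ℂ K) (ev : ι → ℝ) {t : ℝ} (ht : 0 ≤ t) (i : ι) :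
    diagHeat b ev t (b i) = (Real.exp (-t * ev i ^ 2) : ℂ) • b i :=
  diag_apply_basis b zero_le_one (fun i => norm_exp_le_one ht (ev i)) i

theorem tendsto_exp_slope (a : ℝ) :
    Tendsto (fun t : ℝ => t⁻¹ * (Real.exp (-t * a ^ 2) - 1)) (𝓝[>] 0) (𝓝 (-a ^ 2)) := by
  have h1 : HasDerivAt (fun t : ℝ => Real.exp (-t * a ^ 2)) (-a ^ 2) 0 := by
    have := (((hasDerivAt_id (0 : ℝ)).neg).mul_const (a ^ 2)).exp
    simpa using this
  have h2 := (hasDerivAt_iff_tendsto_slope_zero.1 h1).mono_left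
    (nhdsWithin_mono 0 (fun t ht => (Set.mem_Ioi.1 ht).ne' : Set.Ioi (0 : ℝ) ⊆ {0}ᶜ))
  simpa using h2

theorem exp_slope_bound {t : ℝ} (ht : 0 < t) (a : ℝ) :
    |t⁻¹ * (Real.exp (-t * a ^ 2) - 1) + a ^ 2| ≤ a ^ 2 := by
  have h1 : Real.exp (-t * a ^ 2) ≤ 1 := by
    rw [Real.exp_le_one_iff]
    nlinarith [mul_nonneg ht.le (sq_nonneg a)]
  have h2 := Real.add_one_le_exp (-t * a ^ 2)
  rw [abs_le]
  have h3 : t⁻¹ * (Real.exp (-t * a ^ 2) - 1) ≤ 0 :=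
    mul_nonpos_of_nonneg_of_nonpos (inv_pos.2 ht).le (by linarith)
  have h4 : -a ^ 2 ≤ t⁻¹ * (Real.exp (-t * a ^ 2) - 1) := by
    rw [inv_mul_eq_div, le_div_iff₀ ht]
    linarith
  constructor <;> nlinarith [sq_nonneg a]

theorem IsEigenBasis.maps_iff {D : K →ₗ.[ℂ] K} {b : HilbertBasis ι ℂ K} {ev : ι → ℝ}
    (h : IsEigenBasis D b ev) {x y : K} : Maps D x y ↔ ∀ i, ⟪b i, y⟫ = ev i * ⟪b i, x⟫ := by
  refine ⟨h.inner_apply x y, fun hxy => ?_⟩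
  have hx : x ∈ D.domain := by
    rw [h.mem_domain]
    simp only [← hxy]
    exact (basis_hasSum_norm_sq b y).summable
  exact (maps_apply hx).congr rfl (basis_ext b fun i => by
    rw [h.inner_apply _ _ (maps_apply hx), hxy])

theorem isHeatSemigroup_diagHeat {D : K →ₗ.[ℂ] K} {b : HilbertBasis ι ℂ K} {ev : ι → ℝ}
    (h : IsEigenBasis D b ev) : IsHeatSemigroup D (diagHeat b ev) := by
  have hslope : ∀ (x : K) {t : ℝ}, 0 < t → ∀ i, ⟪b i, (t⁻¹ : ℝ) • (diagHeat b ev t x - x)⟫ =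
      ((t⁻¹ * (Real.exp (-t * ev i ^ 2) - 1) : ℝ) : ℂ) * ⟪b i, x⟫ := fun x t ht i => by
    rw [← Complex.coe_smul, inner_smul_right, inner_sub_right, inner_diagHeat b ev ht.le]
    push_cast
    ring
  refine ⟨?_, ?_, ?_, ?_⟩
  · refine clm_eq_of_basis b fun x i => ?_
    rw [inner_diagHeat b ev le_rfl]
    simp
  · intro s t hs ht
    refine clm_eq_of_basis b fun x i => ?_
    rw [inner_diagHeat b ev (add_nonneg hs ht), mul_apply_eq_comp,
      inner_diagHeat b ev hs, inner_diagHeat b ev ht, ← mul_assoc, ← Complex.ofReal_mul,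
      ← Real.exp_add]
    congr 3
    ring
  · intro x s hs
    refine tendsto_of_inner_basis b (g := fun i => 2 * ‖⟪b i, x⟫‖) ?_ ?_ ?_
    · simp only [mul_pow]
      exact (basis_hasSum_norm_sq b x).summable.mul_left _
    · filter_upwards [self_mem_nhdsWithin] with t ht i
      rw [inner_sub_right, inner_diagHeat b ev hs, inner_diagHeat b ev ht, ← sub_mul, norm_mul]
      gcongr
      refine (norm_sub_le _ _).trans ?_
      linarith [norm_exp_le_one (Set.mem_Ici.1 hs) (ev i), norm_exp_le_one (Set.mem_Ici.1 ht) (ev i)]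
    · intro i
      have h1 : Tendsto (fun t : ℝ => ((Real.exp (-t * ev i ^ 2) : ℂ) - Real.exp (-s * ev i ^ 2))
          * ⟪b i, x⟫) (𝓝[Set.Ici 0] s) (𝓝 (((Real.exp (-s * ev i ^ 2) : ℂ) -
          Real.exp (-s * ev i ^ 2)) * ⟪b i, x⟫)) := by
        have : Continuous fun t : ℝ => ((Real.exp (-t * ev i ^ 2) : ℂ) - Real.exp (-s * ev i ^ 2))
          * ⟪b i, x⟫ := by fun_prop
        exact (this.tendsto s).mono_left nhdsWithin_le_nhds
      rw [sub_self, zero_mul] at h1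
      refine h1.congr' ?_
      filter_upwards [self_mem_nhdsWithin] with t ht
      rw [inner_sub_right, inner_diagHeat b ev hs, inner_diagHeat b ev ht, ← sub_mul]
  · intro x y
    have hslope' : ∀ i, Tendsto (fun t : ℝ => ⟪b i, (t⁻¹ : ℝ) • (diagHeat b ev t x - x)⟫) (𝓝[>] 0)
        (𝓝 (((-ev i ^ 2 : ℝ) : ℂ) * ⟪b i, x⟫)) := fun i => by
      have h1 := ((Complex.continuous_ofReal.tendsto _).comp
        (tendsto_exp_slope (ev i))).mul_const ⟪b i, x⟫
      refine h1.congr' ?_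
      filter_upwards [self_mem_nhdsWithin] with t ht
      rw [hslope x ht]
      rfl
    constructor
    · intro hlim
      have hy : ∀ i, ⟪b i, y⟫ = ((-ev i ^ 2 : ℝ) : ℂ) * ⟪b i, x⟫ := fun i =>
        tendsto_nhds_unique ((tendsto_const_nhds.inner hlim)) (hslope' i)
      -- The existence of the limit only controls $\lambda_i^2\langle b_i,x\rangle$; the inequality
      -- $\lambda^2\le1+\lambda^4$ puts $x$ itself into the domain of $D$.
      have hz : Summable fun i => ‖(ev i : ℂ) * ⟪b i, x⟫‖ ^ 2 := by
        refine Summable.of_nonneg_of_le (fun _ => by positivity) (fun i => ?_)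
          ((basis_hasSum_norm_sq b x).summable.add (basis_hasSum_norm_sq b y).summable)
        rw [hy, norm_mul, norm_mul, Complex.norm_real, Complex.norm_real, mul_pow, mul_pow,
          Real.norm_eq_abs, Real.norm_eq_abs, sq_abs, sq_abs, ← one_add_mul]
        gcongr
        nlinarith [sq_nonneg (ev i ^ 2 - 1)]
      obtain ⟨z, hz⟩ := basis_exists b hz
      have h1 : Maps D x z := h.maps_iff.2 hz
      have h2 : Maps D z (-y) := h.maps_iff.2 fun i => by
        rw [inner_neg_right, hy, hz]
        push_cast
        ring
      obtain ⟨hx, rfl⟩ := h1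
      obtain ⟨hDx, hy⟩ := h2
      exact ⟨hx, hDx, by rw [hy, neg_neg]⟩
    · rintro ⟨hx, hDx, rfl⟩
      set z := D ⟨D ⟨x, hx⟩, hDx⟩
      have hz : ∀ i, ⟪b i, -z⟫ = ((-ev i ^ 2 : ℝ) : ℂ) * ⟪b i, x⟫ := fun i => by
        rw [inner_neg_right, h.inner_apply _ _ (maps_apply hDx), h.inner_apply _ _ (maps_apply hx)]
        push_cast
        ring
      refine tendsto_of_inner_basis b (g := fun i => ‖⟪b i, -z⟫‖)
        (basis_hasSum_norm_sq b (-z)).summable ?_ fun i => ?_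
      · filter_upwards [self_mem_nhdsWithin] with t ht i
        rw [inner_sub_right, hslope x ht, hz, ← sub_mul, norm_mul, norm_mul, ← Complex.ofReal_sub,
          Complex.norm_real, Complex.norm_real, Real.norm_eq_abs, Real.norm_eq_abs, neg_eq_neg_one_mul,
          neg_one_mul, sub_neg_eq_add, abs_neg, abs_of_nonneg (sq_nonneg (ev i))]
        gcongr
        exact exp_slope_bound ht (ev i)
      · have := (hslope' i).sub_const ⟪b i, -z⟫
        rw [hz, sub_self] at this
        refine this.congr fun t => ?_
        rw [inner_sub_right, hz]

/-- Every heat semigroup of $D$ acts on eigenvectors by $e^{-t\lambda^2}$, so the one selected by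
choice in `heat` is the diagonal one. -/
theorem heat_eq {D : K →ₗ.[ℂ] K} {b : HilbertBasis ι ℂ K} {ev : ι → ℝ}
    (h : IsEigenBasis D b ev) {t : ℝ} (ht : 0 ≤ t) : heat D t = diagHeat b ev t := by
  have hex : ∃ S, IsHeatSemigroup D S := ⟨_, isHeatSemigroup_diagHeat h⟩
  rw [heat, dif_pos hex]
  refine clm_eq_of_apply_basis b fun i => ?_
  rw [hex.choose_spec.apply_eigenvector (h.maps_basis i) ht, diagHeat_apply_basis b ev ht]

theorem heat_zero {D : K →ₗ.[ℂ] K} {b : HilbertBasis ι ℂ K} {ev : ι → ℝ}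
    (h : IsEigenBasis D b ev) : heat D 0 = 1 := by
  rw [heat_eq h le_rfl, (isHeatSemigroup_diagHeat h).map_zero]

theorem isTraceClass_heat {D : K →ₗ.[ℂ] K} {b : HilbertBasis ι ℂ K} {ev : ι → ℝ}
    (h : IsEigenBasis D b ev) {t : ℝ} (ht : 0 ≤ t)
    (hs : Summable fun i => Real.exp (-t * ev i ^ 2)) : IsTraceClass (heat D t) := by
  rw [heat_eq h ht]
  refine isTraceClass_diag b (hs.congr fun i => ?_)
  rw [Complex.norm_real, Real.norm_of_nonneg (Real.exp_pos _).le]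

theorem trace_mul_heat [CompleteSpace K] {D : K →ₗ.[ℂ] K} {b : HilbertBasis ι ℂ K} {ev : ι → ℝ}
    (h : IsEigenBasis D b ev) {t : ℝ} (ht : 0 ≤ t)
    (hs : Summable fun i => Real.exp (-t * ev i ^ 2)) (A : K →L[ℂ] K) :
    trace (A * heat D t) = ∑' i, (Real.exp (-t * ev i ^ 2) : ℂ) * ⟪b i, A (b i)⟫ := by
  rw [((isTraceClass_heat h ht hs).comp_left A).trace_eq b]
  refine tsum_congr fun i => ?_
  rw [mul_apply_eq_comp, heat_eq h ht, diagHeat_apply_basis b ev ht, map_smul,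
    inner_smul_right]

end Heat

/-! ### Bounded perturbations -/

section Sums

variable {ι ι' : Type*}

/-- Fubini with weights depending on one index. It turns identities for the moments of the overlaps
into identities between double series over pairs of eigenvalues. -/
theorem hasSum_weighted {a : ι → ℝ} (ha : Summable fun i => |a i|) {q Q : ι → ι' → ℝ}
    {s S : ι → ℝ} {B : ℝ} (hq : ∀ i, HasSum (q i) (s i)) (hQ : ∀ i j, |q i j| ≤ Q i j)
    (hS : ∀ i, HasSum (Q i) (S i)) (hB : ∀ i, S i ≤ B) :
    HasSum (fun p : ι × ι' => a p.1 * q p.1 p.2) (∑' i, a i * s i) := by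
  have h0 : ∀ i j, 0 ≤ |a i| * Q i j := fun i j =>
    mul_nonneg (abs_nonneg (a i)) ((abs_nonneg (q i j)).trans (hQ i j))
  have hsum : Summable fun p : ι × ι' => |a p.1| * Q p.1 p.2 := by
    have h1 : ∀ i, HasSum (fun j => |a i| * Q i j) (|a i| * S i) := fun i => (hS i).mul_left |a i|
    have h2 : Summable fun i => |a i| * S i := by
      refine Summable.of_nonneg_of_le (fun i => ?_) (fun i => ?_) (ha.mul_right B)
      · exact (h1 i).nonneg fun j => h0 i j
      · exact mul_le_mul_of_nonneg_left (hB i) (abs_nonneg _)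
    refine (summable_prod_of_nonneg (f := fun p : ι × ι' => |a p.1| * Q p.1 p.2)
      (fun p => h0 p.1 p.2)).2 ⟨fun i => (h1 i).summable, ?_⟩
    exact h2.congr fun i => (h1 i).tsum_eq.symm
  have hsum' : Summable fun p : ι × ι' => a p.1 * q p.1 p.2 := by
    refine Summable.of_norm_bounded hsum fun p => ?_
    rw [Real.norm_eq_abs, abs_mul]
    exact mul_le_mul_of_nonneg_left (hQ _ _) (abs_nonneg _)
  have h : ∑' p : ι × ι', a p.1 * q p.1 p.2 = ∑' i, a i * s i := by
    rw [hsum'.tsum_prod]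
    exact tsum_congr fun i => by simp only [tsum_mul_left, (hq i).tsum_eq]
  rw [← h]
  exact hsum'.hasSum

theorem hasSum_weighted' {a : ι' → ℝ} (ha : Summable fun j => |a j|) {q : ι → ι' → ℝ}
    {s : ι' → ℝ} {B : ℝ} (h0 : ∀ i j, 0 ≤ q i j) (hq : ∀ j, HasSum (fun i => q i j) (s j))
    (hB : ∀ j, s j ≤ B) :
    HasSum (fun p : ι × ι' => a p.2 * q p.1 p.2) (∑' j, a j * s j) := by
  have h := hasSum_weighted ha (q := fun j i => q i j) hq (fun j i => (abs_of_nonneg (h0 i j)).le)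
    hq hB
  exact (Equiv.prodComm ι ι').hasSum_iff.2 h

end Sums

section Perturb

universe w

variable {K : Type w} [NormedAddCommGroup K] [InnerProductSpace ℂ K]
variable {ι ι' : Type*}

/-- `D' = D + E` with `E` bounded and symmetric. -/
structure IsPerturbation (D D' : K →ₗ.[ℂ] K) (E : K →L[ℂ] K) : Prop where
  symm : ∀ x y, ⟪E x, y⟫ = ⟪x, E y⟫
  maps_iff : ∀ x y, Maps D' x y ↔ Maps D x (y - E x)

theorem IsEigenBasis.isSymm {D : K →ₗ.[ℂ] K} {b : HilbertBasis ι ℂ K} {ev : ι → ℝ}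
    (h : IsEigenBasis D b ev) : IsSymm D := fun x y x' y' hxy hxy' => by
  rw [← b.tsum_inner_mul_inner, ← b.tsum_inner_mul_inner x]
  refine tsum_congr fun i => ?_
  rw [h.inner_apply _ _ hxy', ← inner_conj_symm y, h.inner_apply _ _ hxy, map_mul,
    Complex.conj_ofReal, inner_conj_symm]
  ring

theorem exists_rightInv_diag {D : K →ₗ.[ℂ] K} {b : HilbertBasis ι ℂ K} {ev : ι → ℝ}
    (h : IsEigenBasis D b ev) {c : ℝ} (hc : c ≠ 0) :
    RightInv D (c * Complex.I) (diag b fun i => ((ev i : ℂ) + c * Complex.I)⁻¹) ∧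
      ‖diag b fun i => ((ev i : ℂ) + c * Complex.I)⁻¹‖ ≤ |c|⁻¹ := by
  have hb : ∀ i, ‖((ev i : ℂ) + c * Complex.I)⁻¹‖ ≤ |c|⁻¹ := fun i => by
    rw [norm_inv]
    refine inv_anti₀ (abs_pos.2 hc) ?_
    refine le_trans (le_of_eq ?_) (Complex.abs_im_le_norm _)
    simp
  refine ⟨fun y => h.maps_iff.2 fun i => ?_, norm_diag_le b (by positivity) hb⟩
  rw [inner_sub_right, inner_smul_right, inner_diag b (by positivity) hb]
  have := ofReal_add_ne_zero (ev i) hc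
  field_simp
  ring

theorem isCompactOperator_rightInv_diag [CompleteSpace K] {b : HilbertBasis ι ℂ K} {ev : ι → ℝ}
    (hev : Tendsto (fun i => |ev i|) cofinite atTop) {c : ℝ} (hc : c ≠ 0) :
    IsCompactOperator (diag b fun i => ((ev i : ℂ) + c * Complex.I)⁻¹) := by
  refine isCompactOperator_diag b ?_ (C := |c|⁻¹) (by positivity) fun i => ?_
  · rw [tendsto_zero_iff_norm_tendsto_zero]
    simp only [norm_inv]
    refine (tendsto_atTop_mono (fun i => ?_) hev).inv_tendsto_atTop
    refine le_trans (le_of_eq ?_) (Complex.abs_re_le_norm _)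
    simp
  · rw [norm_inv]
    refine inv_anti₀ (abs_pos.2 hc) ?_
    refine le_trans (le_of_eq ?_) (Complex.abs_im_le_norm _)
    simp

theorem tendsto_abs_of_summable_exp {ev : ι → ℝ} (hs : Summable fun i => Real.exp (-1 * ev i ^ 2)) :
    Tendsto (fun i => |ev i|) cofinite atTop := by
  have h1 := hs.tendsto_cofinite_zero
  rw [Real.tendsto_exp_comp_nhds_zero] at h1
  have h2 : Tendsto (fun i => ev i ^ 2) cofinite atTop := by
    have := tendsto_neg_atBot_iff.1 (h1.congr fun i => by rw [neg_one_mul])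
    exact this
  have h3 := Real.tendsto_sqrt_atTop.comp h2
  exact h3.congr fun i => Real.sqrt_sq_eq_abs _

/-- Factor $D+E+z=(1+EP)(D+z)$ and invert $1+EP$ by a Neumann series. -/
theorem exists_rightInv_perturbation {D D' : K →ₗ.[ℂ] K} [CompleteSpace K] {E : K →L[ℂ] K}
    (hE : ∀ x y, Maps D' x y ↔ Maps D x (y - E x)) {z : ℂ} {P : K →L[ℂ] K} (hP : RightInv D z P)
    (hEP : ‖E * P‖ < 1) : ∃ T : K →L[ℂ] K, RightInv D' z (P * T : K →L[ℂ] K) := by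
  let u := Units.oneSub (-(E * P)) (by rwa [norm_neg])
  refine ⟨((u⁻¹ : (K →L[ℂ] K)ˣ) : K →L[ℂ] K), fun y => ?_⟩
  set x := ((u⁻¹ : (K →L[ℂ] K)ˣ) : K →L[ℂ] K) y
  have hx : x + E (P x) = y := by
    have h1 : (u : K →L[ℂ] K) * ((u⁻¹ : (K →L[ℂ] K)ˣ) : K →L[ℂ] K) = 1 := u.mul_inv
    have h2 := congrArg (fun T : K →L[ℂ] K => T y) h1
    have h3 : (u : K →L[ℂ] K) = 1 + E * P := by
      change 1 - -(E * P) = _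
      rw [sub_neg_eq_add]
    rw [h3] at h2
    exact h2
  rw [hE]
  refine (hP x).congr rfl ?_
  change _ = y - z • P x - E (P x)
  rw [← hx]
  abel

theorem IsPerturbation.exists_isEigenBasis [CompleteSpace K] {D D' : K →ₗ.[ℂ] K} {E : K →L[ℂ] K}
    (hE : IsPerturbation D D' E) {b : HilbertBasis ι ℂ K} {ev : ι → ℝ} (h : IsEigenBasis D b ev)
    (hev : Tendsto (fun i => |ev i|) cofinite atTop) :
    ∃ (ι : Type w) (b : HilbertBasis ι ℂ K) (ev : ι → ℝ), IsEigenBasis D' b ev := by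
  have hs : IsSymm D' := fun x y x' y' h1 h2 => by
    have := h.isSymm _ _ _ _ ((hE.maps_iff _ _).1 h1) ((hE.maps_iff _ _).1 h2)
    rw [inner_sub_left, inner_sub_right, hE.symm] at this
    exact sub_left_injective this
  -- With $|c|=\|E\|+1$ the bound $\|(D+ci)^{-1}\|\le|c|^{-1}$ makes $\|E(D+ci)^{-1}\|<1$. The
  -- inverse keeps a compact diagonal factor on the left, which gives the compactness needed for the
  -- spectral theorem.
  have hbound : ∀ c : ℝ, |c| = ‖E‖ + 1 → ∃ T : K →L[ℂ] K, RightInv D' (c * Complex.I)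
      ((diag b fun i => ((ev i : ℂ) + c * Complex.I)⁻¹) * T : K →L[ℂ] K) := fun c hc => by
    have hc0 : c ≠ 0 := abs_pos.1 (hc ▸ (by positivity))
    obtain ⟨h1, h2⟩ := exists_rightInv_diag h hc0
    refine exists_rightInv_perturbation hE.maps_iff h1 ?_
    refine (norm_mul_le _ _).trans_lt ?_
    rw [hc] at h2
    calc ‖E‖ * _ ≤ ‖E‖ * (‖E‖ + 1)⁻¹ := by gcongr
      _ < 1 := by
        rw [mul_inv_lt_iff₀ (by positivity)]
        linarith
  have hpos : 0 < ‖E‖ + 1 := by positivity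
  obtain ⟨T, hT⟩ := hbound (‖E‖ + 1) (abs_of_pos hpos)
  obtain ⟨T', hT'⟩ := hbound (-(‖E‖ + 1)) (by rw [abs_neg, abs_of_pos hpos])
  rw [Complex.ofReal_neg, neg_mul] at hT'
  refine OddPairing.exists_isEigenBasis hs hpos.ne' hT hT' ?_
  have h1 := isCompactOperator_rightInv_diag (b := b) hev (neg_ne_zero.2 hpos.ne')
  rw [Complex.ofReal_neg, neg_mul] at h1
  exact (h1.comp_clm T').comp_clm _

/-! ### Overlaps of two eigenbases -/

variable {D D' : K →ₗ.[ℂ] K} {E : K →L[ℂ] K} {b : HilbertBasis ι ℂ K} {ev : ι → ℝ}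
  {b' : HilbertBasis ι' ℂ K} {ev' : ι' → ℝ}

/-- Evaluate $D'b'_j=Db'_j+Eb'_j$ against $b_i$. By this identity, weights $\lambda'_j-\lambda_i$ on
the overlaps become matrix elements of the bounded operator $E$. -/
theorem IsPerturbation.inner_off (hE : IsPerturbation D D' E) (h : IsEigenBasis D b ev)
    (h' : IsEigenBasis D' b' ev') (i : ι) (j : ι') :
    ⟪b i, E (b' j)⟫ = ((ev' j - ev i : ℝ) : ℂ) * ⟪b i, b' j⟫ := by
  have h1 := h.inner_apply _ _ ((hE.maps_iff _ _).1 (h'.maps_basis j)) i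
  rw [inner_sub_right, inner_smul_right] at h1
  push_cast
  linear_combination -h1

/-- The transition probabilities between two Hilbert bases. -/
def overlap (b : HilbertBasis ι ℂ K) (b' : HilbertBasis ι' ℂ K) (i : ι) (j : ι') : ℝ :=
  ‖⟪b i, b' j⟫‖ ^ 2

theorem overlap_nonneg (b : HilbertBasis ι ℂ K) (b' : HilbertBasis ι' ℂ K) (i : ι) (j : ι') :
    0 ≤ overlap b b' i j := sq_nonneg _

theorem hasSum_overlap (b : HilbertBasis ι ℂ K) (b' : HilbertBasis ι' ℂ K) (i : ι) :
    HasSum (overlap b b' i) 1 := by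
  have := basis_hasSum_norm_sq' b' (b i)
  rwa [b.orthonormal.1, one_pow] at this

theorem hasSum_overlap' (b : HilbertBasis ι ℂ K) (b' : HilbertBasis ι' ℂ K) (j : ι') :
    HasSum (fun i => overlap b b' i j) 1 := by
  have := basis_hasSum_norm_sq b (b' j)
  rwa [b'.orthonormal.1, one_pow] at this

theorem IsPerturbation.sq_mul_overlap (hE : IsPerturbation D D' E) (h : IsEigenBasis D b ev)
    (h' : IsEigenBasis D' b' ev') (i : ι) (j : ι') :
    (ev' j - ev i) ^ 2 * overlap b b' i j = ‖⟪b i, E (b' j)⟫‖ ^ 2 := by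
  rw [hE.inner_off h h', norm_mul, mul_pow, Complex.norm_real, Real.norm_eq_abs, sq_abs, overlap]

theorem norm_sq_apply_basis_le (E : K →L[ℂ] K) (b : HilbertBasis ι ℂ K) (i : ι) :
    ‖E (b i)‖ ^ 2 ≤ ‖E‖ ^ 2 := by
  refine pow_le_pow_left₀ (norm_nonneg _) ?_ 2
  have := E.le_opNorm (b i)
  rwa [b.orthonormal.1, mul_one] at this

theorem IsPerturbation.hasSum_sq (hE : IsPerturbation D D' E) (h : IsEigenBasis D b ev)
    (h' : IsEigenBasis D' b' ev') (i : ι) :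
    HasSum (fun j => (ev' j - ev i) ^ 2 * overlap b b' i j) (‖E (b i)‖ ^ 2) := by
  simp only [hE.sq_mul_overlap h h', ← hE.symm]
  exact basis_hasSum_norm_sq' b' (E (b i))

theorem IsPerturbation.hasSum_sq' (hE : IsPerturbation D D' E) (h : IsEigenBasis D b ev)
    (h' : IsEigenBasis D' b' ev') (j : ι') :
    HasSum (fun i => (ev' j - ev i) ^ 2 * overlap b b' i j) (‖E (b' j)‖ ^ 2) := by
  simp only [hE.sq_mul_overlap h h']
  exact basis_hasSum_norm_sq b (E (b' j))

theorem IsPerturbation.hasSum_first (hE : IsPerturbation D D' E) (h : IsEigenBasis D b ev)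
    (h' : IsEigenBasis D' b' ev') (i : ι) :
    HasSum (fun j => (ev' j - ev i) * overlap b b' i j) (⟪b i, E (b i)⟫ : ℂ).re := by
  have h1 := (b'.hasSum_inner_mul_inner (E (b i)) (b i)).mapL Complex.reCLM
  rw [hE.symm] at h1
  refine h1.congr_fun fun j => ?_
  rw [hE.symm, hE.inner_off h h', mul_assoc, Complex.reCLM_apply, Complex.re_ofReal_mul, overlap,
    ← inner_conj_symm (b' j), Complex.mul_conj, Complex.ofReal_re, Complex.normSq_eq_norm_sq]

/-- A Jensen type estimate for the probabilities $p_{ij}$. It rests on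
$\lambda^2/2\le\lambda'^2+(\lambda'-\lambda)^2$, on $e^x\ge1+x$, and on the second moment being at
most $\|E\|^2$. The price is halving $t$. -/
theorem IsPerturbation.exp_le (hE : IsPerturbation D D' E) (h : IsEigenBasis D b ev)
    (h' : IsEigenBasis D' b' ev') {t : ℝ} (ht : 0 ≤ t) (j : ι') :
    Real.exp (-t * ev' j ^ 2) ≤
      Real.exp (t * ‖E‖ ^ 2) * ∑' i, overlap b b' i j * Real.exp (-(t / 2) * ev i ^ 2) := by
  have hsm : Summable fun i => overlap b b' i j * Real.exp (-(t / 2) * ev i ^ 2) := by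
    refine Summable.of_nonneg_of_le (fun i => mul_nonneg (overlap_nonneg b b' i j)
      (Real.exp_pos _).le) (fun i => ?_) (hasSum_overlap' b b' j).summable
    refine mul_le_of_le_one_right (overlap_nonneg b b' i j) ?_
    rw [Real.exp_le_one_iff]
    nlinarith [mul_nonneg ht (sq_nonneg (ev i))]
  -- The added $t\|E\|^2$ compensates the second moment, so the sum of this series is at least its
  -- exponential prefactor.
  have h1 := (((hasSum_overlap' b b' j).mul_right (1 + t * ‖E‖ ^ 2)).sub
    ((hE.hasSum_sq' h h' j).mul_left t)).mul_left (Real.exp (-t * ev' j ^ 2 - t * ‖E‖ ^ 2))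
  have h2 : Real.exp (-t * ev' j ^ 2 - t * ‖E‖ ^ 2) ≤
      ∑' i, overlap b b' i j * Real.exp (-(t / 2) * ev i ^ 2) := by
    refine le_trans ?_ (hasSum_le (fun i => ?_) h1 hsm.hasSum)
    · refine le_mul_of_one_le_right (Real.exp_pos _).le ?_
      nlinarith [mul_le_mul_of_nonneg_left (norm_sq_apply_basis_le E b' j) ht]
    · have h3 := Real.add_one_le_exp (t * ev' j ^ 2 + t * ‖E‖ ^ 2 - t / 2 * ev i ^ 2)
      have h4 : Real.exp (-(t / 2) * ev i ^ 2) = Real.exp (-t * ev' j ^ 2 - t * ‖E‖ ^ 2) *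
          Real.exp (t * ev' j ^ 2 + t * ‖E‖ ^ 2 - t / 2 * ev i ^ 2) := by
        rw [← Real.exp_add]; congr 1; ring
      rw [h4, mul_left_comm (overlap b b' i j) (Real.exp (-t * ev' j ^ 2 - t * ‖E‖ ^ 2))]
      refine mul_le_mul_of_nonneg_left ?_ (Real.exp_pos _).le
      have h5 : 1 + t * ‖E‖ ^ 2 - t * (ev' j - ev i) ^ 2 ≤
          Real.exp (t * ev' j ^ 2 + t * ‖E‖ ^ 2 - t / 2 * ev i ^ 2) := by
        refine le_trans ?_ h3
        nlinarith [mul_nonneg ht (sq_nonneg (2 * ev' j - ev i))]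
      have := mul_le_mul_of_nonneg_left h5 (overlap_nonneg b b' i j)
      linarith
  have h6 := mul_le_mul_of_nonneg_left h2 (Real.exp_pos (t * ‖E‖ ^ 2)).le
  rwa [← Real.exp_add, show t * ‖E‖ ^ 2 + (-t * ev' j ^ 2 - t * ‖E‖ ^ 2) = -t * ev' j ^ 2 by ring]
    at h6

theorem IsPerturbation.summable_exp (hE : IsPerturbation D D' E) (h : IsEigenBasis D b ev)
    (h' : IsEigenBasis D' b' ev') {t : ℝ} (ht : 0 ≤ t)
    (hs : Summable fun i => Real.exp (-(t / 2) * ev i ^ 2)) :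
    Summable (fun j => Real.exp (-t * ev' j ^ 2)) ∧ ∑' j, Real.exp (-t * ev' j ^ 2) ≤
      Real.exp (t * ‖E‖ ^ 2) * ∑' i, Real.exp (-(t / 2) * ev i ^ 2) := by
  have habs : Summable fun i => |Real.exp (-(t / 2) * ev i ^ 2)| := by
    simpa only [abs_of_pos (Real.exp_pos _)] using hs
  have h1 := hasSum_weighted habs (hasSum_overlap b b')
    (fun i j => (abs_of_nonneg (overlap_nonneg b b' i j)).le) (hasSum_overlap b b') fun _ => le_rfl
  have h2 := (Equiv.prodComm ι' ι).hasSum_iff.2 h1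
  have h3 : HasSum (fun p : ι' × ι => overlap b b' p.2 p.1 * Real.exp (-(t / 2) * ev p.2 ^ 2))
      (∑' i, Real.exp (-(t / 2) * ev i ^ 2)) := by
    simp only [mul_one] at h2
    exact h2.congr_fun fun p => mul_comm _ _
  have h4 := (h3.prod_fiberwise fun j => (h3.summable.prod_factor j).hasSum).mul_left
    (Real.exp (t * ‖E‖ ^ 2))
  have h5 := Summable.of_nonneg_of_le (fun j => (Real.exp_pos (-t * ev' j ^ 2)).le)
    (fun j => hE.exp_le h h' ht j) h4.summable
  exact ⟨h5, hasSum_le (fun j => hE.exp_le h h' ht j) h5.hasSum h4⟩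

/-- Since $p$ is doubly stochastic with the stated first moment, the left side is
$\left|\sum_{i,j}p_{ij}\bigl(f(\lambda'_j)-f(\lambda_i)-f'(\lambda_i)(\lambda'_j-\lambda_i)\bigr)\right|$.
The remainder bound is quadratic, so the second moments bound it by $\|E\|^2$. Only the scalar
remainder estimate on the two spectra is required, so $f$ may jump in a spectral gap. -/
theorem IsPerturbation.taylor (hE : IsPerturbation D D' E) (h : IsEigenBasis D b ev)
    (h' : IsEigenBasis D' b' ev') {f f' w : ℝ → ℝ} {C : ℝ} (hC : 0 ≤ C) (hw : ∀ x, 0 ≤ w x)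
    (hf : Summable fun i => |f (ev i)|) (hf' : Summable fun j => |f (ev' j)|)
    (hdf : Summable fun i => |f' (ev i)|) (hws : Summable fun i => w (ev i))
    (hws' : Summable fun j => w (ev' j))
    (hT : ∀ i j, |f (ev' j) - f (ev i) - f' (ev i) * (ev' j - ev i)| ≤
      C * (w (ev i) + w (ev' j)) * (ev' j - ev i) ^ 2) :
    |∑' j, f (ev' j) - ∑' i, f (ev i) - ∑' i, f' (ev i) * (⟪b i, E (b i)⟫ : ℂ).re| ≤
      C * ‖E‖ ^ 2 * (∑' i, w (ev i) + ∑' j, w (ev' j)) := by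
  have hO : ∀ i j, |overlap b b' i j| ≤ overlap b b' i j := fun i j =>
    (abs_of_nonneg (overlap_nonneg b b' i j)).le
  have hsq0 : ∀ i j, 0 ≤ (ev' j - ev i) ^ 2 * overlap b b' i j := fun i j =>
    mul_nonneg (sq_nonneg _) (overlap_nonneg b b' i j)
  have hF' := hasSum_weighted' hf' (overlap_nonneg b b') (hasSum_overlap' b b') fun _ => le_rfl
  have hF := hasSum_weighted hf (hasSum_overlap b b') hO (hasSum_overlap b b') fun _ => le_rfl
  -- The first moment is dominated through $|x|\le1+x^2$, whose moments are known.
  have hL := hasSum_weighted hdf (hE.hasSum_first h h')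
    (Q := fun i j => overlap b b' i j + (ev' j - ev i) ^ 2 * overlap b b' i j)
    (fun i j => by
      rw [abs_mul, abs_of_nonneg (overlap_nonneg b b' i j), ← one_add_mul]
      refine mul_le_mul_of_nonneg_right ?_ (overlap_nonneg b b' i j)
      rw [← sq_abs (ev' j - ev i)]
      nlinarith [sq_nonneg (|ev' j - ev i| - 1)])
    (fun i => (hasSum_overlap b b' i).add (hE.hasSum_sq h h' i))
    (B := 1 + ‖E‖ ^ 2) (fun i => by simpa using norm_sq_apply_basis_le E b i)
  have habs : ∀ x, |w x| = w x := fun x => abs_of_nonneg (hw x)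
  have hW := hasSum_weighted (a := fun i => w (ev i)) (by simpa only [habs] using hws)
    (hE.hasSum_sq h h') (fun i j => (abs_of_nonneg (hsq0 i j)).le) (hE.hasSum_sq h h')
    (norm_sq_apply_basis_le E b)
  have hW' := hasSum_weighted' (a := fun j => w (ev' j)) (by simpa only [habs] using hws') hsq0
    (hE.hasSum_sq' h h') (norm_sq_apply_basis_le E b')
  have hR := (hF'.sub hF).sub hL
  have hB := (hW.add hW').mul_left C
  simp only [mul_one] at hR
  have hle : ∀ p : ι × ι', ‖f (ev' p.2) * overlap b b' p.1 p.2 - f (ev p.1) * overlap b b' p.1 p.2 -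
      f' (ev p.1) * ((ev' p.2 - ev p.1) * overlap b b' p.1 p.2)‖ ≤
      C * (w (ev p.1) * ((ev' p.2 - ev p.1) ^ 2 * overlap b b' p.1 p.2) +
        w (ev' p.2) * ((ev' p.2 - ev p.1) ^ 2 * overlap b b' p.1 p.2)) := fun p => by
    have h1 := mul_le_mul_of_nonneg_right (hT p.1 p.2) (overlap_nonneg b b' p.1 p.2)
    rw [← abs_of_nonneg (overlap_nonneg b b' p.1 p.2), ← abs_mul,
      abs_of_nonneg (overlap_nonneg b b' p.1 p.2)] at h1
    rw [Real.norm_eq_abs]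
    calc _ = _ := by congr 1; ring
      _ ≤ _ := h1
      _ = _ := by ring
  have h1 := tsum_of_norm_bounded hB hle
  rw [hR.tsum_eq, Real.norm_eq_abs] at h1
  refine h1.trans ?_
  rw [mul_assoc]
  refine mul_le_mul_of_nonneg_left ?_ hC
  rw [mul_add, mul_comm _ (∑' i, w (ev i)), mul_comm _ (∑' j, w (ev' j)), ← tsum_mul_right,
    ← tsum_mul_right]
  refine add_le_add ?_ ?_
  · have h2 := hW.summable.prod
    simp only [tsum_mul_left, (hE.hasSum_sq h h' _).tsum_eq] at h2
    exact h2.tsum_le_tsum (fun i => mul_le_mul_of_nonneg_left (norm_sq_apply_basis_le E b i) (hw _))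
      (hws.mul_right _)
  · have hle' : ∀ j, w (ev' j) * ‖E (b' j)‖ ^ 2 ≤ w (ev' j) * ‖E‖ ^ 2 := fun j =>
      mul_le_mul_of_nonneg_left (norm_sq_apply_basis_le E b' j) (hw _)
    have h2 : Summable fun j => w (ev' j) * ‖E (b' j)‖ ^ 2 :=
      Summable.of_nonneg_of_le (fun j => mul_nonneg (hw _) (sq_nonneg _)) hle' (hws'.mul_right _)
    exact h2.tsum_le_tsum hle' (hws'.mul_right _)

end Perturb

/-! ### The truncated Gaussian primitive -/

section Gauss

/-- The primitive `∫_{-∞}^x e^{-s²} ds`. -/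
def gaussPrim (x : ℝ) : ℝ := √Real.pi / 2 + ∫ s in (0 : ℝ)..x, Real.exp (-s ^ 2)

theorem continuous_gauss : Continuous fun s : ℝ => Real.exp (-s ^ 2) := by fun_prop

theorem hasDerivAt_gaussPrim (x : ℝ) : HasDerivAt gaussPrim (Real.exp (-x ^ 2)) x :=
  (intervalIntegral.integral_hasDerivAt_right (continuous_gauss.intervalIntegrable _ _)
    (continuous_gauss.stronglyMeasurableAtFilter _ _) continuous_gauss.continuousAt).const_add _

theorem integral_gauss_Ioi : ∫ s in Set.Ioi (0 : ℝ), Real.exp (-s ^ 2) = √Real.pi / 2 := by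
  simpa using integral_gaussian_Ioi 1

theorem integrable_gauss : MeasureTheory.Integrable fun s : ℝ => Real.exp (-s ^ 2) := by
  simpa using integrable_exp_neg_mul_sq (one_pos)

/-- The tail is $\int_0^\infty e^{-(s+y)^2}ds$, and $(s+y)^2\ge s^2+y^2$ for $s,y\ge0$. -/
theorem gaussTail_bounds {y : ℝ} (hy : 0 ≤ y) :
    0 ≤ √Real.pi / 2 - ∫ s in (0 : ℝ)..y, Real.exp (-s ^ 2) ∧
      √Real.pi / 2 - ∫ s in (0 : ℝ)..y, Real.exp (-s ^ 2) ≤ √Real.pi / 2 * Real.exp (-y ^ 2) := by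
  have h1 : √Real.pi / 2 - ∫ s in (0 : ℝ)..y, Real.exp (-s ^ 2) =
      ∫ s in Set.Ioi y, Real.exp (-s ^ 2) := by
    rw [← integral_gauss_Ioi, sub_eq_iff_eq_add, add_comm]
    exact (intervalIntegral.integral_interval_add_Ioi integrable_gauss.integrableOn
      integrable_gauss.integrableOn).symm
  have h2 : ∫ s in Set.Ioi y, Real.exp (-s ^ 2) =
      ∫ s in Set.Ioi (0 : ℝ), Real.exp (-(s + y) ^ 2) := by
    have := (MeasureTheory.measurePreserving_add_right MeasureTheory.volume y).setIntegral_preimage_emb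
      (measurableEmbedding_addRight y) (fun s : ℝ => Real.exp (-s ^ 2)) (Set.Ioi y)
    rw [Set.preimage_add_const_Ioi, sub_self] at this
    exact this.symm
  rw [h1]
  refine ⟨MeasureTheory.integral_nonneg fun _ => (Real.exp_pos _).le, ?_⟩
  rw [h2, ← integral_gauss_Ioi, mul_comm, ← MeasureTheory.integral_const_mul]
  refine MeasureTheory.setIntegral_mono_on ?_ ?_ measurableSet_Ioi fun s hs => ?_
  · exact (integrable_gauss.comp_add_right y).integrableOn
  · exact (integrable_gauss.const_mul _).integrableOn
  · rw [← Real.exp_add, Real.exp_le_exp]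
    nlinarith [mul_nonneg (Set.mem_Ioi.1 hs).le hy]

theorem integral_gauss_neg (x : ℝ) : ∫ s in (0 : ℝ)..(-x), Real.exp (-s ^ 2) =
    -∫ s in (0 : ℝ)..x, Real.exp (-s ^ 2) := by
  have := intervalIntegral.integral_comp_neg (fun s : ℝ => Real.exp (-s ^ 2)) (a := 0) (b := x)
  simp only [neg_sq, neg_zero] at this
  rw [this, intervalIntegral.integral_symm]

/-- The primitive of `e^{-x²}` on `ℝ ∖ {a}` that vanishes at `±∞`. -/
def gaussStep (a x : ℝ) : ℝ := if x < a then gaussPrim x else gaussPrim x - √Real.pi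

/-- The weight `e^{-x²/4}`. -/
def gaussWeight (x : ℝ) : ℝ := Real.exp (-(1 / 4) * x ^ 2)

theorem gaussWeight_pos (x : ℝ) : 0 < gaussWeight x := Real.exp_pos _

theorem exp_neg_sq_le_gaussWeight (x : ℝ) : Real.exp (-x ^ 2) ≤ gaussWeight x := by
  rw [gaussWeight, Real.exp_le_exp]
  nlinarith [sq_nonneg x]

theorem gaussPrim_nonneg_of_nonpos {x : ℝ} (hx : x ≤ 0) :
    0 ≤ gaussPrim x ∧ gaussPrim x ≤ √Real.pi / 2 * Real.exp (-x ^ 2) := by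
  have h := gaussTail_bounds (neg_nonneg.2 hx)
  rw [integral_gauss_neg, sub_neg_eq_add, neg_sq] at h
  exact h

theorem gaussPrim_bounds_of_nonneg {x : ℝ} (hx : 0 ≤ x) :
    -(√Real.pi / 2 * Real.exp (-x ^ 2)) ≤ gaussPrim x - √Real.pi ∧ gaussPrim x - √Real.pi ≤ 0 := by
  have h := gaussTail_bounds hx
  rw [gaussPrim]
  constructor <;> linarith [h.1, h.2]

/-- The tail bounds apply except on $[0,a)$, where the function is at most $\sqrt\pi$ and
$e^{a^2}e^{-x^2/4}\ge1$. -/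
theorem abs_gaussStep_le {a : ℝ} (ha : 0 ≤ a) (x : ℝ) :
    |gaussStep a x| ≤ √Real.pi * Real.exp (a ^ 2) * gaussWeight x := by
  have hpi : 0 ≤ √Real.pi := Real.sqrt_nonneg _
  have h1 : 1 ≤ Real.exp (a ^ 2) := Real.one_le_exp (sq_nonneg a)
  have hw := exp_neg_sq_le_gaussWeight x
  have hw0 := gaussWeight_pos x
  have h2 : √Real.pi / 2 * Real.exp (-x ^ 2) ≤ √Real.pi * Real.exp (a ^ 2) * gaussWeight x := by
    calc √Real.pi / 2 * Real.exp (-x ^ 2) ≤ √Real.pi * 1 * gaussWeight x := by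
          rw [mul_one]
          exact mul_le_mul (by linarith) hw (Real.exp_pos _).le hpi
      _ ≤ _ := by gcongr
  rw [gaussStep]
  split_ifs with h
  · rcases le_total x 0 with hx | hx
    · have := gaussPrim_nonneg_of_nonpos hx
      rw [abs_of_nonneg this.1]
      exact this.2.trans h2
    · have h3 := gaussPrim_bounds_of_nonneg hx
      have h4 : Real.exp (-x ^ 2) ≤ 1 := Real.exp_le_one_iff.2 (by nlinarith [sq_nonneg x])
      have h5 : 0 ≤ gaussPrim x := by nlinarith
      rw [abs_of_nonneg h5]
      have h6 : 1 ≤ Real.exp (a ^ 2) * gaussWeight x := by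
        rw [gaussWeight, ← Real.exp_add]
        refine Real.one_le_exp ?_
        nlinarith
      rw [mul_assoc]
      nlinarith
  · have h3 := gaussPrim_bounds_of_nonneg (ha.trans (not_lt.1 h))
    rw [abs_of_nonpos h3.2]
    linarith [h3.1]

/-- The derivative is bounded by $2|s|e^{-s^2}\le2e^{-s^2/2}$, and $x^2\le2s^2+2$ when $|s-x|\le1$;
hence the exponent $1/4$ in the weight. -/
theorem abs_gauss_sub_le {x t : ℝ} (ht : |t - x| ≤ 1) :
    |Real.exp (-t ^ 2) - Real.exp (-x ^ 2)| ≤ 2 * Real.exp (1 / 2) * gaussWeight x * |t - x| := by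
  have hd : ∀ s : ℝ, HasDerivAt (fun s : ℝ => Real.exp (-s ^ 2)) (Real.exp (-s ^ 2) * (-(2 * s))) s :=
    fun s => by simpa using ((hasDerivAt_pow 2 s).neg).exp
  have := (convex_Icc (x - 1) (x + 1)).norm_image_sub_le_of_norm_hasDerivWithin_le
    (f := fun s : ℝ => Real.exp (-s ^ 2)) (C := 2 * Real.exp (1 / 2) * gaussWeight x)
    (fun s _ => (hd s).hasDerivWithinAt) (fun s hs => ?_) (x := x) (y := t)
    ⟨by linarith, by linarith⟩ ⟨by linarith [(abs_le.1 ht).1], by linarith [(abs_le.1 ht).2]⟩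
  · exact this
  · rw [norm_mul, Real.norm_eq_abs, Real.norm_eq_abs, abs_of_pos (Real.exp_pos _), abs_neg, abs_mul,
      abs_two]
    have h1 : |s| ≤ Real.exp (s ^ 2 / 2) := by
      have := Real.add_one_le_exp (s ^ 2 / 2)
      rw [← sq_abs] at this ⊢
      nlinarith [sq_nonneg (|s| - 1)]
    have h2 : Real.exp (-s ^ 2) * Real.exp (s ^ 2 / 2) ≤ Real.exp (1 / 2) * gaussWeight x := by
      rw [gaussWeight, ← Real.exp_add, ← Real.exp_add, Real.exp_le_exp]
      have h3 : |x - s| ≤ 1 := abs_le.2 ⟨by linarith [hs.2], by linarith [hs.1]⟩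
      have h4 : (x - s) ^ 2 ≤ 1 := by rw [← sq_abs]; nlinarith [abs_nonneg (x - s)]
      nlinarith [sq_nonneg (x - 2 * s)]
    have h5 := mul_le_mul_of_nonneg_left h1 (Real.exp_pos (-s ^ 2)).le
    nlinarith

theorem abs_gaussPrim_taylor_le {x y : ℝ} (hy : |y - x| ≤ 1) :
    |gaussPrim y - gaussPrim x - Real.exp (-x ^ 2) * (y - x)| ≤
      2 * Real.exp (1 / 2) * gaussWeight x * (y - x) ^ 2 := by
  have hd : ∀ s : ℝ, HasDerivAt (fun s : ℝ => gaussPrim s - Real.exp (-x ^ 2) * s)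
      (Real.exp (-s ^ 2) - Real.exp (-x ^ 2)) s := fun s => by
    have := (hasDerivAt_gaussPrim s).sub ((hasDerivAt_id s).const_mul (Real.exp (-x ^ 2)))
    rwa [mul_one] at this
  have := (convex_uIcc x y).norm_image_sub_le_of_norm_hasDerivWithin_le
    (C := 2 * Real.exp (1 / 2) * gaussWeight x * |y - x|)
    (fun s _ => (hd s).hasDerivWithinAt) (fun s hs => ?_) (x := x) (y := y)
    Set.left_mem_uIcc Set.right_mem_uIcc
  · rw [Real.norm_eq_abs, Real.norm_eq_abs, mul_assoc, ← sq, sq_abs] at this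
    refine le_trans (le_of_eq ?_) this
    congr 1
    ring
  · have h1 : |s - x| ≤ |y - x| := Set.abs_sub_left_of_mem_uIcc hs
    refine (abs_gauss_sub_le (h1.trans hy)).trans ?_
    have := gaussWeight_pos x
    gcongr

/-- Points closer together than $\delta=\min(\varepsilon,1)$ lie on the same side of $a$, where
Taylor's formula for the smooth primitive applies. For points farther apart, $(y-x)^2\ge\delta^2$
absorbs the decay bounds. -/
theorem exists_gaussStep_taylor {a ε : ℝ} (ha : 0 ≤ a) (hε : 0 < ε) : ∃ C, 0 ≤ C ∧ ∀ x y,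
    ε ≤ |x - a| → ε ≤ |y - a| →
    |gaussStep a y - gaussStep a x - Real.exp (-x ^ 2) * (y - x)| ≤
      C * (gaussWeight x + gaussWeight y) * (y - x) ^ 2 := by
  set δ := min ε 1 with hδ
  have hδ0 : 0 < δ := lt_min hε one_pos
  set B := √Real.pi * Real.exp (a ^ 2)
  have hB : 0 ≤ B := by positivity
  refine ⟨2 * Real.exp (1 / 2) + (B / δ ^ 2 + 1 / δ), by positivity, fun x y hx hy => ?_⟩
  have hwx := gaussWeight_pos x
  have hwy := gaussWeight_pos y
  rcases lt_or_ge |y - x| δ with h | h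
  · have h1 : gaussStep a y - gaussStep a x = gaussPrim y - gaussPrim x := by
      have h2 := (abs_lt.1 (h.trans_le (min_le_left _ _)))
      rw [gaussStep, gaussStep]
      split_ifs with h3 h4 h4
      · rfl
      · rw [abs_of_nonneg (by linarith)] at hx
        linarith
      · rw [abs_of_nonneg (by linarith)] at hy
        linarith
      · ring
    rw [h1]
    refine (abs_gaussPrim_taylor_le (h.le.trans (min_le_right _ _))).trans ?_
    gcongr
    · have : 0 ≤ B / δ ^ 2 + 1 / δ := by positivity
      linarith
    · linarith
  · have h1 : 1 ≤ (y - x) ^ 2 / δ ^ 2 := by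
      rw [one_le_div (by positivity), ← sq_abs (y - x)]
      exact pow_le_pow_left₀ hδ0.le h 2
    have h2 : |y - x| ≤ (y - x) ^ 2 / δ := by
      rw [le_div_iff₀ hδ0, ← sq_abs (y - x), sq]
      exact mul_le_mul_of_nonneg_left h (abs_nonneg _)
    have h3 := abs_gaussStep_le ha x
    have h4 := abs_gaussStep_le ha y
    have h5 : |Real.exp (-x ^ 2) * (y - x)| ≤ gaussWeight x * ((y - x) ^ 2 / δ) := by
      rw [abs_mul, abs_of_pos (Real.exp_pos _)]
      exact mul_le_mul (exp_neg_sq_le_gaussWeight x) h2 (abs_nonneg _) hwx.le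
    have h6 : B * (gaussWeight x + gaussWeight y) ≤
        B * (gaussWeight x + gaussWeight y) * ((y - x) ^ 2 / δ ^ 2) :=
      le_mul_of_one_le_right (by positivity) h1
    have h7 : 0 ≤ gaussWeight y * ((y - x) ^ 2 / δ) := by positivity
    have h8 : 0 ≤ 2 * Real.exp (1 / 2) * (gaussWeight x + gaussWeight y) * (y - x) ^ 2 := by
      positivity
    calc _ ≤ |gaussStep a y| + |gaussStep a x| + |Real.exp (-x ^ 2) * (y - x)| :=
          (abs_sub _ _).trans (add_le_add_left (abs_sub _ _) _)
      _ ≤ B * (gaussWeight x + gaussWeight y) + gaussWeight x * ((y - x) ^ 2 / δ) := by linarith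
      _ ≤ B * (gaussWeight x + gaussWeight y) * ((y - x) ^ 2 / δ ^ 2) +
          gaussWeight x * ((y - x) ^ 2 / δ) + gaussWeight y * ((y - x) ^ 2 / δ) +
          2 * Real.exp (1 / 2) * (gaussWeight x + gaussWeight y) * (y - x) ^ 2 := by linarith
      _ = _ := by ring

theorem gaussStep_sub {a : ℝ} (ha : 0 ≤ a) (x : ℝ) :
    gaussStep a x - gaussStep 0 x = √Real.pi * (if x ∈ Set.Ico 0 a then 1 else 0) := by
  simp only [gaussStep, Set.mem_Ico]
  split_ifs <;> first | linarith | grind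

end Gauss

/-! ### Spectral subspaces and resolvent sets in an eigenbasis -/

section Spectral

variable {K : Type*} [NormedAddCommGroup K] [InnerProductSpace ℂ K] {ι : Type*}
  {D : K →ₗ.[ℂ] K} {b : HilbertBasis ι ℂ K} {ev : ι → ℝ}

theorem finite_eigenvalues (hev : Tendsto (fun i => |ev i|) cofinite atTop) (R : ℝ) :
    {i | |ev i| ≤ R}.Finite := by
  have := hev.eventually_gt_atTop R
  simpa [Filter.eventually_cofinite] using this

theorem exists_gap (hev : Tendsto (fun i => |ev i|) cofinite atTop) {c : ℝ} (hc : ∀ i, ev i ≠ c) :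
    ∃ ε > 0, ∀ i, ε ≤ |ev i - c| := by
  have hfin := finite_eigenvalues hev (|c| + 1)
  obtain ⟨ε, hε, h⟩ : ∃ ε > 0, ∀ i ∈ hfin.toFinset, ε ≤ |ev i - c| := by
    rcases hfin.toFinset.eq_empty_or_nonempty with h | h
    · exact ⟨1, one_pos, by simp [h]⟩
    · obtain ⟨i, _, hi⟩ := hfin.toFinset.exists_min_image (fun i => |ev i - c|) h
      exact ⟨|ev i - c|, abs_pos.2 (sub_ne_zero.2 (hc i)), hi⟩
  refine ⟨min ε 1, lt_min hε one_pos, fun i => ?_⟩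
  by_cases hi : |ev i| ≤ |c| + 1
  · exact (min_le_left _ _).trans (h i (by simpa using hi))
  · refine (min_le_right _ _).trans ?_
    have := abs_sub_abs_le_abs_sub (ev i) c
    linarith

theorem IsEigenBasis.ne_of_inResolventSet (h : IsEigenBasis D b ev) {c : ℝ}
    (hc : InResolventSet D c) (i : ι) : ev i ≠ c := by
  rintro rfl
  obtain ⟨hm, he⟩ := h.maps_basis i
  have h0 := @hc.1 ⟨b i, hm⟩ 0 (by
    change D ⟨b i, hm⟩ - (ev i : ℂ) • b i = D 0 - (ev i : ℂ) • (0 : K)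
    rw [he, sub_self, D.map_zero, smul_zero, sub_zero])
  have h1 : b i = 0 := congrArg Subtype.val h0
  have := b.orthonormal.1 i
  rw [h1, norm_zero] at this
  exact zero_ne_one this

theorem IsEigenBasis.inResolventSet (h : IsEigenBasis D b ev) {c ε : ℝ} (hε : 0 < ε)
    (hgap : ∀ i, ε ≤ |ev i - c|) : InResolventSet D c := by
  have hne : ∀ i, (ev i : ℂ) - c ≠ 0 := fun i h0 => by
    have h1 : ev i - c = 0 := by exact_mod_cast h0
    have := hgap i
    rw [h1, abs_zero] at this
    linarith
  constructor
  · rintro ⟨x, hx⟩ ⟨y, hy⟩ hxy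
    refine Subtype.ext (basis_ext b fun i => ?_)
    have h1 : D ⟨x, hx⟩ - (c : ℂ) • x = D ⟨y, hy⟩ - (c : ℂ) • y := hxy
    have h2 := congrArg (fun z => ⟪b i, z⟫) h1
    simp only [inner_sub_right, inner_smul_right, h.inner_apply _ _ (maps_apply hx),
      h.inner_apply _ _ (maps_apply hy), ← sub_mul] at h2
    exact mul_left_cancel₀ (hne i) h2
  · intro y
    have hb : ∀ i, ‖((ev i : ℂ) - c)⁻¹‖ ≤ ε⁻¹ := fun i => by
      rw [norm_inv, ← Complex.ofReal_sub, Complex.norm_real]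
      exact inv_anti₀ hε (hgap i)
    obtain ⟨x, hx⟩ := basis_exists b (summable_mul_norm_sq b hb y)
    obtain ⟨hm, he⟩ : Maps D x (y + (c : ℂ) • x) := h.maps_iff.2 fun i => by
      rw [inner_add_right, inner_smul_right, hx]
      field_simp [hne i]
      ring
    exact ⟨⟨x, hm⟩, by
      change D ⟨x, hm⟩ - (c : ℂ) • x = y
      rw [he, add_sub_cancel_right]⟩

theorem IsEigenBasis.spectralSubspace_eq (h : IsEigenBasis D b ev) {J : Set ℝ}
    (hJ : {i | ev i ∈ J}.Finite) :
    spectralSubspace D J = Submodule.span ℂ (Set.range fun i : {i | ev i ∈ J} => b i) := by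
  apply le_antisymm
  · refine iSup₂_le fun c hc v hv => ?_
    rw [mem_eigenspace] at hv
    have hv0 : ∀ i, ev i ∉ J → ⟪b i, v⟫ = 0 := fun i hi => by
      have h1 := h.inner_apply _ _ hv i
      rw [inner_smul_right] at h1
      have h2 : ((ev i : ℂ) - c) * ⟪b i, v⟫ = 0 := by linear_combination -h1
      refine (mul_eq_zero.1 h2).resolve_left fun h3 => hi ?_
      have : ev i = c := by exact_mod_cast sub_eq_zero.1 h3
      rwa [this]
    have h3 := b.hasSum_repr v
    have h4 : HasSum (fun i => b.repr v i • b i) (∑ i ∈ hJ.toFinset, b.repr v i • b i) := by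
      refine hasSum_sum_of_ne_finset_zero fun i hi => ?_
      rw [b.repr_apply_apply, hv0 i (by simpa using hi), zero_smul]
    rw [h3.unique h4]
    refine Submodule.sum_mem _ fun i hi => Submodule.smul_mem _ _ (Submodule.subset_span ?_)
    exact ⟨⟨i, by simpa using hi⟩, rfl⟩
  · rw [Submodule.span_le]
    rintro _ ⟨⟨i, hi⟩, rfl⟩
    exact Submodule.mem_iSup_of_mem (ev i) (Submodule.mem_iSup_of_mem hi
      (mem_eigenspace.2 (h.maps_basis i)))

theorem IsEigenBasis.finiteDimensional (h : IsEigenBasis D b ev) {J : Set ℝ}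
    (hJ : {i | ev i ∈ J}.Finite) : FiniteDimensional ℂ (spectralSubspace D J) := by
  rw [h.spectralSubspace_eq hJ]
  have : Finite {i | ev i ∈ J} := hJ
  exact FiniteDimensional.span_of_finite ℂ (Set.finite_range _)

theorem IsEigenBasis.hasSum_indicator (h : IsEigenBasis D b ev) {J : Set ℝ} [DecidablePred (· ∈ J)]
    (hJ : {i | ev i ∈ J}.Finite) : HasSum (fun i => if ev i ∈ J then (1 : ℝ) else 0)
      (Module.finrank ℂ (spectralSubspace D J)) := by
  classical
  have : Fintype {i | ev i ∈ J} := hJ.fintype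
  have h1 : Module.finrank ℂ (spectralSubspace D J) = hJ.toFinset.card := by
    have hli : LinearIndependent ℂ fun i : {i | ev i ∈ J} => b i :=
      b.orthonormal.linearIndependent.comp _ Subtype.val_injective
    rw [h.spectralSubspace_eq hJ, finrank_span_eq_card hli, Set.Finite.card_toFinset]
  have h2 : HasSum (fun i => if ev i ∈ J then (1 : ℝ) else 0)
      (∑ i ∈ hJ.toFinset, (if ev i ∈ J then (1 : ℝ) else 0)) :=
    hasSum_sum_of_ne_finset_zero fun i hi => if_neg (by simpa using hi)
  have h3 : ∑ i ∈ hJ.toFinset, (if ev i ∈ J then (1 : ℝ) else 0) = hJ.toFinset.card := by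
    rw [Finset.sum_congr rfl fun i hi => if_pos (by simpa using hi)]
    simp
  rw [h1, ← h3]
  exact h2

theorem summable_gaussStep {a : ℝ} (ha : 0 ≤ a)
    (hs : ∀ t : ℝ, 0 < t → Summable fun i => Real.exp (-t * ev i ^ 2)) :
    Summable fun i => |gaussStep a (ev i)| :=
  Summable.of_nonneg_of_le (fun _ => abs_nonneg _) (fun i => abs_gaussStep_le ha (ev i))
    ((hs (1 / 4) (by norm_num)).mul_left _)

/-- Change of the truncated trace when the cut is moved from `0` to `a`. -/
theorem IsEigenBasis.tsum_gaussStep (h : IsEigenBasis D b ev) {a : ℝ} (ha : 0 ≤ a)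
    (hs : ∀ t : ℝ, 0 < t → Summable fun i => Real.exp (-t * ev i ^ 2)) :
    ∑' i, gaussStep a (ev i) = ∑' i, gaussStep 0 (ev i) +
      √Real.pi * Module.finrank ℂ (spectralSubspace D (Set.Ico 0 a)) := by
  classical
  have hJ : {i | ev i ∈ Set.Ico 0 a}.Finite :=
    (finite_eigenvalues (tendsto_abs_of_summable_exp (hs 1 one_pos)) a).subset fun i hi => by
      have hi' : 0 ≤ ev i ∧ ev i < a := hi
      change |ev i| ≤ a
      rw [abs_of_nonneg hi'.1]
      exact hi'.2.le
  have h1 := (summable_gaussStep le_rfl hs).of_abs.hasSum.add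
    ((h.hasSum_indicator hJ).mul_left √Real.pi)
  rw [← h1.tsum_eq]
  refine tsum_congr fun i => ?_
  rw [← gaussStep_sub ha]
  ring

/-- The spectral sums do not depend on the eigenbasis. -/
theorem IsEigenBasis.tsum_unique {ι' : Type*} {b' : HilbertBasis ι' ℂ K} {ev' : ι' → ℝ}
    (h : IsEigenBasis D b ev) (h' : IsEigenBasis D b' ev') {f : ℝ → ℝ}
    (hf : Summable fun i => |f (ev i)|) (hf' : Summable fun j => |f (ev' j)|) :
    ∑' i, f (ev i) = ∑' j, f (ev' j) := by
  have hE : IsPerturbation D D 0 := ⟨by simp, by simp⟩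
  have h1 := hasSum_weighted hf (hasSum_overlap b b')
    (fun i j => (abs_of_nonneg (overlap_nonneg b b' i j)).le) (hasSum_overlap b b') fun _ => le_rfl
  have h2 := hasSum_weighted' hf' (overlap_nonneg b b') (hasSum_overlap' b b') fun _ => le_rfl
  simp only [mul_one] at h1 h2
  refine h1.unique (h2.congr_fun fun p => ?_)
  have h3 := hE.sq_mul_overlap h h' p.1 p.2
  rw [zero_apply, inner_zero_right, norm_zero, zero_pow two_ne_zero] at h3
  rcases mul_eq_zero.1 h3 with h4 | h4
  · rw [sub_eq_zero.1 (pow_eq_zero_iff two_ne_zero |>.1 h4)]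
  · rw [h4, mul_zero, mul_zero]

end Spectral

/-! ### Spectral flow along an affine path -/

section Flow

universe w

variable {K : Type w} [NormedAddCommGroup K] [InnerProductSpace ℂ K]

/-- An affine path `D u`, of velocity `B`, of diagonalized operators with trace class heat
semigroups. -/
structure IsEigenFamily (D : ℝ → K →ₗ.[ℂ] K) (B : K →L[ℂ] K) {ι : ℝ → Type w}
    (b : ∀ u, HilbertBasis (ι u) ℂ K) (ev : ∀ u, ι u → ℝ) : Prop where
  perturb : ∀ u v, IsPerturbation (D u) (D v) (((v - u : ℝ) : ℂ) • B)
  basis : ∀ u, IsEigenBasis (D u) (b u) (ev u)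
  summable : ∀ u t : ℝ, 0 < t → Summable fun i => Real.exp (-t * ev u i ^ 2)

/-- `Tr(B e^{-D_u²})` in the eigenbasis of `D_u`. -/
def velocityTrace (B : K →L[ℂ] K) {ι : ℝ → Type w} (b : ∀ u, HilbertBasis (ι u) ℂ K)
    (ev : ∀ u, ι u → ℝ) (u : ℝ) : ℝ :=
  ∑' i, Real.exp (-ev u i ^ 2) * (⟪b u i, B (b u i)⟫ : ℂ).re

/-- The truncated trace `Tr f_a(D_u)`. -/
def stepTrace {ι : ℝ → Type w} (ev : ∀ u, ι u → ℝ) (a u : ℝ) : ℝ := ∑' i, gaussStep a (ev u i)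

variable {D : ℝ → K →ₗ.[ℂ] K} {B : K →L[ℂ] K} {ι : ℝ → Type w}
  {b : ∀ u, HilbertBasis (ι u) ℂ K} {ev : ∀ u, ι u → ℝ}

theorem hasDerivAt_of_quadratic {f : ℝ → ℝ} {d u δ L : ℝ} (hδ : 0 < δ)
    (h : ∀ v, |v - u| < δ → |f v - f u - (v - u) * d| ≤ L * (v - u) ^ 2) : HasDerivAt f d u := by
  rw [hasDerivAt_iff_isLittleO]
  have h1 : (fun v => f v - f u - (v - u) • d) =O[𝓝 u] fun v => (v - u) ^ 2 := by
    refine Asymptotics.IsBigO.of_bound L ?_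
    filter_upwards [Metric.ball_mem_nhds u hδ] with v hv
    rw [Real.norm_eq_abs, Real.norm_of_nonneg (sq_nonneg _)]
    exact h v hv
  refine h1.trans_isLittleO ?_
  have h2 := Asymptotics.isLittleO_pow_sub_sub u one_lt_two
  simpa using h2

theorem norm_real_smul (B : K →L[ℂ] K) (r : ℝ) : ‖(r : ℂ) • B‖ = |r| * ‖B‖ := by
  rw [norm_smul, Complex.norm_real, Real.norm_eq_abs]

theorem IsEigenFamily.tendsto (h : IsEigenFamily D B b ev) (u : ℝ) :
    Tendsto (fun i => |ev u i|) cofinite atTop :=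
  tendsto_abs_of_summable_exp (h.summable u 1 one_pos)

theorem IsEigenFamily.tsum_exp_le (h : IsEigenFamily D B b ev) {t : ℝ} (ht : 0 < t) {u v R : ℝ}
    (huv : |v - u| ≤ R) : ∑' j, Real.exp (-t * ev v j ^ 2) ≤
      Real.exp (t * (R * ‖B‖) ^ 2) * ∑' i, Real.exp (-(t / 2) * ev u i ^ 2) := by
  refine ((h.perturb u v).summable_exp (h.basis u) (h.basis v) ht.le
    (h.summable u _ (half_pos ht))).2.trans ?_
  refine mul_le_mul_of_nonneg_right ?_ (tsum_nonneg fun _ => (Real.exp_pos _).le)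
  rw [Real.exp_le_exp, norm_real_smul]
  gcongr

/-- If $|\lambda'_j-c|<\varepsilon$, then $|\lambda'_j-\lambda_i|>\varepsilon$ for all $i$,
uniformly. The second moment would exceed $\varepsilon^2$, although it is at most $(|v-u|\|B\|)^2$.
-/
theorem IsEigenFamily.gap (h : IsEigenFamily D B b ev) {u v c ε : ℝ} (hε : 0 < ε)
    (hgap : ∀ i, 2 * ε ≤ |ev u i - c|) (huv : |v - u| * ‖B‖ ≤ ε) (j : ι v) : ε ≤ |ev v j - c| := by
  by_contra! hj
  set η := 2 * ε - |ev v j - c| with hη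
  have h1 : ∀ i, η ^ 2 * overlap (b u) (b v) i j ≤
      (ev v j - ev u i) ^ 2 * overlap (b u) (b v) i j := fun i => by
    refine mul_le_mul_of_nonneg_right ?_ (overlap_nonneg _ _ _ _)
    rw [← sq_abs (ev v j - ev u i)]
    refine pow_le_pow_left₀ (by linarith) ?_ 2
    have := abs_sub_le (ev u i) (ev v j) c
    rw [abs_sub_comm (ev u i) (ev v j)] at this
    linarith [hgap i]
  have h2 := hasSum_le h1 ((hasSum_overlap' (b u) (b v) j).mul_left (η ^ 2))
    ((h.perturb u v).hasSum_sq' (h.basis u) (h.basis v) j)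
  have h3 := norm_sq_apply_basis_le (((v - u : ℝ) : ℂ) • B) (b v) j
  rw [norm_real_smul] at h3
  have h4 : (|v - u| * ‖B‖) ^ 2 ≤ ε ^ 2 := pow_le_pow_left₀ (by positivity) huv 2
  nlinarith

theorem IsEigenFamily.abs_velocityTrace_le (h : IsEigenFamily D B b ev) {u v R : ℝ}
    (huv : |v - u| ≤ R) : |velocityTrace B b ev v| ≤
      Real.exp (1 * (R * ‖B‖) ^ 2) * (∑' i, Real.exp (-(1 / 2) * ev u i ^ 2)) * ‖B‖ := by
  have h1 := ((h.summable v 1 one_pos).hasSum).mul_right ‖B‖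
  refine (Real.norm_eq_abs _ ▸ tsum_of_norm_bounded h1 fun i => ?_ :
    |velocityTrace B b ev v| ≤ _).trans (mul_le_mul_of_nonneg_right (h.tsum_exp_le one_pos huv) (norm_nonneg B))
  rw [norm_mul, neg_one_mul, Real.norm_of_nonneg (Real.exp_pos _).le]
  refine mul_le_mul_of_nonneg_left ?_ (Real.exp_pos _).le
  refine (Complex.abs_re_le_norm _).trans ((norm_inner_le_norm _ _).trans ?_)
  have := B.le_opNorm (b v i)
  rw [(b v).orthonormal.1, mul_one] at this
  rwa [(b v).orthonormal.1, one_mul]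

/-- The jump of $f_a$ sits in a gap shared by the spectra of $D_u$ and all nearby $D_v$, so the
trace Taylor formula has an error $O((v-u)^2)$. -/
theorem IsEigenFamily.hasDerivAt_stepTrace (h : IsEigenFamily D B b ev) {a u : ℝ} (ha : 0 ≤ a)
    (hu : ∀ i, ev u i ≠ a) : HasDerivAt (stepTrace ev a) (velocityTrace B b ev u) u := by
  obtain ⟨ε, hε, hgap⟩ := exists_gap (h.tendsto u) hu
  obtain ⟨C, hC, hT⟩ := exists_gaussStep_taylor ha (half_pos hε)
  set S := ∑' i, Real.exp (-(1 / 4 / 2) * ev u i ^ 2)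
  set W := ∑' i, gaussWeight (ev u i)
  -- The second entry of the minimum preserves half of the gap; the first bounds
  -- $\operatorname{Tr}e^{-D_v^2/4}$ uniformly in $v$.
  refine hasDerivAt_of_quadratic (δ := min 1 (ε / 2 / (‖B‖ + 1))) (by positivity)
    (L := C * ‖B‖ ^ 2 * (W + Real.exp (1 / 4 * (1 * ‖B‖) ^ 2) * S)) fun v hv => ?_
  have hv1 : |v - u| ≤ 1 := hv.le.trans (min_le_left _ _)
  have hv2 : |v - u| * ‖B‖ ≤ ε / 2 := by
    have h1 := hv.le.trans (min_le_right _ _)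
    rw [le_div_iff₀ (by positivity)] at h1
    nlinarith [abs_nonneg (v - u)]
  have hgap' := h.gap (half_pos hε) (c := a) (fun i => by linarith [hgap i]) hv2
  have h1 := (h.perturb u v).taylor (h.basis u) (h.basis v) (f := gaussStep a)
    (f' := fun x => Real.exp (-x ^ 2)) (w := gaussWeight) hC (fun x => (gaussWeight_pos x).le)
    (summable_gaussStep ha (h.summable u)) (summable_gaussStep ha (h.summable v))
    (by
      simp only [abs_of_pos (Real.exp_pos _)]
      simpa using h.summable u 1 one_pos)
    (h.summable u (1 / 4) (by norm_num)) (h.summable v (1 / 4) (by norm_num))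
    (fun i j => hT _ _ (by linarith [hgap i]) (hgap' j))
  have h2 : ∑' i, Real.exp (-ev u i ^ 2) *
      (⟪b u i, (((v - u : ℝ) : ℂ) • B) (b u i)⟫ : ℂ).re = (v - u) * velocityTrace B b ev u := by
    rw [velocityTrace, ← tsum_mul_left]
    refine tsum_congr fun i => ?_
    rw [smul_apply, inner_smul_right, Complex.re_ofReal_mul]
    ring
  rw [h2, norm_real_smul, mul_pow, sq_abs] at h1
  refine h1.trans ?_
  have h3 : ∑' j, gaussWeight (ev v j) ≤ Real.exp (1 / 4 * (1 * ‖B‖) ^ 2) * S :=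
    h.tsum_exp_le (by norm_num) hv1
  calc _ ≤ C * ((v - u) ^ 2 * ‖B‖ ^ 2) * (W + Real.exp (1 / 4 * (1 * ‖B‖) ^ 2) * S) := by gcongr
    _ = _ := by ring

theorem IsEigenFamily.integral_velocityTrace (h : IsEigenFamily D B b ev) {a u v : ℝ} (ha : 0 ≤ a)
    (huv : u ≤ v) (hres : ∀ r ∈ Set.Icc u v, ∀ i, ev r i ≠ a) :
    IntervalIntegrable (velocityTrace B b ev) MeasureTheory.volume u v ∧
      ∫ r in u..v, velocityTrace B b ev r = stepTrace ev a v - stepTrace ev a u := by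
  have hderiv : ∀ r ∈ Set.uIcc u v, HasDerivAt (stepTrace ev a) (velocityTrace B b ev r) r :=
    fun r hr => h.hasDerivAt_stepTrace ha (hres r (by rwa [Set.uIcc_of_le huv] at hr))
  have hint : IntervalIntegrable (velocityTrace B b ev) MeasureTheory.volume u v := by
    rw [intervalIntegrable_iff_integrableOn_Ioc_of_le huv]
    -- Measurability of the integrand, whose eigenbases are chosen arbitrarily in `u`, comes from
    -- its being a derivative.
    have heq : Set.EqOn (deriv (stepTrace ev a)) (velocityTrace B b ev) (Set.Ioc u v) :=
      fun r hr => (hderiv r (Set.uIcc_of_le huv ▸ Set.Ioc_subset_Icc_self hr)).deriv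
    refine MeasureTheory.IntegrableOn.congr_fun ?_ heq measurableSet_Ioc
    refine MeasureTheory.Measure.integrableOn_of_bounded
      (M := Real.exp (1 * ((v - u) * ‖B‖) ^ 2) *
        (∑' i, Real.exp (-(1 / 2) * ev u i ^ 2)) * ‖B‖) (by simp)
      (measurable_deriv _).aestronglyMeasurable ?_
    filter_upwards [MeasureTheory.ae_restrict_mem measurableSet_Ioc] with r hr
    rw [heq hr]
    refine h.abs_velocityTrace_le ?_
    rw [abs_of_nonneg (by linarith [hr.1])]
    linarith [hr.2]
  exact ⟨hint, intervalIntegral.integral_eq_sub_of_hasDerivAt hderiv hint⟩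

theorem IsEigenFamily.stepTrace_eq (h : IsEigenFamily D B b ev) {a : ℝ} (ha : 0 ≤ a) (u : ℝ) :
    stepTrace ev a u = stepTrace ev 0 u +
      √Real.pi * Module.finrank ℂ (spectralSubspace (D u) (Set.Ico 0 a)) :=
  (h.basis u).tsum_gaussStep ha (h.summable u)

/-- The integral formula for the spectral flow. -/
theorem IsEigenFamily.integral_eq_of_isSpectralFlow (h : IsEigenFamily D B b ev) {m : ℤ}
    (hm : IsSpectralFlow D m) : IntervalIntegrable (velocityTrace B b ev) MeasureTheory.volume 0 1 ∧
      ∫ r in (0 : ℝ)..1, velocityTrace B b ev r =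
        stepTrace ev 0 1 - stepTrace ev 0 0 + √Real.pi * m := by
  obtain ⟨k, s, a, hs, hs0, hs1, ha, hres, rfl⟩ := hm
  -- The partition is continued constantly beyond its last point, so that it can be indexed by
  -- natural numbers.
  let s' : ℕ → ℝ := fun n => s ⟨min n k, by omega⟩
  have h0 : s' 0 = 0 := by rw [← hs0]; simp [s']
  have h1 : s' k = 1 := by rw [← hs1]; simp [s', Fin.last]
  have hcast : ∀ i : Fin k, s' i = s i.castSucc := fun i =>
    congrArg s (Fin.ext (min_eq_left i.2.le))
  have hsucc : ∀ i : Fin k, s' (i + 1) = s i.succ := fun i =>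
    congrArg s (Fin.ext (min_eq_left i.2))
  have key : ∀ i : Fin k, IntervalIntegrable (velocityTrace B b ev) MeasureTheory.volume
      (s' i) (s' (i + 1)) ∧ ∫ r in s' i..s' (i + 1), velocityTrace B b ev r =
      (stepTrace ev 0 (s' (i + 1)) - stepTrace ev 0 (s' i)) + √Real.pi *
      ((Module.finrank ℂ (spectralSubspace (D (s i.succ)) (Set.Ico 0 (a i))) : ℝ) -
        Module.finrank ℂ (spectralSubspace (D (s i.castSucc)) (Set.Ico 0 (a i)))) := fun i => by
    rw [hcast, hsucc]
    have h2 := h.integral_velocityTrace (ha i) (hs (Fin.castSucc_le_succ i)) fun r hr =>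
      (h.basis r).ne_of_inResolventSet (hres i r hr).1
    refine ⟨h2.1, h2.2.trans ?_⟩
    rw [h.stepTrace_eq (ha i), h.stepTrace_eq (ha i)]
    ring
  have hint : ∀ n < k, IntervalIntegrable (velocityTrace B b ev) MeasureTheory.volume
      (s' n) (s' (n + 1)) := fun n hn => (key ⟨n, hn⟩).1
  have h2 := IntervalIntegrable.trans_iterate hint
  have h3 := intervalIntegral.sum_integral_adjacent_intervals hint
  rw [h0, h1] at h2 h3
  refine ⟨h2, ?_⟩
  rw [← h3, Finset.sum_range, Finset.sum_congr rfl fun i _ => (key i).2, Finset.sum_add_distrib,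
    ← Finset.sum_range (fun n => stepTrace ev 0 (s' (n + 1)) - stepTrace ev 0 (s' n)),
    Finset.sum_range_sub (fun n => stepTrace ev 0 (s' n)), h0, h1, ← Finset.mul_sum]
  push_cast
  rfl

/-- Only finitely many eigenvalues lie in $[-1,1]$, so some $a\in[0,1]$ avoids their absolute
values. -/
theorem IsEigenFamily.exists_cut (h : IsEigenFamily D B b ev) (u : ℝ) :
    ∃ a ε : ℝ, 0 ≤ a ∧ 0 < ε ∧ ∀ i, 2 * ε ≤ |ev u i - a| ∧ 2 * ε ≤ |ev u i - -a| := by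
  obtain ⟨a, ha, hna⟩ := (Set.Icc_infinite (zero_lt_one' ℝ)).exists_notMem_finite
    ((finite_eigenvalues (h.tendsto u) 1).image fun i => |ev u i|)
  have hne : ∀ i, |ev u i| ≠ a := fun i hi => hna ⟨i, by
    change |ev u i| ≤ 1
    rw [hi]; exact ha.2, hi⟩
  obtain ⟨ε₁, h1, h1'⟩ := exists_gap (h.tendsto u) (c := a) fun i hi =>
    hne i (by rw [hi, abs_of_nonneg ha.1])
  obtain ⟨ε₂, h2, h2'⟩ := exists_gap (h.tendsto u) (c := -a) fun i hi =>
    hne i (by rw [hi, abs_neg, abs_of_nonneg ha.1])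
  refine ⟨a, min ε₁ ε₂ / 2, ha.1, half_pos (lt_min h1 h2), fun i => ?_⟩
  rw [mul_div_cancel₀ _ two_ne_zero]
  exact ⟨(min_le_left _ _).trans (h1' i), (min_le_right _ _).trans (h2' i)⟩

/-- A cut chosen at $u$ works while $|r-u|\|B\|<\varepsilon_u$. These sets cover $[0,1]$, and by
compactness some finite partition is subordinate to them. -/
theorem IsEigenFamily.exists_isSpectralFlow (h : IsEigenFamily D B b ev) :
    ∃ m, IsSpectralFlow D m := by
  choose a ε ha hε hgap using h.exists_cut
  obtain ⟨t, ht0, ht, ⟨k, hk⟩, hsub⟩ := exists_monotone_Icc_subset_open_cover_Icc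
    (zero_le_one' ℝ) (c := fun u : Set.Icc (0 : ℝ) 1 =>
      {r : Set.Icc (0 : ℝ) 1 | |(r : ℝ) - u| * ‖B‖ < ε u})
    (fun u => isOpen_lt (by fun_prop) continuous_const)
    (fun u _ => Set.mem_iUnion.2 ⟨u, by simpa using hε u⟩)
  choose c hc using hsub
  refine ⟨_, k, fun i => t i, fun i => a (c i), fun i j hij => ht hij, by simp [ht0],
    by simp [hk k le_rfl], fun i => ha _, fun i r hr => ?_, rfl⟩
  have hr01 : r ∈ Set.Icc (0 : ℝ) 1 :=
    ⟨(t i.castSucc).2.1.trans hr.1, hr.2.trans (t i.succ).2.2⟩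
  have hrc : |r - c i| * ‖B‖ ≤ ε (c i) :=
    le_of_lt (hc i (show (⟨r, hr01⟩ : Set.Icc (0 : ℝ) 1) ∈ Set.Icc (t i) (t (i + 1)) from
      ⟨Subtype.coe_le_coe.1 (by simpa using hr.1), Subtype.coe_le_coe.1 (by simpa using hr.2)⟩))
  have hg1 := h.gap (hε (c i)) (fun j => (hgap (c i) j).1) hrc
  have hg2 := h.gap (hε (c i)) (fun j => (hgap (c i) j).2) hrc
  refine ⟨(h.basis r).inResolventSet (hε (c i)) hg1, ?_, ?_⟩
  · exact (h.basis r).inResolventSet (hε (c i)) hg2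
  · exact (h.basis r).finiteDimensional ((finite_eigenvalues (h.tendsto r) (a (c i))).subset
      fun j hj => abs_le.2 hj)

end Flow

/-! ### Amplification -/

section Amplification

universe w

variable {H : Type w} [NormedAddCommGroup H] [InnerProductSpace ℂ H] {N : ℕ}

theorem maps_ampOp_iff {D : H →ₗ.[ℂ] H} {x y : Amp H N} :
    Maps (ampOp N D) x y ↔ ∀ i, Maps D (x i) (y i) := by
  constructor
  · rintro ⟨hx, rfl⟩ i
    exact ⟨hx i, rfl⟩
  · intro h
    refine ⟨fun i => (h i).mem, ?_⟩
    ext i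
    exact (maps_apply (h i).mem).unique (h i)

theorem inner_toLp_single (j : Fin N) (v : H) (x : Amp H N) :
    ⟪(WithLp.toLp 2 (Pi.single j v) : Amp H N), x⟫ = ⟪v, x j⟫ := by
  rw [PiLp.inner_apply, Finset.sum_eq_single j]
  · simp
  · intro i _ hij
    simp [Pi.single_eq_of_ne hij]
  · simp

theorem exists_ampBasis [CompleteSpace H] {ι : Type*} (b : HilbertBasis ι ℂ H) (N : ℕ) :
    ∃ β : HilbertBasis (Fin N × ι) ℂ (Amp H N), ∀ p x, ⟪β p, x⟫ = ⟪b p.2, x p.1⟫ := by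
  have horth : Orthonormal ℂ fun p : Fin N × ι =>
      (WithLp.toLp 2 (Pi.single p.1 (b p.2)) : Amp H N) := by
    classical
    rw [orthonormal_iff_ite]
    rintro ⟨j, i⟩ ⟨j', i'⟩
    rw [inner_toLp_single]
    by_cases hj : j = j'
    · subst hj
      have := (orthonormal_iff_ite.1 b.orthonormal) i i'
      simpa using this
    · simp [hj]
  have hbot : (Submodule.span ℂ (Set.range fun p : Fin N × ι =>
      (WithLp.toLp 2 (Pi.single p.1 (b p.2)) : Amp H N)))ᗮ = ⊥ := by
    refine (Submodule.eq_bot_iff _).2 fun x hx => ?_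
    ext j
    refine basis_ext b fun i => ?_
    have := (Submodule.mem_orthogonal _ _).1 hx _ (Submodule.subset_span ⟨(j, i), rfl⟩)
    rw [inner_toLp_single] at this
    rw [this]
    simp
  refine ⟨HilbertBasis.mkOfOrthogonalEqBot horth hbot, fun p x => ?_⟩
  rw [HilbertBasis.coe_mkOfOrthogonalEqBot, inner_toLp_single]

theorem exists_isEigenBasis_ampOp [CompleteSpace H] {ι : Type*} {D : H →ₗ.[ℂ] H}
    {b : HilbertBasis ι ℂ H} {ev : ι → ℝ} (h : IsEigenBasis D b ev) (N : ℕ) :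
    ∃ β : HilbertBasis (Fin N × ι) ℂ (Amp H N), IsEigenBasis (ampOp N D) β fun p => ev p.2 := by
  obtain ⟨β, hβ⟩ := exists_ampBasis b N
  refine ⟨β, fun x => ?_, fun x y hxy p => ?_⟩
  · have h1 : x ∈ (ampOp N D).domain ↔ ∀ j, x j ∈ D.domain := Iff.rfl
    rw [h1, summable_prod_of_nonneg fun _ => by positivity]
    simp only [h.mem_domain, hβ]
    exact ⟨fun h2 => ⟨h2, Summable.of_finite⟩, fun h2 => h2.1⟩
  · rw [hβ, hβ]
    exact h.inner_apply _ _ (maps_ampOp_iff.1 hxy p.1) p.2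

theorem summable_fin_prod {ι : Type*} {f : ι → ℝ} (hf : Summable f) (h0 : ∀ i, 0 ≤ f i) :
    Summable fun p : Fin N × ι => f p.2 := by
  rw [summable_prod_of_nonneg fun p => h0 p.2]
  exact ⟨fun _ => hf, Summable.of_finite⟩

variable {A : Type*} [NormedRing A] [NormedAlgebra ℂ A] [StarRing A]
  [CompleteSpace H]

theorem ampRep_apply (ρ : A →⋆ₐ[ℂ] (H →L[ℂ] H)) (M : Matrix (Fin N) (Fin N) A) (x : Amp H N)
    (i : Fin N) : ampRep N ρ M x i = ∑ j, ρ (M i j) (x j) := by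
  simp [ampRep]

theorem ampRep_mul (ρ : A →⋆ₐ[ℂ] (H →L[ℂ] H)) (M M' : Matrix (Fin N) (Fin N) A) :
    ampRep N ρ (M * M') = ampRep N ρ M * ampRep N ρ M' := by
  ext x i
  rw [mul_apply_eq_comp, ampRep_apply, ampRep_apply]
  simp only [ampRep_apply, Matrix.mul_apply, map_sum, map_mul, sum_apply, mul_apply_eq_comp]
  exact Finset.sum_comm

theorem ampRep_one (ρ : A →⋆ₐ[ℂ] (H →L[ℂ] H)) :
    ampRep N ρ (1 : Matrix (Fin N) (Fin N) A) = 1 := by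
  ext x i
  rw [ampRep_apply, Finset.sum_eq_single i]
  · simp
  · intro j _ hj
    simp [Matrix.one_apply_ne hj.symm]
  · simp

theorem inner_ampRep (ρ : A →⋆ₐ[ℂ] (H →L[ℂ] H)) (M : Matrix (Fin N) (Fin N) A) (x y : Amp H N) :
    ⟪ampRep N ρ M x, y⟫ = ⟪x, ampRep N ρ (star M) y⟫ := by
  rw [PiLp.inner_apply, PiLp.inner_apply]
  simp only [ampRep_apply, sum_inner, inner_sum]
  rw [Finset.sum_comm]
  refine Finset.sum_congr rfl fun i _ => Finset.sum_congr rfl fun j _ => ?_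
  rw [Matrix.star_apply, map_star, ContinuousLinearMap.star_eq_adjoint,
    ContinuousLinearMap.adjoint_inner_right]

theorem Implements.maps {K : Type*} [NormedAddCommGroup K] [InnerProductSpace ℂ K]
    {D : K →ₗ.[ℂ] K} {a T : K →L[ℂ] K} (h : Implements D a T) {x y : K} (hxy : Maps D x y) :
    Maps D (a x) (a y + T x) := by
  obtain ⟨hx, rfl⟩ := hxy
  obtain ⟨hax, h1⟩ := h x hx
  exact ⟨hax, by rw [← h1, add_sub_cancel]⟩

theorem exists_implements_ampOp {ρ : A →⋆ₐ[ℂ] (H →L[ℂ] H)} {D : H →ₗ.[ℂ] H}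
    (hD : ∀ a : A, ∃ T : H →L[ℂ] H, Implements D (ρ a) T) (M : Matrix (Fin N) (Fin N) A) :
    ∃ T, Implements (ampOp N D) (ampRep N ρ M) T := by
  choose T hT using fun i j => hD (M i j)
  let S : Amp H N →L[ℂ] Amp H N := ((PiLp.continuousLinearEquiv 2 ℂ (fun _ : Fin N => H)).symm :
      (Fin N → H) →L[ℂ] Amp H N).comp
    (ContinuousLinearMap.pi fun i => ∑ j, (T i j).comp (PiLp.proj 2 (fun _ : Fin N => H) j))
  have hS : ∀ x i, S x i = ∑ j, T i j (x j) := fun x i => by simp [S]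
  refine ⟨S, fun x hx => ?_⟩
  have h1 : Maps (ampOp N D) (ampRep N ρ M x)
      (ampRep N ρ M (ampOp N D ⟨x, hx⟩) + S x) := maps_ampOp_iff.2 fun i => by
    have h2 : ∀ s : Finset (Fin N), Maps D (∑ j ∈ s, ρ (M i j) (x j))
        (∑ j ∈ s, (ρ (M i j) (D ⟨x j, hx j⟩) + T i j (x j))) := fun s => by
      classical
      induction s using Finset.induction_on with
      | empty => exact ⟨D.domain.zero_mem, D.map_zero⟩
      | insert j s hj ih =>
        rw [Finset.sum_insert hj, Finset.sum_insert hj]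
        exact ((hT i j).maps (maps_apply (hx j))).add ih
    refine (h2 Finset.univ).congr (ampRep_apply ρ M x i).symm ?_
    rw [Finset.sum_add_distrib, PiLp.add_apply, ampRep_apply, hS]
    rfl
  obtain ⟨hm, he⟩ := h1
  exact ⟨hm, by rw [he, add_sub_cancel_left]⟩

/-! ### The path of operators -/

variable {ρ : A →⋆ₐ[ℂ] (H →L[ℂ] H)} {D : H →ₗ.[ℂ] H} {g : unitary (Matrix (Fin N) (Fin N) A)}

theorem ampRep_inv_mul (ρ : A →⋆ₐ[ℂ] (H →L[ℂ] H)) (g : unitary (Matrix (Fin N) (Fin N) A)) :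
    ampRep N ρ ((g⁻¹ : unitary _) : Matrix (Fin N) (Fin N) A) * ampRep N ρ g = 1 := by
  rw [← ampRep_mul, ← Submonoid.coe_mul, inv_mul_cancel, OneMemClass.coe_one, ampRep_one]

theorem ampRep_mul_inv (ρ : A →⋆ₐ[ℂ] (H →L[ℂ] H)) (g : unitary (Matrix (Fin N) (Fin N) A)) :
    ampRep N ρ g * ampRep N ρ ((g⁻¹ : unitary _) : Matrix (Fin N) (Fin N) A) = 1 := by
  rw [← ampRep_mul, ← Submonoid.coe_mul, mul_inv_cancel, OneMemClass.coe_one, ampRep_one]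

theorem ampRep_inv_apply (ρ : A →⋆ₐ[ℂ] (H →L[ℂ] H)) (g : unitary (Matrix (Fin N) (Fin N) A))
    (x : Amp H N) :
    ampRep N ρ ((g⁻¹ : unitary _) : Matrix (Fin N) (Fin N) A) (ampRep N ρ g x) = x :=
  congrArg (fun T : Amp H N →L[ℂ] Amp H N => T x) (ampRep_inv_mul ρ g)

theorem ampRep_apply_inv (ρ : A →⋆ₐ[ℂ] (H →L[ℂ] H)) (g : unitary (Matrix (Fin N) (Fin N) A))
    (x : Amp H N) :
    ampRep N ρ g (ampRep N ρ ((g⁻¹ : unitary _) : Matrix (Fin N) (Fin N) A) x) = x :=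
  congrArg (fun T : Amp H N →L[ℂ] Amp H N => T x) (ampRep_mul_inv ρ g)

/-- On $\operatorname{dom}D$ one has $g^{-1}Dg=D+g^{-1}[D,g]$, so the path is affine with bounded
velocity $g^{-1}T$. -/
theorem maps_path {T : Amp H N →L[ℂ] Amp H N} (hT : Implements (ampOp N D) (ampRep N ρ g) T)
    (u : ℝ) {x y : Amp H N} (h : Maps (ampOp N D) x y) : Maps (path ρ D g u) x (y + (u : ℂ) •
      (ampRep N ρ ((g⁻¹ : unitary _) : Matrix (Fin N) (Fin N) A) * T) x) := by
  have h1 := hT.maps h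
  have hx : x ∈ (path ρ D g u).domain := ⟨h.mem, h1.mem⟩
  refine ⟨hx, ?_⟩
  have h2 : path ρ D g u ⟨x, hx⟩ = ((1 - u : ℝ) : ℂ) • ampOp N D ⟨x, h.mem⟩ + (u : ℂ) •
      ampRep N ρ ((g⁻¹ : unitary _) : Matrix (Fin N) (Fin N) A)
        (ampOp N D ⟨ampRep N ρ g x, h1.mem⟩) := rfl
  rw [h2, (maps_apply h.mem).unique h, (maps_apply h1.mem).unique h1, map_add, ampRep_inv_apply,
    mul_apply_eq_comp]
  push_cast
  module

theorem maps_path_iff {T : Amp H N →L[ℂ] Amp H N}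
    (hT : Implements (ampOp N D) (ampRep N ρ g) T) (u : ℝ) (x z : Amp H N) :
    Maps (path ρ D g u) x z ↔ Maps (ampOp N D) x (z - ((u : ℂ) •
      (ampRep N ρ ((g⁻¹ : unitary _) : Matrix (Fin N) (Fin N) A) * T)) x) := by
  constructor
  · intro h
    obtain ⟨y, h1⟩ : ∃ y, Maps (ampOp N D) x y :=
      ⟨_, maps_apply (show x ∈ (ampOp N D).domain from h.mem.1)⟩
    refine h1.congr rfl ?_
    rw [h.unique (maps_path hT u h1), smul_apply, add_sub_cancel_right]
  · intro h
    refine (maps_path hT u h).congr rfl ?_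
    rw [smul_apply, sub_add_cancel]

/-- Formally $g^{-1}T=g^{-1}Dg-D$ is a difference of symmetric operators. This is checked on
eigenvectors of $D$ and extended to all vectors by boundedness. -/
theorem inner_velocity {T : Amp H N →L[ℂ] Amp H N}
    (hT : Implements (ampOp N D) (ampRep N ρ g) T) {ι : Type*}
    {b : HilbertBasis ι ℂ (Amp H N)} {ev : ι → ℝ} (h : IsEigenBasis (ampOp N D) b ev)
    (x y : Amp H N) :
    ⟪(ampRep N ρ ((g⁻¹ : unitary _) : Matrix (Fin N) (Fin N) A) * T) x, y⟫ =
      ⟪x, (ampRep N ρ ((g⁻¹ : unitary _) : Matrix (Fin N) (Fin N) A) * T) y⟫ := by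
  set G := ampRep N ρ (g : Matrix (Fin N) (Fin N) A) with hG
  set G' := ampRep N ρ ((g⁻¹ : unitary _) : Matrix (Fin N) (Fin N) A) with hG'
  have hadj : ∀ x y, ⟪G' x, y⟫ = ⟪x, G y⟫ := fun x y => by
    rw [hG', inner_ampRep]
    congr 2
    exact congrArg (ampRep N ρ) (star_star (g : Matrix (Fin N) (Fin N) A))
  have hadj' : ∀ x y, ⟪G x, y⟫ = ⟪x, G' y⟫ := fun x y => inner_ampRep ρ _ x y
  have key : ∀ i j, ⟪(G' * T) (b i), b j⟫ = ⟪b i, (G' * T) (b j)⟫ := fun i j => by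
    have hi := hT.maps (h.maps_basis i)
    have hj := hT.maps (h.maps_basis j)
    have h1 := h.isSymm _ _ _ _ hi hj
    have h2 := h.isSymm _ _ _ _ (h.maps_basis i) (h.maps_basis j)
    rw [mul_apply_eq_comp, mul_apply_eq_comp, hadj, ← hadj']
    rw [inner_add_left, inner_add_right, hadj', hadj'] at h1
    rw [ampRep_inv_apply, ampRep_inv_apply, h2] at h1
    exact add_left_cancel h1
  have h1 : ContinuousLinearMap.adjoint (G' * T) = G' * T :=
    clm_eq_of_apply_basis b fun j => basis_ext b fun i => by
      rw [ContinuousLinearMap.adjoint_inner_right, key]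
  rw [← ContinuousLinearMap.adjoint_inner_right, h1]

theorem isPerturbation_path {T : Amp H N →L[ℂ] Amp H N}
    (hT : Implements (ampOp N D) (ampRep N ρ g) T) {ι : Type*}
    {b : HilbertBasis ι ℂ (Amp H N)} {ev : ι → ℝ} (h : IsEigenBasis (ampOp N D) b ev) (u : ℝ) :
    IsPerturbation (ampOp N D) (path ρ D g u) ((u : ℂ) •
      (ampRep N ρ ((g⁻¹ : unitary _) : Matrix (Fin N) (Fin N) A) * T)) where
  symm x y := by
    rw [smul_apply, smul_apply, inner_smul_left, inner_smul_right, inner_velocity hT h,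
      Complex.conj_ofReal]
  maps_iff := maps_path_iff hT u

/-- The path `D_u` is a family of diagonalized operators. -/
theorem exists_isEigenFamily_path {T : Amp H N →L[ℂ] Amp H N}
    (hT : Implements (ampOp N D) (ampRep N ρ g) T) {ι₀ : Type*}
    {b₀ : HilbertBasis ι₀ ℂ (Amp H N)} {ev₀ : ι₀ → ℝ} (h : IsEigenBasis (ampOp N D) b₀ ev₀)
    (hs : ∀ t : ℝ, 0 < t → Summable fun i => Real.exp (-t * ev₀ i ^ 2)) :
    ∃ (ι : ℝ → Type w) (b : ∀ u, HilbertBasis (ι u) ℂ (Amp H N)) (ev : ∀ u, ι u → ℝ),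
      IsEigenFamily (path ρ D g)
        (ampRep N ρ ((g⁻¹ : unitary _) : Matrix (Fin N) (Fin N) A) * T) b ev := by
  choose ι b ev hb using fun u => (isPerturbation_path hT h u).exists_isEigenBasis h
    (tendsto_abs_of_summable_exp (hs 1 one_pos))
  refine ⟨ι, b, ev, fun u v => ⟨fun x y => ?_, fun x z => ?_⟩, hb, fun u t ht => ?_⟩
  · rw [smul_apply, smul_apply, inner_smul_left, inner_smul_right, inner_velocity hT h,
      Complex.conj_ofReal]
  · rw [maps_path_iff hT, maps_path_iff hT]
    have : z - ((v : ℂ) • (ampRep N ρ ((g⁻¹ : unitary _) : Matrix (Fin N) (Fin N) A) * T)) x =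
        z - (((v - u : ℝ) : ℂ) • (ampRep N ρ ((g⁻¹ : unitary _) : Matrix _ _ A) * T)) x -
        ((u : ℂ) • (ampRep N ρ ((g⁻¹ : unitary _) : Matrix (Fin N) (Fin N) A) * T)) x := by
      simp only [smul_apply]
      push_cast
      module
    rw [this]
  · exact ((isPerturbation_path hT h u).summable_exp h (hb u) ht.le (hs _ (half_pos ht))).1

/-- The end points of the path are unitarily equivalent. -/
theorem stepTrace_path_one {T T' : Amp H N →L[ℂ] Amp H N}
    (hT : Implements (ampOp N D) (ampRep N ρ g) T)
    (hT' : Implements (ampOp N D)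
      (ampRep N ρ ((g⁻¹ : unitary _) : Matrix (Fin N) (Fin N) A)) T') {ι : ℝ → Type w}
    {b : ∀ u, HilbertBasis (ι u) ℂ (Amp H N)} {ev : ∀ u, ι u → ℝ}
    (h : IsEigenFamily (path ρ D g)
      (ampRep N ρ ((g⁻¹ : unitary _) : Matrix (Fin N) (Fin N) A) * T) b ev) :
    stepTrace ev 0 1 = stepTrace ev 0 0 := by
  set G := ampRep N ρ (g : Matrix (Fin N) (Fin N) A) with hG
  set G' := ampRep N ρ ((g⁻¹ : unitary _) : Matrix (Fin N) (Fin N) A) with hG'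
  let e₀ : Amp H N ≃ₗ[ℂ] Amp H N := LinearEquiv.ofLinearMap (G : Amp H N →ₗ[ℂ] Amp H N)
    (G' : Amp H N →ₗ[ℂ] Amp H N) (LinearMap.ext (ampRep_apply_inv ρ g))
    (LinearMap.ext (ampRep_inv_apply ρ g))
  let e : Amp H N ≃ₗᵢ[ℂ] Amp H N := e₀.isometryOfInner fun x y => by
    change ⟪G x, G y⟫ = ⟪x, y⟫
    rw [hG, inner_ampRep]
    exact congrArg (fun z => ⟪x, z⟫) (ampRep_inv_apply ρ g y)
  -- The vectors $g^{-1}b_i$ diagonalize $D_1=g^{-1}Dg$ with the eigenvalues of $D_0$; spectral sums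
  -- do not depend on the eigenbasis.
  let b' : HilbertBasis (ι 0) ℂ (Amp H N) := HilbertBasis.ofRepr (e.trans (b 0).repr)
  have hb' : ∀ i, b' i = G' (b 0 i) := fun i => by
    classical
    rw [← b'.repr_symm_single, ← (b 0).repr_symm_single]
    rfl
  have h0 : ∀ i, Maps (ampOp N D) (b 0 i) ((ev 0 i : ℂ) • b 0 i) := fun i =>
    ((maps_path_iff hT 0 _ _).1 ((h.basis 0).maps_basis i)).congr rfl (by simp)
  have h1 : IsEigenBasis (path ρ D g 1) b' (ev 0) := by
    refine isEigenBasis_of_maps (h.basis 1).isSymm one_ne_zero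
      (exists_rightInv_diag (h.basis 1) one_ne_zero).1 b' (ev 0) fun i => ?_
    rw [hb']
    -- The commutator with $g^{-1}$ is needed here to know that $g^{-1}b_i$ lies in
    -- $\operatorname{dom}D$.
    have h2 := hT'.maps (h0 i)
    have h3 := maps_path hT 1 h2
    have h4 := hT.maps h2
    refine h3.congr rfl ?_
    rw [ampRep_apply_inv] at h4
    have h5 := (h0 i).unique h4
    have h6 := congrArg G' h5
    rw [map_add, ampRep_inv_apply, map_smul] at h6
    rw [h6, Complex.ofReal_one, one_smul, map_smul]
    rfl
  exact (h.basis 1).tsum_unique h1 (summable_gaussStep le_rfl (h.summable 1))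
    (summable_gaussStep le_rfl (h.summable 0))

end Amplification

open Finset

section Combinatorics

/-! ## Vertices of the cocyclic simplex -/

theorem Simplex.vertex_t (n : ℕ) (i : Fin (n + 2)) :
    (Simplex.vertex n).t i = if (i : ℕ) = n + 1 then 1 else 0 := by
  induction n with
  | zero => fin_cases i <;> rfl
  | succ n ih =>
    change (Simplex.vertex n).t (Fin.predAbove 0 i) = _
    rw [ih]
    induction i using Fin.cases with
    | zero => simp
    | succ i => simp

theorem Simplex.cyc_t {n : ℕ} (x : Simplex n) (i : Fin (n + 2)) :
    x.cyc.t i = if h : (i : ℕ) < n + 1 then x.t (Fin.succ ⟨i, h⟩) - x.t 1 else 1 := by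
  induction i using Fin.lastCases with
  | last => simpa using x.cyc.last
  | cast i =>
    rw [dif_pos (show (i.castSucc : ℕ) < n + 1 from i.2)]
    change Fin.snoc (α := fun _ => ℝ) (fun k : Fin (n + 1) => x.t k.succ - x.t 1) 1
      i.castSucc = _
    rw [Fin.snoc_castSucc]
    rfl

/-- Each application of $\tau$ to a vertex with $t_1=0$ just shifts one more $1$ into the sequence
from the right. -/
theorem Simplex.cyc_iterate_vertex_t {n r : ℕ} (hr : r ≤ n) (i : Fin (n + 2)) :
    (Simplex.cyc^[r] (Simplex.vertex n)).t i = if n + 1 ≤ i + r then 1 else 0 := by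
  induction r generalizing i with
  | zero =>
    rw [Function.iterate_zero_apply, Simplex.vertex_t]
    have := i.2
    congr 1
    exact propext (by omega)
  | succ r ih =>
    have hi := i.2
    rw [Function.iterate_succ_apply', Simplex.cyc_t]
    split_ifs with h1 h2
    · rw [ih (by omega), ih (by omega), if_pos, if_neg, sub_zero]
      · simp; omega
      · simp; omega
    · rw [ih (by omega), ih (by omega), if_neg, if_neg, sub_zero]
      · simp; omega
      · simp; omega
    · rfl
    · omega

theorem Simplex.cast_t {m n : ℕ} (h : m = n) (x : Simplex m) (i : Fin (n + 2)) :
    (x.cast h).t i = x.t (Fin.cast (by omega) i) := by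
  subst h
  rfl

theorem Simplex.zeroFaces_one_t {n : ℕ} (x : Simplex n) (i : Fin (n + 1 + 2)) :
    (Simplex.zeroFaces 1 x).t i = x.t (Fin.predAbove 0 i) := rfl

/-! ## Cofaces of the Hopf algebra -/

theorem inj_one {n : ℕ} (k : Fin n) : inj k (1 : ℂ[X]) = 1 := by
  change PiTensorProduct.tprod ℂ (Function.update (fun _ => (1 : ℂ[X])) k 1) = _
  rw [Function.update_eq_self_iff.2 rfl]
  rfl

theorem injComul_one {n : ℕ} (k l : Fin n) : injComul k l (1 : ℂ[X]) = 1 := by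
  change TensorProduct.lift _ (comul 1) = _
  rw [map_one, Algebra.TensorProduct.one_def, TensorProduct.lift.tmul]
  change inj k 1 * inj l 1 = _
  rw [inj_one, inj_one, one_mul]

theorem comul_X : comul Polynomial.X = Polynomial.X ⊗ₜ[ℂ] 1 + 1 ⊗ₜ[ℂ] Polynomial.X :=
  Polynomial.aeval_X _

theorem injComul_X {n : ℕ} (k l : Fin n) :
    injComul k l Polynomial.X = inj k Polynomial.X + inj l Polynomial.X := by
  change TensorProduct.lift _ (comul Polynomial.X) = _
  rw [comul_X, map_add, TensorProduct.lift.tmul, TensorProduct.lift.tmul]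
  change inj k _ * inj l 1 + inj k 1 * inj l _ = _
  rw [inj_one, inj_one, one_mul, mul_one]

theorem HopfCochain.coface_inj {n : ℕ} (i : Fin (n + 2)) (k : Fin n) (h : ℂ[X]) :
    HopfCochain.coface i (inj k h) =
      if (k : ℕ) + 1 < i then inj k.castSucc h
      else if (k : ℕ) + 1 = i then injComul k.castSucc k.succ h
      else inj k.succ h := by
  have h1 : inj k h = PiTensorProduct.tprod ℂ (Function.update (fun _ => (1 : ℂ[X])) k h) := rfl
  rw [h1, HopfCochain.coface, PiTensorProduct.lift.tprod, MultilinearMap.compLinearMap_apply,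
    MultilinearMap.mkPiAlgebra_apply, Finset.prod_eq_single k]
  · rw [Function.update_self]
    split_ifs <;> rfl
  · intro j _ hj
    rw [Function.update_of_ne hj]
    split_ifs
    · exact inj_one _
    · exact injComul_one _ _
    · exact inj_one _
  · simp

theorem HopfCochain.lastFaces_X (q : ℕ) :
    HopfCochain.lastFaces q (PiTensorProduct.tprod ℂ fun _ : Fin 1 => (Polynomial.X : ℂ[X])) =
      inj (⟨0, by omega⟩ : Fin (1 + q)) Polynomial.X := by
  induction q with
  | zero =>
    change PiTensorProduct.tprod ℂ _ = PiTensorProduct.tprod ℂ (Function.update _ _ _)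
    congr 1
    ext k : 1
    rw [Subsingleton.elim k ⟨0, by omega⟩, Function.update_self]
  | succ q ih =>
    change HopfCochain.coface _ (HopfCochain.lastFaces q _) = _
    rw [ih, HopfCochain.coface_inj, if_pos (by simp)]
    rfl

/-- Each coface here comultiplies the last factor, so primitivity of $X$ adds one summand, the one
with $X$ in the new last position. -/
theorem HopfCochain.shuffleFaces_X (q : ℕ) :
    HopfCochain.shuffleFaces q
        (PiTensorProduct.tprod ℂ fun _ : Fin 1 => (Polynomial.X : ℂ[X])) =
      ∑ k : Fin (1 + q), inj k Polynomial.X := by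
  induction q with
  | zero =>
    have h := HopfCochain.lastFaces_X 0
    rw [Finset.sum_eq_single (⟨0, by omega⟩ : Fin (1 + 0))]
    · exact h
    · intro k _ hk
      exact absurd (Subsingleton.elim (α := Fin 1) k _) hk
    · simp
  | succ q ih =>
    change HopfCochain.coface _ (HopfCochain.shuffleFaces q _) = _
    rw [ih, map_sum]
    have h1 : ∀ k : Fin (1 + q), HopfCochain.coface (Fin.last (1 + q)).castSucc
        (inj k (Polynomial.X : ℂ[X])) = inj k.castSucc Polynomial.X +
          if k = ⟨q, by omega⟩ then inj (Fin.last (1 + q)) Polynomial.X else 0 := fun k => by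
      rw [HopfCochain.coface_inj, injComul_X]
      have hk := k.2
      simp only [Fin.val_castSucc, Fin.val_last, Fin.ext_iff]
      split_ifs
      · omega
      · rw [add_zero]
      · rw [show k.succ = Fin.last (1 + q) from Fin.ext ‹_›]
      · omega
      · omega
      · omega
    simp_rw [h1]
    rw [Finset.sum_add_distrib, Finset.sum_ite_eq' , if_pos (Finset.mem_univ _)]
    exact (Fin.sum_univ_castSucc (n := 1 + q) fun k => inj k (Polynomial.X : ℂ[X])).symm

end Combinatorics

section Products

/-! ## Telescoping products -/

variable {R : Type*} [Ring R]

/-- The product of `c_j w_j` over `j < m`, with `c_k` replaced by `d_k`. -/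
def replaceProd (c d w : ℕ → R) (k m : ℕ) : R :=
  ((List.range m).map fun j => (if j = k then d j else c j) * w j).prod

theorem replaceProd_succ (c d w : ℕ → R) (k m : ℕ) : replaceProd c d w k (m + 1) =
    replaceProd c d w k m * ((if m = k then d m else c m) * w m) :=
  List.prod_range_succ _ _

variable {a a' b b' E : R} {p : ℕ}

/-- After the initial $b$ the factors come in pairs $a'a=1$. The insertion $E$ has even index, so it
stands between pairs and never inside one. -/
theorem replaceProd_zero_eq (c d w : ℕ → R) (h : a' * a = 1) (hc : ∀ m, c (2 * m) = a)
    (hc' : ∀ m, c (2 * m + 1) = a') (hd : d 0 = b)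
    (hw : ∀ j, w j = if j = 2 * p then E else 1) (m : ℕ) :
    replaceProd c d w 0 (2 * m + 1) = b * if p ≤ m then E else 1 := by
  induction m with
  | zero => simp [replaceProd, hd, hw, eq_comm]
  | succ m ih =>
    rw [show 2 * (m + 1) + 1 = 2 * m + 1 + 1 + 1 by ring, replaceProd_succ, replaceProd_succ, ih,
      if_neg (Nat.succ_ne_zero _), if_neg (Nat.succ_ne_zero _), hc',
      show 2 * m + 1 + 1 = 2 * (m + 1) by ring, hc, hw, hw,
      if_neg (show ¬ 2 * m + 1 = 2 * p by omega), mul_one, mul_assoc _ a', ← mul_assoc a', h,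
      one_mul, mul_assoc]
    congr 1
    split_ifs <;> first | omega | simp

/-- The Leibniz rule over the alternating product. Appending a pair $a'a=1$ adds the term
$a(b'a+a'b)=0$, up to insertions between pairs, so only the first replacement survives. -/
theorem sum_replaceProd_eq (c d w : ℕ → R) (h : a' * a = 1)  (hb : b' * a + a' * b = 0) (hc : ∀ m, c (2 * m) = a)
    (hc' : ∀ m, c (2 * m + 1) = a') (hd : ∀ m, d (2 * m) = b) (hd' : ∀ m, d (2 * m + 1) = b')
    (hw : ∀ j, w j = if j = 2 * p then E else 1) (m : ℕ) :
    ∑ k ∈ range (2 * m + 1), replaceProd c d w k (2 * m + 1) = b * if p ≤ m then E else 1 := by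
  set Q : ℕ → R := fun m => ((List.range m).map fun j => c j * w j).prod with hQ
  have hQs : ∀ m, Q (m + 1) = Q m * (c m * w m) := fun m => List.prod_range_succ _ _
  have hrep : ∀ m, replaceProd c d w m m = Q m := fun m => by
    rw [replaceProd, hQ]
    congr 1
    refine List.map_congr_left fun j hj => ?_
    rw [if_neg (List.mem_range.1 hj).ne]
  have hS : ∀ m, ∑ k ∈ range (m + 1), replaceProd c d w k (m + 1) =
      (∑ k ∈ range m, replaceProd c d w k m) * (c m * w m) + Q m * (d m * w m) := fun m => by
    rw [sum_range_succ, replaceProd_succ, if_pos rfl, hrep, sum_mul]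
    congr 1
    refine sum_congr rfl fun k hk => ?_
    rw [replaceProd_succ, if_neg (mem_range.1 hk).ne']
  have hQ1 : ∀ m, Q (2 * m + 1) = a * if p ≤ m then E else 1 := fun m => by
    have := replaceProd_zero_eq (p := p) c c w h hc hc' (hc 0) hw m
    rw [← this, replaceProd, hQ]
    simp
  induction m with
  | zero =>
    rw [hS]
    have := hd 0
    simp only [mul_zero] at this
    simp [hQ, this, hw, eq_comm]
  | succ m ih =>
    rw [show 2 * (m + 1) + 1 = 2 * m + 1 + 1 + 1 by ring, hS, hS, ih, hQs (2 * m + 1),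
      hQ1, hc', hd', show 2 * m + 1 + 1 = 2 * (m + 1) by ring, hc, hd, hw, hw,
      if_neg (show ¬ 2 * m + 1 = 2 * p by omega), mul_one, mul_one]
    set W : R := if p ≤ m then E else 1
    have h1 : (if p ≤ m + 1 then E else 1) = W * if 2 * (m + 1) = 2 * p then E else 1 := by
      simp only [W]
      split_ifs <;> first | omega | simp
    rw [h1]
    set v : R := if 2 * (m + 1) = 2 * p then E else 1
    calc (b * W * a' + a * W * b') * (a * v) + a * W * a' * (b * v)
        = b * W * (a' * a) * v + a * W * (b' * a + a' * b) * v := by noncomm_ring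
      _ = b * (W * v) := by rw [h, hb]; noncomm_ring

end Products

/-! ### The primitive element acts as a derivation on matrices -/

section Derivation

variable {A : Type*} [NormedRing A] [NormedAlgebra ℂ A] [Module ℂ[X] A] [IsScalarTower ℂ ℂ[X] A]
  {N : ℕ}

theorem IsModuleAlgebra.X_smul_mul (hA : IsModuleAlgebra A) (a b : A) :
    (Polynomial.X : ℂ[X]) • (a * b) =
      ((Polynomial.X : ℂ[X]) • a) * b + a * ((Polynomial.X : ℂ[X]) • b) := by
  rw [hA.smul_mul, comul_X, map_add, map_add, TensorProduct.map_tmul, TensorProduct.map_tmul,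
    LinearMap.mul'_apply, LinearMap.mul'_apply]
  simp

theorem IsModuleAlgebra.X_smul_one (hA : IsModuleAlgebra A) :
    (Polynomial.X : ℂ[X]) • (1 : A) = 0 := by
  rw [hA.smul_one, counit, Polynomial.aeval_X, zero_smul]

theorem IsModuleAlgebra.X_smul_matrix_mul (hA : IsModuleAlgebra A)
    (M M' : Matrix (Fin N) (Fin N) A) : (Polynomial.X : ℂ[X]) • (M * M') =
      ((Polynomial.X : ℂ[X]) • M) * M' + M * ((Polynomial.X : ℂ[X]) • M') := by
  ext i j
  simp only [Matrix.smul_apply, Matrix.mul_apply, Matrix.add_apply, Finset.smul_sum,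
    hA.X_smul_mul, Finset.sum_add_distrib]

theorem IsModuleAlgebra.X_smul_matrix_one (hA : IsModuleAlgebra A) :
    (Polynomial.X : ℂ[X]) • (1 : Matrix (Fin N) (Fin N) A) = 0 := by
  ext i j
  rw [Matrix.smul_apply, Matrix.one_apply, Matrix.zero_apply]
  split_ifs
  · exact hA.X_smul_one
  · exact smul_zero _

end Derivation

/-! ### Evaluation of the characteristic map on alternating arguments -/

section Pairing

variable {A : Type*} [NormedRing A] [NormedAlgebra ℂ A] [StarRing A]
  [Module ℂ[X] A] [IsScalarTower ℂ ℂ[X] A]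
  {H : Type*} [NormedAddCommGroup H] [InnerProductSpace ℂ H] [CompleteSpace H] {N : ℕ}
  {ρ : A →⋆ₐ[ℂ] (H →L[ℂ] H)} {g : unitary (Matrix (Fin N) (Fin N) A)}
  {e : ℝ → Amp H N →L[ℂ] Amp H N}

/-- The arguments `g⁻¹, g, …, g⁻¹, g` of the pairing. -/
def alternating (g : unitary (Matrix (Fin N) (Fin N) A)) (m : ℕ) : Matrix (Fin N) (Fin N) A :=
  if Even m then ((g⁻¹ : unitary (Matrix (Fin N) (Fin N) A)) : Matrix (Fin N) (Fin N) A) else g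

omit [NormedAlgebra ℂ A] [Module ℂ[X] A] [IsScalarTower ℂ ℂ[X] A] in
theorem alternating_two_mul (m : ℕ) : alternating g (2 * m) =
    ((g⁻¹ : unitary (Matrix (Fin N) (Fin N) A)) : Matrix (Fin N) (Fin N) A) :=
  if_pos (even_two_mul m)

omit [NormedAlgebra ℂ A] [Module ℂ[X] A] [IsScalarTower ℂ ℂ[X] A] in
theorem alternating_two_mul_add_one (m : ℕ) : alternating g (2 * m + 1) = g :=
  if_neg (by simp)

/-- The simplex point `δ₀ τ^{2r} δ₀^{2n}(∗)`. -/
def cupPoint (n r : ℕ) : Simplex (1 + 2 * n) :=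
  (Simplex.zeroFaces 1 (Simplex.cyc^[2 * r] (Simplex.vertex (2 * n)))).cast
    (Nat.add_comm (2 * n) 1)

theorem cupPoint_t {n r : ℕ} (hr : r ≤ n) (i : Fin (1 + 2 * n + 2)) :
    (cupPoint n r).t i = if 2 * n + 2 ≤ i + 2 * r then 1 else 0 := by
  rw [cupPoint, Simplex.cast_t, Simplex.zeroFaces_one_t, Simplex.cyc_iterate_vertex_t (by omega)]
  have h : ((Fin.predAbove 0 (Fin.cast (by omega) i : Fin (2 * n + 1 + 2)) : Fin (2 * n + 2)) : ℕ)
      = (i : ℕ) - 1 := by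
    generalize hj : (Fin.cast (by omega) i : Fin (2 * n + 1 + 2)) = j
    have : (i : ℕ) = j := by rw [← hj]; rfl
    rw [this]
    induction j using Fin.cases with
    | zero => simp
    | succ j => simp
  rw [h]
  congr 1
  exact propext (by omega)

theorem map_range_eq_ofFn {α : Type*} (F : ℕ → α) (m : ℕ) :
    (List.range m).map F = List.ofFn fun i : Fin m => F i :=
  List.ext_getElem (by simp) (by simp)

/-- The entries of the simplex point jump once, from $t_{2(n-r)+1}=0$ to $t_{2(n-r)+2}=1$. Hence all
heat factors are $e(0)=1$ except the one behind $a_{2(n-r)+1}$, an odd position, which holds $g$. -/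
theorem chiPoint_inj (he : e 0 = 1) {n r : ℕ} (hr : r ≤ n) (k : Fin (1 + 2 * n)) :
    chiPoint ρ e (fun i => alternating g i) (cupPoint n r) (inj k Polynomial.X) =
      ampRep N ρ (alternating g 0) * replaceProd
        (fun j => ampRep N ρ (alternating g (j + 1)))
        (fun j => ampRep N ρ ((Polynomial.X : ℂ[X]) • alternating g (j + 1)))
        (fun j => if j = 2 * (n - r) then e 1 else 1) k (2 * n + 1) := by
  have h1 : inj k (Polynomial.X : ℂ[X]) = PiTensorProduct.tprod ℂ
    (Function.update (fun _ => (1 : ℂ[X])) k Polynomial.X) := rfl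
  have h2 : (cupPoint n r).t 1 - (cupPoint n r).t 0 = 0 := by
    rw [cupPoint_t hr, cupPoint_t hr, if_neg, if_neg, sub_zero]
    · simp; omega
    · simp; omega
  rw [h1, chiPoint, LinearMap.comp_apply, LinearMap.mulLeft_apply, PiTensorProduct.lift.tprod,
    MultilinearMap.compLinearMap_apply, MultilinearMap.mkPiAlgebraFin_apply, h2, he, mul_one]
  congr 1
  rw [replaceProd, show 2 * n + 1 = 1 + 2 * n from Nat.add_comm _ _, map_range_eq_ofFn]
  congr 2
  ext1 j
  have hj := j.2
  rw [LinearMap.comp_apply, LinearMap.mulRight_apply, LinearMap.comp_apply, cupPoint_t hr,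
    cupPoint_t hr]
  congr 1
  · by_cases hjk : j = k
    · subst hjk
      rw [Function.update_self, if_pos rfl]
      rfl
    · rw [Function.update_of_ne hjk, if_neg (fun h => hjk (Fin.ext h))]
      change ampRep N ρ ((1 : ℂ[X]) • alternating g (j + 1)) = _
      rw [one_smul]
  · simp only [Fin.val_succ, Fin.val_castSucc]
    split_ifs <;> first | omega | simp [he]

/-- For both cup products, every simplex of `φ` contributes the same operator. -/
theorem exists_chiPoint_eq (hA : IsModuleAlgebra A) (he : e 0 = 1) {prod : ExternalProduct}
    (hprod : prod = cup ∨ prod = cup') (n : ℕ) : ∃ z : HopfCochain (1 + 2 * n),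
      (∀ v, prod 1 (2 * n) (eta (2 * n) v) = z ⊗ₜ[ℂ] simplexFaces 1 (2 * n) v) ∧
      ∀ r ≤ n, chiPoint ρ e (fun i => alternating g i) (cupPoint n r) z =
        ampRep N ρ (((g⁻¹ : unitary (Matrix (Fin N) (Fin N) A)) : Matrix (Fin N) (Fin N) A) *
          ((Polynomial.X : ℂ[X]) • (g : Matrix (Fin N) (Fin N) A))) * e 1 := by
  have hc : ∀ m, ampRep N ρ (alternating g (2 * m + 1)) = ampRep N ρ g := fun m => by
    rw [alternating_two_mul_add_one]
  have hc' : ∀ m, ampRep N ρ (alternating g (2 * m + 1 + 1)) =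
      ampRep N ρ ((g⁻¹ : unitary (Matrix (Fin N) (Fin N) A)) : Matrix (Fin N) (Fin N) A) :=
    fun m => by rw [show 2 * m + 1 + 1 = 2 * (m + 1) by ring, alternating_two_mul]
  have hd : ∀ m, ampRep N ρ ((Polynomial.X : ℂ[X]) • alternating g (2 * m + 1)) =
      ampRep N ρ ((Polynomial.X : ℂ[X]) • (g : Matrix (Fin N) (Fin N) A)) := fun m => by
    rw [alternating_two_mul_add_one]
  have hd' : ∀ m, ampRep N ρ ((Polynomial.X : ℂ[X]) • alternating g (2 * m + 1 + 1)) =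
      ampRep N ρ ((Polynomial.X : ℂ[X]) •
        ((g⁻¹ : unitary (Matrix (Fin N) (Fin N) A)) : Matrix (Fin N) (Fin N) A)) :=
    fun m => by rw [show 2 * m + 1 + 1 = 2 * (m + 1) by ring, alternating_two_mul]
  have h0 : alternating g 0 =
      ((g⁻¹ : unitary (Matrix (Fin N) (Fin N) A)) : Matrix (Fin N) (Fin N) A) :=
    alternating_two_mul 0
  have hb : ampRep N ρ ((Polynomial.X : ℂ[X]) •
        ((g⁻¹ : unitary (Matrix (Fin N) (Fin N) A)) : Matrix (Fin N) (Fin N) A)) *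
        ampRep N ρ g +
      ampRep N ρ ((g⁻¹ : unitary (Matrix (Fin N) (Fin N) A)) : Matrix (Fin N) (Fin N) A) *
        ampRep N ρ ((Polynomial.X : ℂ[X]) • (g : Matrix (Fin N) (Fin N) A)) = 0 := by
    rw [← ampRep_mul, ← ampRep_mul, ← map_add, ← hA.X_smul_matrix_mul, ← Submonoid.coe_mul,
      inv_mul_cancel, OneMemClass.coe_one, hA.X_smul_matrix_one, map_zero]
  rcases hprod with rfl | rfl
  · refine ⟨inj ⟨0, by omega⟩ Polynomial.X, fun v => ?_, fun r hr => ?_⟩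
    · rw [← HopfCochain.lastFaces_X]
      rfl
    · rw [chiPoint_inj he hr]
      have := replaceProd_zero_eq (p := n - r)
        (fun j => ampRep N ρ (alternating g (j + 1)))
        (fun j => ampRep N ρ ((Polynomial.X : ℂ[X]) • alternating g (j + 1)))
        (fun j => if j = 2 * (n - r) then e 1 else 1) (ampRep_inv_mul ρ g) hc hc' (hd 0)
        (fun j => rfl) n
      rw [this, if_pos (Nat.sub_le n r), h0, ampRep_mul, mul_assoc]
  · refine ⟨∑ k, inj k Polynomial.X, fun v => ?_, fun r hr => ?_⟩
    · rw [← HopfCochain.shuffleFaces_X]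
      rfl
    · have := sum_replaceProd_eq (p := n - r)
        (fun j => ampRep N ρ (alternating g (j + 1)))
        (fun j => ampRep N ρ ((Polynomial.X : ℂ[X]) • alternating g (j + 1)))
        (fun j => if j = 2 * (n - r) then e 1 else 1) (ampRep_inv_mul ρ g) hb hc hc' hd hd'
        (fun j => rfl) n
      rw [if_pos (Nat.sub_le n r)] at this
      rw [map_sum, sum_congr rfl fun k _ => chiPoint_inj he hr k, ← mul_sum,
        Fin.sum_univ_eq_sum_range (fun k => replaceProd
          (fun j => ampRep N ρ (alternating g (j + 1)))
          (fun j => ampRep N ρ ((Polynomial.X : ℂ[X]) • alternating g (j + 1)))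
          (fun j => if j = 2 * (n - r) then e 1 else 1) k (2 * n + 1)) (1 + 2 * n),
        Nat.add_comm 1 (2 * n), this, h0, ampRep_mul, mul_assoc]

theorem trace_smul (c : ℂ) (T : Amp H N →L[ℂ] Amp H N) : trace (c • T) = c * trace T := by
  simp only [trace, smul_apply, inner_smul_right, tsum_mul_left]

/-- The signs and factorials of $\varphi_{2n}$ and of the pairing cancel, and the $n+1$ equal
contributions leave $(n+1)/2^n$. -/
theorem pairingTerm_eq (hA : IsModuleAlgebra A) (he : e 0 = 1) {prod : ExternalProduct}
    (hprod : prod = cup ∨ prod = cup') (n : ℕ) : pairingTerm (oddCochain prod ρ e) g n =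
      ((n : ℂ) + 1) / 2 ^ n * trace (ampRep N ρ
        (((g⁻¹ : unitary (Matrix (Fin N) (Fin N) A)) : Matrix (Fin N) (Fin N) A) *
          ((Polynomial.X : ℂ[X]) • (g : Matrix (Fin N) (Fin N) A))) * e 1) := by
  obtain ⟨z, hz, hz'⟩ := exists_chiPoint_eq (ρ := ρ) (g := g) hA he hprod n
  set B := ampRep N ρ (((g⁻¹ : unitary (Matrix (Fin N) (Fin N) A)) : Matrix (Fin N) (Fin N) A) *
          ((Polynomial.X : ℂ[X]) • (g : Matrix (Fin N) (Fin N) A))) * e 1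
  have h1 : simplexFaces 1 (2 * n) (phi n) = ((-1 : ℂ) ^ n / (2 ^ n * (n.factorial : ℂ))) •
      ∑ r ∈ range (n + 1), Finsupp.single (cupPoint n r) (1 : ℂ) := by
    rw [phi, map_smul, map_sum]
    congr 1
    refine sum_congr rfl fun r _ => ?_
    exact Finsupp.mapDomain_single
  have h2 : oddCochain prod ρ e n (fun i => alternating g i) =
      trace ((((-1 : ℂ) ^ n / (2 ^ n * (n.factorial : ℂ))) * ((n : ℂ) + 1)) • B) := by
    rw [oddCochain, chi, hz, TensorProduct.lift.tmul, LinearMap.flip_apply, h1, map_smul, map_sum,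
      LinearMap.smul_apply, LinearMap.sum_apply]
    congr 1
    rw [mul_smul]
    congr 1
    rw [sum_congr rfl fun r hr => (?_ : _ = B), sum_const, card_range, ← Nat.cast_smul_eq_nsmul ℂ]
    · push_cast
      rfl
    · rw [Finsupp.linearCombination_single, one_smul]
      exact hz' r (Nat.lt_succ_iff.1 (mem_range.1 hr))
  change (-1) ^ n * (n.factorial : ℂ) * oddCochain prod ρ e n (fun i => alternating g i) = _
  rw [h2, trace_smul]
  have h3 : (n.factorial : ℂ) ≠ 0 := Nat.cast_ne_zero.2 n.factorial_ne_zero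
  have h4 : ((-1 : ℂ) ^ n) * (-1) ^ n = 1 := by rw [← mul_pow]; norm_num
  field_simp
  linear_combination trace B * h4

end Pairing

/-! ### From the Fredholm module to the integral formula -/

section Main

universe w

variable {A : Type*} [NormedRing A] [NormedAlgebra ℂ A] [StarRing A]
  [Module ℂ[X] A] [IsScalarTower ℂ ℂ[X] A]
  {H : Type w} [NormedAddCommGroup H] [InnerProductSpace ℂ H] [CompleteSpace H] {N : ℕ}
  {ρ : A →⋆ₐ[ℂ] (H →L[ℂ] H)} {D : H →ₗ.[ℂ] H}

omit [Module ℂ[X] A] [IsScalarTower ℂ ℂ[X] A] in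
/-- The path `D_u` of a theta-summable Fredholm module is a family of diagonalized operators with
trace class heat operators, and its end points have the same truncated trace. -/
theorem IsOddThetaSummable.exists_isEigenFamily (hD : IsOddThetaSummable ρ D)
    (g : unitary (Matrix (Fin N) (Fin N) A)) :
    ∃ T, Implements (ampOp N D) (ampRep N ρ g) T ∧
      ∀ T, Implements (ampOp N D) (ampRep N ρ g) T →
      ∃ (ι : ℝ → Type w) (b : ∀ u, HilbertBasis (ι u) ℂ (Amp H N)) (ev : ∀ u, ι u → ℝ),
        IsEigenFamily (path ρ D g)
          (ampRep N ρ ((g⁻¹ : unitary _) : Matrix (Fin N) (Fin N) A) * T) b ev ∧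
        stepTrace ev 0 1 = stepTrace ev 0 0 := by
  obtain ⟨c, -, hc⟩ := hD.commutator
  have hc' : ∀ a : A, ∃ T, Implements D (ρ a) T := fun a => (hc a).imp fun _ h => h.1
  obtain ⟨T', hT'⟩ := exists_implements_ampOp (N := N) hc'
    ((g⁻¹ : unitary _) : Matrix (Fin N) (Fin N) A)
  obtain ⟨ι, b, ev, hb, hs⟩ := exists_isEigenBasis_of_theta hD.selfAdjoint hD.theta
  obtain ⟨β, hβ⟩ := exists_isEigenBasis_ampOp hb N
  refine (exists_implements_ampOp (N := N) hc' g).imp fun _ hT₀ => ⟨hT₀, fun T hT => ?_⟩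
  obtain ⟨ι', b', ev', h⟩ := exists_isEigenFamily_path hT hβ fun t ht =>
    summable_fin_prod (hs t ht) fun _ => (Real.exp_pos _).le
  exact ⟨ι', b', ev', h, stepTrace_path_one hT hT' h⟩

/-- The velocity is symmetric, so its diagonal matrix elements are real and the trace equals its
real version. -/
theorem IsEigenFamily.trace_mul_heat_eq {K : Type w} [NormedAddCommGroup K]
    [InnerProductSpace ℂ K] [CompleteSpace K] {D : ℝ → K →ₗ.[ℂ] K} {B : K →L[ℂ] K}
    {ι : ℝ → Type w} {b : ∀ u, HilbertBasis (ι u) ℂ K} {ev : ∀ u, ι u → ℝ}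
    (h : IsEigenFamily D B b ev) (u : ℝ) :
    trace (B * heat (D u) 1) = (velocityTrace B b ev u : ℂ) := by
  rw [trace_mul_heat (h.basis u) zero_le_one (h.summable u 1 one_pos), velocityTrace,
    Complex.ofReal_tsum]
  refine tsum_congr fun i => ?_
  have h1 : ⟪B (b u i), b u i⟫ = ⟪b u i, B (b u i)⟫ := by
    have := (h.perturb u (u + 1)).symm (b u i) (b u i)
    simpa using this
  have h2 : ((⟪b u i, B (b u i)⟫ : ℂ).re : ℂ) = ⟪b u i, B (b u i)⟫ := by
    rw [← Complex.conj_eq_iff_re, inner_conj_symm, h1]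
  rw [Complex.ofReal_mul, h2, neg_one_mul]

theorem summable_succ_div_two_pow : Summable fun n : ℕ => ((n : ℂ) + 1) / 2 ^ n := by
  have h : ‖(1 / 2 : ℂ)‖ < 1 := by norm_num
  refine ((summable_pow_mul_geometric_of_norm_lt_one 1 h).add
    (summable_geometric_of_norm_lt_one h)).congr fun n => ?_
  rw [pow_one, one_div, inv_pow]
  ring

/-- A positive real factor only shifts the principal logarithm by a real number, so it splits off
the root. The resulting $\sqrt\pi$ cancels the one in the spectral flow formula. -/
theorem two_pi_I_cpow_half : (2 * Real.pi * Complex.I : ℂ) ^ (1 / 2 : ℂ) =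
    (√Real.pi : ℂ) * (2 * Complex.I) ^ (1 / 2 : ℂ) := by
  have h : (2 * Real.pi * Complex.I : ℂ) = (Real.pi : ℂ) * (2 * Complex.I) := by ring
  have h2 : (2 * Complex.I : ℂ) ≠ 0 := by simp
  have h3 : (Real.pi : ℂ) ≠ 0 := Complex.ofReal_ne_zero.2 Real.pi_ne_zero
  rw [h, Complex.cpow_def_of_ne_zero (mul_ne_zero h3 h2), Complex.log_ofReal_mul Real.pi_pos h2,
    add_mul, Complex.exp_add, ← Complex.cpow_def_of_ne_zero h2, Real.sqrt_eq_rpow,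
    Complex.ofReal_cpow Real.pi_pos.le, Complex.cpow_def_of_ne_zero h3,
    Complex.ofReal_log Real.pi_pos.le]
  norm_num

end Main

end OddPairing

end

theorem mainTheorem2
    {A : Type*} [NormedRing A] [NormedAlgebra ℂ A] [StarRing A] [StarModule ℂ A]
    [Module (Polynomial ℂ) A] [IsScalarTower ℂ (Polynomial ℂ) A]
    (hA : OddPairing.IsModuleAlgebra A)
    {H : Type*} [NormedAddCommGroup H] [InnerProductSpace ℂ H] [CompleteSpace H]
    (ρ : A →⋆ₐ[ℂ] (H →L[ℂ] H)) (D : H →ₗ.[ℂ] H) (hD : OddPairing.IsOddThetaSummable ρ D)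
    (N : ℕ) (g : unitary (Matrix (Fin N) (Fin N) A))
    (prod : OddPairing.ExternalProduct)
    (hprod : prod = OddPairing.cup ∨ prod = OddPairing.cup') :
    -- the pairing for each `u`
    (∀ u ∈ Set.Icc (0 : ℝ) 1,
      OddPairing.IsTraceClass
        (OddPairing.ampRep N ρ
            (((g⁻¹ : unitary (Matrix (Fin N) (Fin N) A)) : Matrix (Fin N) (Fin N) A) *
              ((Polynomial.X : Polynomial ℂ) • (g : Matrix (Fin N) (Fin N) A))) *
          OddPairing.heat (OddPairing.path ρ D g u) 1) ∧
      Summable (OddPairing.pairingTerm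
        (OddPairing.oddCochain prod ρ (OddPairing.heat (OddPairing.path ρ D g u))) g) ∧
      OddPairing.pairing
          (OddPairing.oddCochain prod ρ (OddPairing.heat (OddPairing.path ρ D g u))) g =
        (1 / (2 * Real.pi * Complex.I) ^ (1 / 2 : ℂ) * ∑' n : ℕ, ((n : ℂ) + 1) / 2 ^ n) *
          OddPairing.trace
            (OddPairing.ampRep N ρ
                (((g⁻¹ : unitary (Matrix (Fin N) (Fin N) A)) : Matrix (Fin N) (Fin N) A) *
                  ((Polynomial.X : Polynomial ℂ) • (g : Matrix (Fin N) (Fin N) A))) *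
              OddPairing.heat (OddPairing.path ρ D g u) 1)) ∧
    -- its integral, when `X(g)` acts as the commutator `[D, g]`
    (OddPairing.Implements (OddPairing.ampOp N D) (OddPairing.ampRep N ρ g)
        (OddPairing.ampRep N ρ
          ((Polynomial.X : Polynomial ℂ) • (g : Matrix (Fin N) (Fin N) A))) →
      IntervalIntegrable (fun u => OddPairing.pairing
        (OddPairing.oddCochain prod ρ (OddPairing.heat (OddPairing.path ρ D g u))) g)
        MeasureTheory.volume 0 1 ∧
      (∃ m : ℤ, OddPairing.IsSpectralFlow (OddPairing.path ρ D g) m) ∧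
      ∀ m : ℤ, OddPairing.IsSpectralFlow (OddPairing.path ρ D g) m →
        ∫ u in (0 : ℝ)..1, OddPairing.pairing
          (OddPairing.oddCochain prod ρ (OddPairing.heat (OddPairing.path ρ D g u))) g =
        (1 / (2 * Complex.I) ^ (1 / 2 : ℂ) * ∑' n : ℕ, ((n : ℂ) + 1) / 2 ^ n) * (m : ℂ)) := by
  obtain ⟨T, hT, hfam⟩ := hD.exists_isEigenFamily g
  -- For the first part any bounded extension $T$ of $[D,g]$ serves, only to diagonalize $D_u$; it
  -- need not be related to $X(g)$.
  obtain ⟨ι, b, ev, h, -⟩ := hfam T hT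
  have he : ∀ u, OddPairing.heat (OddPairing.path ρ D g u) 0 = 1 := fun u =>
    OddPairing.heat_zero (h.basis u)
  have hterm := fun u => funext fun n =>
    OddPairing.pairingTerm_eq (ρ := ρ) (g := g) hA (he u) hprod n
  have hpair : ∀ u, OddPairing.pairing
      (OddPairing.oddCochain prod ρ (OddPairing.heat (OddPairing.path ρ D g u))) g =
      (1 / (2 * Real.pi * Complex.I) ^ (1 / 2 : ℂ) * ∑' n : ℕ, ((n : ℂ) + 1) / 2 ^ n) *
        OddPairing.trace (OddPairing.ampRep N ρ
          (((g⁻¹ : unitary (Matrix (Fin N) (Fin N) A)) : Matrix (Fin N) (Fin N) A) *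
            ((Polynomial.X : Polynomial ℂ) • (g : Matrix (Fin N) (Fin N) A))) *
          OddPairing.heat (OddPairing.path ρ D g u) 1) := fun u => by
    rw [OddPairing.pairing, hterm u, tsum_mul_right, ← mul_assoc]
  refine ⟨fun u _ => ⟨?_, ?_, hpair u⟩, fun hX => ?_⟩
  · exact (OddPairing.isTraceClass_heat (h.basis u) zero_le_one
      (h.summable u 1 one_pos)).comp_left _
  · rw [hterm u]
    exact OddPairing.summable_succ_div_two_pow.mul_right _
  -- Now $T=X(g)$, so the velocity of the path is exactly the operator $g^{-1}X(g)$ under the trace.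
  · obtain ⟨ι, b, ev, h, hends⟩ := hfam _ hX
    rw [← OddPairing.ampRep_mul] at h
    have hpair' : ∀ u, OddPairing.pairing
        (OddPairing.oddCochain prod ρ (OddPairing.heat (OddPairing.path ρ D g u))) g = _ :=
      fun u => (hpair u).trans (congrArg _ (h.trace_mul_heat_eq u))
    simp_rw [hpair']
    obtain ⟨m₀, hm₀⟩ := h.exists_isSpectralFlow
    have hint := (h.integral_eq_of_isSpectralFlow hm₀).1
    refine ⟨IntervalIntegrable.const_mul ⟨hint.1.ofReal, hint.2.ofReal⟩ _, ⟨m₀, hm₀⟩,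
      fun m hm => ?_⟩
    have hπ : (√Real.pi : ℂ) ≠ 0 := Complex.ofReal_ne_zero.2 (Real.sqrt_pos.2 Real.pi_pos).ne'
    rw [intervalIntegral.integral_const_mul, intervalIntegral.integral_ofReal,
      (h.integral_eq_of_isSpectralFlow hm).2, hends, sub_self, zero_add,
      OddPairing.two_pi_I_cpow_half]
    push_cast
    field_simp
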